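/- Let $R$ be a commutative ring, let $(r_1,\dots,r_n)$ be a regular sequence in $R$ (each $r_i$ is a non-zero-divisor on $R/(r_1,\dots,r_{i-1})$; $R/(r_1,\dots,r_n)$ may be zero), let $I=(r_1,\dots,r_n)$ and $S=R/I$. Let $U$ be a free $R$-module with basis $e_1,\dots,e_n$ and $W$ a free $S$-module with basis $f_1,\dots,f_n$. Tor is computed with projective resolutions of the second variable. For $s\ge 0$ let $$\delta^s\colon \mathrm{Tor}^R_*(S,I^s/I^{s+1})\to \mathrm{Tor}^R_{*-1}(S,I^{s+1}/I^{s+2})$$ be the connecting homomorphism (zero on $\mathrm{Tor}_0$) of $0\to I^{s+1}/I^{s+2}\to I^s/I^{s+2}\to I^s/I^{s+1}\to 0$, let $\delta^*=\bigoplus_s\delta^s$ be their sum, an endomorphism of $\bigoplus_{s}\mathrm{Tor}^R_*(S,I^s/I^{s+1})\cong \mathrm{Tor}^R_*(S,\mathrm{gr}_I(R))$, and let $\eta\colon S\cong \mathrm{Tor}^R_0(S,R)\to \mathrm{Tor}^R_0(S,S)\subseteq\mathrm{Tor}^R_*(S,S)$ be induced by the projection $R\to S$. Then the following hold. 1. The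 Koszul complex $K(r_1,\dots,r_n)=\Lambda^R_*(U)$, with its augmentation to $S$, is a projective resolution of $S$. Write $\kappa(x)\in \mathrm{Tor}^R_p(S,S)$ for the class of the cycle $1\otimes x$ of $S\otimes_R\Lambda^R_*(U)$, for $x\in\Lambda_p^R(U)$. 2. There is an isomorphism of graded algebras $\varphi\colon \mathrm{gr}_I(R)=\bigoplus_s I^s/I^{s+1}\cong \mathrm{Sym}_S^*(W)$ sending the class of $r_j$ in $I/I^2$ to $-f_j$. 3. There is an isomorphism of bigraded $S$-modules $$\psi\colon \bigoplus_{s\ge0}\mathrm{Tor}^R_*(S,I^s/I^{s+1})\;\cong\;\Lambda_*^{\mathrm{Sym}_S(W)}\bigl(\mathrm{Sym}_S(W)\otimes_R U\bigr)$$ such that $\psi(m_*\kappa(u_1\wedge\dots\wedge u_p))=\varphi(m)\cdot(1\otimes u_1)\wedge\dots\wedge(1\otimes u_p)$ for all $m\in I^s/I^{s+1}$ and $u_1,\dots,u_p\in U$, where $m_*$ is induced by the $R$-linear map $S\to I^s/I^{s+1}$, $1\mapsto m$. 4. Under $\psi$ the endomorphism $\delta^*$ corresponds to the Koszul differential $d_*$,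 the $\mathrm{Sym}_S(W)$-linear graded derivation with $d_*(1\otimes e_j)=f_j$; and $\psi\circ\eta$ (with $S$ identified with $I^0/I^1$) is the inclusion of $S$ as the part of bidegree $(0,0)$. 5. The sequence of graded $S$-modules $$0\to S\xrightarrow{\ \eta\ }\mathrm{Tor}^R_*(S,S)\xrightarrow{\ \delta^0\ }\mathrm{Tor}^R_{*-1}(S,I/I^2)\xrightarrow{\ \delta^1\ }\mathrm{Tor}^R_{*-2}(S,I^2/I^3)\xrightarrow{\ \delta^2\ }\cdots$$ is exact. -/

import Mathlib

open CategoryTheory Limits TensorProduct DirectSum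

universe u v w

namespace CategoryTheory

section Horseshoe
variable {C : Type u} [Category.{v} C] [Abelian C]

/-- A short exact sequence of projective resolutions lying over the short complex `S`. -/
structure ResolvedSequence (S : ShortComplex C) where
  P₁ : ProjectiveResolution S.X₁
  P₂ : ProjectiveResolution S.X₂
  P₃ : ProjectiveResolution S.X₃
  f : P₁.complex ⟶ P₂.complex
  g : P₂.complex ⟶ P₃.complex
  comm_f : f ≫ P₂.π = P₁.π ≫ (ChainComplex.single₀ C).map S.f
  comm_g : g ≫ P₃.π = P₂.π ≫ (ChainComplex.single₀ C).map S.g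
  zero : f ≫ g = 0
  shortExact : (ShortComplex.mk f g zero).ShortExact

namespace Horseshoe

/-- The augmentation of a projective resolution. -/
noncomputable def aug {Z : C} (P : ProjectiveResolution Z) : P.complex.X 0 ⟶ Z := P.π.f 0

instance instEpiAug {Z : C} (P : ProjectiveResolution Z) : Epi (aug P) :=
  inferInstanceAs (Epi (P.π.f 0))

lemma d_aug {Z : C} (P : ProjectiveResolution Z) : P.complex.d 1 0 ≫ aug P = 0 :=
  P.complex_d_comp_π_f_zero

lemma aug_exact {Z : C} (P : ProjectiveResolution Z) :
    (ShortComplex.mk _ _ (d_aug P)).Exact := P.exact₀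

lemma exists_theta {S : ShortComplex C} (P : ProjectiveResolution S.X₁)
    (Q : ProjectiveResolution S.X₃) (γ : Q.complex.X 1 ⟶ S.X₁) (hγ : Q.complex.d 2 1 ≫ γ = 0) :
    ∃ θ : ∀ n, Q.complex.X (n + 1) ⟶ P.complex.X n,
    θ 0 ≫ aug P = -γ ∧
    ∀ n, θ (n + 1) ≫ P.complex.d (n + 1) n + Q.complex.d (n + 2) (n + 1) ≫ θ n = 0 := by
  let z : Q.complex.X 1 ⟶ P.complex.X 0 := Projective.factorThru (-γ) (aug P)
  have hz : z ≫ aug P = -γ := Projective.factorThru_comp _ _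
  let o : Q.complex.X 2 ⟶ P.complex.X 1 :=
    (aug_exact P).liftFromProjective (-Q.complex.d 2 1 ≫ z) (by simp [hz, hγ])
  have ho : o ≫ P.complex.d 1 0 = -Q.complex.d 2 1 ≫ z :=
    (aug_exact P).liftFromProjective_comp _ _
  -- The resolution of `S.X₃` shifted down by one, with the negative differential.
  let T : ChainComplex C ℕ :=
    ChainComplex.of (fun n => Q.complex.X (n + 1)) (fun n => -Q.complex.d (n + 2) (n + 1))
      (fun n => by simp)
  have hT (n : ℕ) : T.d (n + 1) n = -Q.complex.d (n + 2) (n + 1) :=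
    ChainComplex.of_d (fun n => Q.complex.X (n + 1)) (fun n => -Q.complex.d (n + 2) (n + 1)) n
  have hp (n : ℕ) : Projective (T.X n) := Q.projective (n + 1)
  let F : T ⟶ P.complex := ChainComplex.mkHom _ _ z o
    (by rw [hT]; simpa using ho)
    (fun n p => ⟨(P.exact_succ n).liftFromProjective
      (T.d (n + 2) (n + 1) ≫ p.2.1) (by
        change (T.d (n + 2) (n + 1) ≫ p.2.1) ≫ P.complex.d (n + 1) n = 0
        rw [Category.assoc, p.2.2]; simp),
      (P.exact_succ n).liftFromProjective_comp _ _⟩)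
  refine ⟨fun n => F.f n, hz, fun n => ?_⟩
  have := F.comm (n + 1) n
  rw [hT] at this
  change F.f (n + 1) ≫ P.complex.d (n + 1) n + _ = 0
  rw [this]
  change (-Q.complex.d (n + 2) (n + 1)) ≫ F.f n + _ = 0
  simp

lemma homology_isZero {Z : C} (P : ProjectiveResolution Z) (n : ℕ) :
    IsZero (P.complex.homology (n + 1)) :=
  (HomologicalComplex.exactAt_iff_isZero_homology _ _).1 (P.complex_exactAt_succ n)

end Horseshoe

open Horseshoe in
/-- The horseshoe lemma. -/
lemma exists_resolvedSequence [EnoughProjectives C] {S : ShortComplex C} (hS : S.ShortExact) :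
    Nonempty (ResolvedSequence S) := by
  have := hS.epi_g
  have := hS.mono_f
  let P := projectiveResolution S.X₁
  let Q := projectiveResolution S.X₃
  let lam : Q.complex.X 0 ⟶ S.X₂ := Projective.factorThru (aug Q) S.g
  have hlam : lam ≫ S.g = aug Q := Projective.factorThru_comp _ _
  let γ : Q.complex.X 1 ⟶ S.X₁ := hS.exact.lift (Q.complex.d 1 0 ≫ lam)
    (by rw [Category.assoc, hlam, d_aug])
  have hγf : γ ≫ S.f = Q.complex.d 1 0 ≫ lam := hS.exact.lift_f _ _
  have hγ : Q.complex.d 2 1 ≫ γ = 0 := by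
    rw [← cancel_mono S.f, Category.assoc, hγf]; simp
  obtain ⟨θ, hθ0, hθ⟩ := exists_theta P Q γ hγ
  let dM (n : ℕ) : P.complex.X (n + 1) ⊞ Q.complex.X (n + 1) ⟶ P.complex.X n ⊞ Q.complex.X n :=
    biprod.desc (P.complex.d (n + 1) n ≫ biprod.inl)
      (θ n ≫ biprod.inl + Q.complex.d (n + 1) n ≫ biprod.inr)
  have hdM (n : ℕ) : dM (n + 1) ≫ dM n = 0 := by
    apply biprod.hom_ext'
    · simp [dM]
    · have := hθ n
      simp only [dM, biprod.inr_desc_assoc, comp_zero, Preadditive.add_comp, Category.assoc,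
        biprod.inl_desc, biprod.inr_desc, Preadditive.comp_add]
      rw [HomologicalComplex.d_comp_d_assoc, zero_comp, add_zero, ← Category.assoc,
        ← Category.assoc, ← Preadditive.add_comp, this, zero_comp]
  let M : ChainComplex C ℕ := ChainComplex.of (fun n => P.complex.X n ⊞ Q.complex.X n) dM hdM
  have hM (n : ℕ) : M.d (n + 1) n = dM n :=
    ChainComplex.of_d (fun n => P.complex.X n ⊞ Q.complex.X n) dM n
  let εM : M.X 0 ⟶ S.X₂ := biprod.desc (aug P ≫ S.f) lam
  have hεM : M.d 1 0 ≫ εM = 0 := by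
    rw [hM]
    apply biprod.hom_ext'
    · simp only [dM, εM, biprod.inl_desc_assoc, Category.assoc, biprod.inl_desc, comp_zero]
      rw [← Category.assoc, d_aug, zero_comp]
    · simp only [dM, εM, biprod.inr_desc_assoc, Category.assoc, biprod.inl_desc, comp_zero,
        Preadditive.add_comp, biprod.inr_desc]
      rw [← Category.assoc, hθ0, ← hγf]; simp
  let f : P.complex ⟶ M := ChainComplex.ofHom (fun n => biprod.inl) (fun n => by
    rw [hM]; simp [dM])
  let g : M ⟶ Q.complex := ChainComplex.ofHom (fun n => biprod.snd) (fun n => by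
    rw [hM]
    apply biprod.hom_ext' <;> simp [dM])
  have hfg : f ≫ g = 0 := by
    ext n
    exact biprod.inl_snd
  have hse : (ShortComplex.mk f g hfg).ShortExact := by
    apply HomologicalComplex.shortExact_of_degreewise_shortExact
    intro n
    exact (ShortComplex.Splitting.ofHasBinaryBiproduct (P.complex.X n) (Q.complex.X n)).shortExact
  let πM : M ⟶ (ChainComplex.single₀ C).obj S.X₂ := (ChainComplex.toSingle₀Equiv M S.X₂).symm ⟨εM, hεM⟩
  have hπM : πM.f 0 = εM := ChainComplex.toSingle₀Equiv_symm_apply_f_zero _ _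
  have cf : f ≫ πM = P.π ≫ (ChainComplex.single₀ C).map S.f := by
    apply HomologicalComplex.to_single_hom_ext
    change biprod.inl ≫ πM.f 0 = P.π.f 0 ≫ ((ChainComplex.single₀ C).map S.f).f 0
    rw [hπM]
    change biprod.inl ≫ biprod.desc (aug P ≫ S.f) lam = aug P ≫ _
    rw [biprod.inl_desc, ChainComplex.single₀_map_f_zero]
  have cg : g ≫ Q.π = πM ≫ (ChainComplex.single₀ C).map S.g := by
    apply HomologicalComplex.to_single_hom_ext
    change biprod.snd ≫ Q.π.f 0 = πM.f 0 ≫ ((ChainComplex.single₀ C).map S.g).f 0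
    rw [hπM, ChainComplex.single₀_map_f_zero]
    change biprod.snd ≫ aug Q = biprod.desc (aug P ≫ S.f) lam ≫ S.g
    apply biprod.hom_ext'
    · simp
    · simp [hlam]
  have hq : QuasiIso πM := by
    rw [quasiIso_iff]
    rintro (_ | n)
    · rw [quasiIsoAt_iff_isIso_homologyMap]
      let S₁ : ShortComplex C := (ShortComplex.mk f g hfg).map
        (HomologicalComplex.homologyFunctor C _ 0)
      let S₂ : ShortComplex C := S.map ((ChainComplex.single₀ C) ⋙
        HomologicalComplex.homologyFunctor C _ 0)
      let φ : S₁ ⟶ S₂ :=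
        { τ₁ := HomologicalComplex.homologyMap P.π 0
          τ₂ := HomologicalComplex.homologyMap πM 0
          τ₃ := HomologicalComplex.homologyMap Q.π 0
          comm₁₂ := by
            change HomologicalComplex.homologyMap _ 0 ≫ HomologicalComplex.homologyMap _ 0 =
              HomologicalComplex.homologyMap _ 0 ≫ HomologicalComplex.homologyMap _ 0
            rw [← HomologicalComplex.homologyMap_comp, ← HomologicalComplex.homologyMap_comp, cf]
          comm₂₃ := by
            change HomologicalComplex.homologyMap _ 0 ≫ HomologicalComplex.homologyMap _ 0 =
              HomologicalComplex.homologyMap _ 0 ≫ HomologicalComplex.homologyMap _ 0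
            rw [← HomologicalComplex.homologyMap_comp, ← HomologicalComplex.homologyMap_comp, cg] }
      have h₁ : S₁.ShortExact :=
        { exact := hse.homology_exact₂ 0
          mono_f := (hse.homology_exact₁ 1 0 (by simp)).mono_g
            ((homology_isZero Q 0).eq_of_src _ _)
          epi_g := by
            have : ∀ n, Epi (g.f n) := fun n => inferInstanceAs (Epi (biprod.snd))
            exact HomologicalComplex.epi_homologyMap_of_epi_of_not_rel g 0 (by simp) }
      have h₂ : S₂.ShortExact :=
        ShortComplex.shortExact_of_iso (S.mapNatIso
          (HomologicalComplex.homologyFunctorSingleIso C (ComplexShape.down ℕ) 0).symm)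
          (show (S.map (𝟭 C)).ShortExact from hS)
      have i₁ : IsIso φ.τ₁ := inferInstanceAs (IsIso (HomologicalComplex.homologyMap P.π 0))
      have i₃ : IsIso φ.τ₃ := inferInstanceAs (IsIso (HomologicalComplex.homologyMap Q.π 0))
      exact ShortComplex.isIso₂_of_shortExact_of_isIso₁₃ φ h₁ h₂
    · rw [quasiIsoAt_iff_exactAt' _ _ (ChainComplex.exactAt_succ_single_obj _ _)]
      exact hse.exactAt_X₂ _ (P.complex_exactAt_succ n) (Q.complex_exactAt_succ n)
  exact ⟨{
    P₁ := P
    P₂ := { complex := M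
            projective := fun n => inferInstanceAs (Projective (P.complex.X n ⊞ Q.complex.X n))
            π := πM
            quasiIso := hq }
    P₃ := Q
    f := f
    g := g
    comm_f := cf
    comm_g := cg
    zero := hfg
    shortExact := hse }⟩

variable {D : Type w} [Category.{v} D] [Abelian D]

lemma ResolvedSequence.shortExact_map {S : ShortComplex C} (T : ResolvedSequence S) (F : C ⥤ D)
    [F.Additive] : ((ShortComplex.mk T.f T.g T.zero).map
      (F.mapHomologicalComplex (ComplexShape.down ℕ))).ShortExact := by
  apply HomologicalComplex.shortExact_of_degreewise_shortExact
  intro n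
  have h := T.shortExact.map_of_exact (HomologicalComplex.eval C (ComplexShape.down ℕ) n)
  have : Projective ((ShortComplex.mk T.f T.g T.zero).map
    (HomologicalComplex.eval C (ComplexShape.down ℕ) n)).X₃ := T.P₃.projective n
  exact (h.splittingOfProjective.map F).shortExact

/-- The connecting homomorphism `L_{n+1}F(S.X₃) ⟶ L_n F(S.X₁)` computed with a given short exact
sequence of projective resolutions: the snake-lemma map in homology, without further sign. -/
noncomputable def ResolvedSequence.δ [EnoughProjectives C] {S : ShortComplex C} (T : ResolvedSequence S) (F : C ⥤ D)
    [F.Additive] (n : ℕ) : (F.leftDerived (n + 1)).obj S.X₃ ⟶ (F.leftDerived n).obj S.X₁ :=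
  (T.P₃.isoLeftDerivedObj F (n + 1)).hom ≫ (T.shortExact_map F).δ (n + 1) n rfl ≫
    (T.P₁.isoLeftDerivedObj F n).inv

/-- The connecting homomorphism `L_{n+1}F(S.X₃) ⟶ L_n F(S.X₁)` of a left derived functor. -/
noncomputable def leftDerivedδ [EnoughProjectives C] (F : C ⥤ D) [F.Additive] {S : ShortComplex C} (hS : S.ShortExact)
    (n : ℕ) : (F.leftDerived (n + 1)).obj S.X₃ ⟶ (F.leftDerived n).obj S.X₁ :=
  (exists_resolvedSequence hS).some.δ F n

end Horseshoe
end CategoryTheory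

namespace KoszulTor

section Koszul
variable {A : Type*} {M : Type*} [CommRing A] [AddCommGroup M] [Module A M]

/-- The Koszul differential on the exterior algebra: the contraction with the linear form `ξ`, that
is, the unique antiderivation `d` with `d (a ∧ x) = ξ a • x - a ∧ d x` for `a` of degree one. -/
noncomputable def koszulD (ξ : M →ₗ[A] A) : ExteriorAlgebra A M →ₗ[A] ExteriorAlgebra A M :=
  CliffordAlgebra.contractLeft (Q := (0 : QuadraticForm A M)) ξ

lemma koszulD_ι_mul (ξ : M →ₗ[A] A) (a : M) (x : ExteriorAlgebra A M) :
    koszulD ξ (ExteriorAlgebra.ι A a * x) = ξ a • x - ExteriorAlgebra.ι A a * koszulD ξ x :=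
  CliffordAlgebra.contractLeft_ι_mul (Q := (0 : QuadraticForm A M)) ξ a x

lemma koszulD_algebraMap (ξ : M →ₗ[A] A) (a : A) :
    koszulD ξ (algebraMap A _ a) = 0 :=
  CliffordAlgebra.contractLeft_algebraMap (Q := (0 : QuadraticForm A M)) ξ a

lemma koszulD_koszulD (ξ : M →ₗ[A] A) (x : ExteriorAlgebra A M) :
    koszulD ξ (koszulD ξ x) = 0 :=
  CliffordAlgebra.contractLeft_contractLeft (Q := (0 : QuadraticForm A M)) ξ x

lemma koszulD_mem_smul (ξ : M →ₗ[A] A) (I : Ideal A) (hξ : ∀ m, ξ m ∈ I) (p : ℕ) :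
    ∀ x ∈ ⋀[A]^(p + 1) M, koszulD ξ x ∈ I • (⋀[A]^p M) := by
  induction p with
  | zero =>
    intro x hx
    change x ∈ LinearMap.range (ExteriorAlgebra.ι A : M →ₗ[A] ExteriorAlgebra A M) ^ (0 + 1) at hx
    rw [zero_add, pow_one] at hx
    obtain ⟨a, rfl⟩ := hx
    have := koszulD_ι_mul ξ a 1
    rw [mul_one, ← map_one (algebraMap A (ExteriorAlgebra A M)), koszulD_algebraMap,
      mul_zero, sub_zero] at this
    rw [this]
    refine Submodule.smul_mem_smul (hξ a) ?_
    change _ ∈ LinearMap.range (ExteriorAlgebra.ι A : M →ₗ[A] ExteriorAlgebra A M) ^ 0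
    rw [pow_zero, map_one]
    exact Submodule.one_le.1 le_rfl
  | succ p ih =>
    intro x hx
    change x ∈ LinearMap.range (ExteriorAlgebra.ι A : M →ₗ[A] ExteriorAlgebra A M) ^ (p + 1 + 1) at hx
    rw [pow_succ'] at hx
    refine Submodule.mul_induction_on hx ?_ ?_
    · rintro _ ⟨a, rfl⟩ y hy
      rw [koszulD_ι_mul]
      refine sub_mem (Submodule.smul_mem_smul (hξ a) hy) ?_
      refine Submodule.smul_induction_on (ih y hy) ?_ ?_
      · intro c hc z hz
        rw [mul_smul_comm]
        refine Submodule.smul_mem_smul hc ?_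
        change _ ∈ LinearMap.range (ExteriorAlgebra.ι A : M →ₗ[A] ExteriorAlgebra A M) ^ (p + 1)
        rw [pow_succ']
        exact Submodule.mul_mem_mul ⟨a, rfl⟩ hz
      · intro z w hz hw
        rw [mul_add]
        exact add_mem hz hw
    · intro y z hy hz
      rw [map_add]
      exact add_mem hy hz

lemma koszulD_mem (ξ : M →ₗ[A] A) (p : ℕ) :
    ∀ x ∈ ⋀[A]^(p + 1) M, koszulD ξ x ∈ ⋀[A]^p M := fun x hx => by
  have := koszulD_mem_smul ξ ⊤ (fun _ => trivial) p x hx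
  rwa [Submodule.top_smul] at this

/-- The Koszul differential `⋀^{p+1} M → ⋀^p M`. -/
noncomputable def koszulDeg (ξ : M →ₗ[A] A) (p : ℕ) : ⋀[A]^(p + 1) M →ₗ[A] ⋀[A]^p M :=
  (koszulD ξ).restrict (koszulD_mem ξ p)

lemma koszulDeg_mem (ξ : M →ₗ[A] A) (I : Ideal A) (hξ : ∀ m, ξ m ∈ I) (p : ℕ)
    (x : ⋀[A]^(p + 1) M) : koszulDeg ξ p x ∈ I • (⊤ : Submodule A (⋀[A]^p M)) := by
  have h := koszulD_mem_smul ξ I hξ p x x.2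
  have e : Submodule.map (Submodule.subtype (⋀[A]^p M)) (I • ⊤) = I • (⋀[A]^p M) := by
    rw [Submodule.map_smul'', Submodule.map_top, Submodule.range_subtype]
  rw [← e] at h
  obtain ⟨y, hy, hyx⟩ := h
  have : y = koszulDeg ξ p x := Subtype.ext hyx
  exact this ▸ hy

end Koszul

section KoszulComplex
variable {R : Type u} [CommRing R] {U : Type u} [AddCommGroup U] [Module R U]

/-- The Koszul complex `⋯ → ⋀^2 U → ⋀^1 U → ⋀^0 U` of a linear form `ξ` on `U`. -/
noncomputable def koszulComplex (ξ : U →ₗ[R] R) : ChainComplex (ModuleCat.{u} R) ℕ :=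
  ChainComplex.of (fun p => ModuleCat.of R (⋀[R]^p U)) (fun p => ModuleCat.ofHom (koszulDeg ξ p))
    (fun p => by
      refine ModuleCat.hom_ext (LinearMap.ext fun x => Subtype.ext ?_)
      exact koszulD_koszulD ξ x.1)

lemma koszulComplex_d (ξ : U →ₗ[R] R) (p : ℕ) :
    (koszulComplex ξ).d (p + 1) p = ModuleCat.ofHom (koszulDeg ξ p) :=
  ChainComplex.of_d (fun p => ModuleCat.of R (⋀[R]^p U))
    (fun p => ModuleCat.ofHom (koszulDeg ξ p)) p

variable (ξ : U →ₗ[R] R) (I : Ideal R) (hξ : ∀ m, ξ m ∈ I)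

/-- The augmentation of the Koszul complex: in degree zero, `⋀^0 U = R → R ⧸ I`. -/
noncomputable def koszulAug : koszulComplex ξ ⟶
    (ChainComplex.single₀ (ModuleCat.{u} R)).obj (ModuleCat.of R (R ⧸ I)) :=
  (ChainComplex.toSingle₀Equiv _ _).symm
    ⟨ModuleCat.ofHom (I.mkQ ∘ₗ (exteriorPower.zeroEquiv R U).toLinearMap), by
      rw [koszulComplex_d]
      ext x
      have h := koszulDeg_mem ξ I hξ 0 x
      change Submodule.Quotient.mk (exteriorPower.zeroEquiv R U (koszulDeg ξ 0 x)) = 0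
      rw [Submodule.Quotient.mk_eq_zero]
      refine Submodule.smul_induction_on h ?_ ?_
      · intro c hc y _
        rw [map_smul]
        exact I.mul_mem_right _ hc
      · intro y z hy hz
        rw [map_add]
        exact add_mem hy hz⟩

end KoszulComplex

section gr
variable {R : Type u} [CommRing R] (I : Ideal R)

/-- The `R`-module `I^a / I^b`, for `a ≤ b`. -/
abbrev PowQuot (a b : ℕ) : Type u :=
  (I ^ a : Submodule R R) ⧸ (I ^ b : Submodule R R).submoduleOf (I ^ a)

/-- The component `I^s / I^{s+1}` of the associated graded ring of `R`. -/
abbrev Gr (s : ℕ) : Type u := PowQuot I s (s + 1)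

variable {I} in
/-- The residue class in `I^s / I^{s+1}` of an element of `I^s`. -/
def Gr.mk {s : ℕ} (x : R) (hx : x ∈ I ^ s) : Gr I s := Submodule.Quotient.mk ⟨x, hx⟩

lemma Gr.mk_eq {s : ℕ} {x y : R} (hx : x ∈ I ^ s) (hy : y ∈ I ^ s) :
    Gr.mk x hx = Gr.mk y hy ↔ x - y ∈ I ^ (s + 1) :=
  Submodule.Quotient.eq _

lemma Gr.ind {s : ℕ} {P : Gr I s → Prop} (h : ∀ x hx, P (Gr.mk x hx)) (m : Gr I s) : P m := by
  obtain ⟨⟨x, hx⟩, rfl⟩ := Submodule.Quotient.mk_surjective _ m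
  exact h x hx

variable {I}

lemma Gr.mul_mem {s t : ℕ} {x y : R} (hx : x ∈ I ^ s) (hy : y ∈ I ^ t) :
    x * y ∈ I ^ (s + t) := by
  rw [pow_add]; exact Ideal.mul_mem_mul hx hy

/-- The product `I^s/I^{s+1} × I^t/I^{t+1} → I^{s+t}/I^{s+t+1}` induced by that of `R`. -/
def Gr.mul {s t : ℕ} : Gr I s → Gr I t → Gr I (s + t) :=
  Quotient.map₂ (fun x y => ⟨x.1 * y.1, Gr.mul_mem x.2 y.2⟩) (by
    intro x x' hx y y' hy
    have hx' : x.1 - x'.1 ∈ I ^ (s + 1) :=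
      (Submodule.quotientRel_def ((I ^ (s + 1) : Submodule R R).submoduleOf (I ^ s))).1 hx
    have hy' : y.1 - y'.1 ∈ I ^ (t + 1) :=
      (Submodule.quotientRel_def ((I ^ (t + 1) : Submodule R R).submoduleOf (I ^ t))).1 hy
    refine (Submodule.quotientRel_def _).2 ?_
    change x.1 * y.1 - x'.1 * y'.1 ∈ I ^ (s + t + 1)
    have e : x.1 * y.1 - x'.1 * y'.1 = (x.1 - x'.1) * y.1 + x'.1 * (y.1 - y'.1) := by ring
    rw [e]
    have h2 : x'.1 * (y.1 - y'.1) ∈ I ^ (s + t + 1) := Gr.mul_mem (t := t + 1) x'.2 hy'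
    refine add_mem ?_ h2
    have := Gr.mul_mem hx' y.2
    rwa [add_right_comm] at this)

lemma Gr.mk_mul_mk {s t : ℕ} {x y : R} (hx : x ∈ I ^ s) (hy : y ∈ I ^ t) :
    Gr.mul (Gr.mk x hx) (Gr.mk y hy) = Gr.mk (x * y) (Gr.mul_mem hx hy) := rfl

lemma Gr.mk_add_mk {s : ℕ} {x y : R} (hx : x ∈ I ^ s) (hy : y ∈ I ^ s) :
    Gr.mk x hx + Gr.mk y hy = Gr.mk (x + y) (add_mem hx hy) := rfl

lemma Gr.smul_mk {s : ℕ} (r : R) {x : R} (hx : x ∈ I ^ s)  :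
    r • Gr.mk x hx = Gr.mk (r * x) (Ideal.mul_mem_left _ r hx) := rfl

lemma Gr.zero_eq (s : ℕ) : (0 : Gr I s) = Gr.mk 0 (zero_mem _) := rfl

lemma Gr.mem_zero (x : R) : x ∈ I ^ 0 := by simp

lemma Gr.sigma_eq {s t : ℕ} (h : s = t) {x y : R} (hx : x ∈ I ^ s) (hy : y ∈ I ^ t) (hxy : x = y) :
    GradedMonoid.mk (A := Gr I) s (Gr.mk x hx) = GradedMonoid.mk t (Gr.mk y hy) := by
  subst h; subst hxy; rfl

instance instGMulGr : GradedMonoid.GMul (Gr I) := ⟨Gr.mul⟩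

instance instGOneGr : GradedMonoid.GOne (Gr I) := ⟨Gr.mk 1 (Gr.mem_zero 1)⟩

instance instGMonoidGr : GradedMonoid.GMonoid (Gr I) where
  one_mul a := by
    obtain ⟨s, a⟩ := a
    induction a using Gr.ind
    exact Gr.sigma_eq (zero_add s) _ _ (one_mul _)
  mul_one a := by
    obtain ⟨s, a⟩ := a
    induction a using Gr.ind
    exact Gr.sigma_eq (add_zero s) _ _ (mul_one _)
  mul_assoc a b c := by
    obtain ⟨s, a⟩ := a
    obtain ⟨t, b⟩ := b
    obtain ⟨r, c⟩ := c
    induction a using Gr.ind; induction b using Gr.ind; induction c using Gr.ind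
    exact Gr.sigma_eq (add_assoc s t r) _ _ (mul_assoc _ _ _)
instance instGCommRingGr : DirectSum.GCommRing (Gr I) where
  mul_zero a := by
    induction a using Gr.ind
    change Gr.mul _ (Gr.mk 0 (zero_mem _)) = Gr.mk 0 (zero_mem _)
    rw [Gr.mk_mul_mk, Gr.mk_eq]; simp
  zero_mul a := by
    induction a using Gr.ind
    change Gr.mul (Gr.mk 0 (zero_mem _)) _ = Gr.mk 0 (zero_mem _)
    rw [Gr.mk_mul_mk, Gr.mk_eq]; simp
  mul_add a b c := by
    induction a using Gr.ind; induction b using Gr.ind; induction c using Gr.ind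
    change Gr.mul _ (_ + _) = Gr.mul _ _ + Gr.mul _ _
    simp only [Gr.mk_mul_mk, Gr.mk_add_mk, mul_add]
  add_mul a b c := by
    induction a using Gr.ind; induction b using Gr.ind; induction c using Gr.ind
    change Gr.mul (_ + _) _ = Gr.mul _ _ + Gr.mul _ _
    simp only [Gr.mk_mul_mk, Gr.mk_add_mk, add_mul]
  mul_comm a b := by
    obtain ⟨s, a⟩ := a
    obtain ⟨t, b⟩ := b
    induction a using Gr.ind; induction b using Gr.ind
    exact Gr.sigma_eq (add_comm s t) _ _ (mul_comm _ _)
  natCast n := Gr.mk (n : R) (Gr.mem_zero _)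
  natCast_zero := by rw [Gr.zero_eq, Gr.mk_eq]; simp
  natCast_succ n := by
    change _ = Gr.mk _ _ + Gr.mk _ _
    rw [Gr.mk_add_mk, Gr.mk_eq]; simp
  intCast n := Gr.mk (n : R) (Gr.mem_zero _)
  intCast_ofNat n := by rw [Gr.mk_eq]; simp
  intCast_negSucc_ofNat n := by
    change _ = Gr.mk (-((n + 1 : ℕ) : R)) _
    rw [Gr.mk_eq]; simp

instance instGAlgebraGr : DirectSum.GAlgebra R (Gr I) where
  toFun :=
    { toFun := fun r => Gr.mk r (Gr.mem_zero r)
      map_zero' := rfl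
      map_add' := fun _ _ => rfl }
  map_one := rfl
  map_mul r s := Gr.sigma_eq (add_zero 0).symm (Gr.mem_zero (r * s))
    (Gr.mul_mem (Gr.mem_zero r) (Gr.mem_zero s)) rfl
  commutes r a := by
    obtain ⟨s, a⟩ := a
    induction a using Gr.ind
    exact Gr.sigma_eq (add_comm 0 s) (Gr.mul_mem (Gr.mem_zero r) ‹_›)
      (Gr.mul_mem ‹_› (Gr.mem_zero r)) (mul_comm _ _)
  smul_def r a := by
    obtain ⟨s, a⟩ := a
    induction a using Gr.ind
    exact Gr.sigma_eq (zero_add s).symm (Ideal.mul_mem_left _ r ‹_›)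
      (Gr.mul_mem (Gr.mem_zero r) ‹_›) rfl

lemma Gr.ideal_smul {s : ℕ} (r : R) (hr : r ∈ I) (m : Gr I s) : r • m = 0 := by
  induction m using Gr.ind with | h x hx
  rw [Gr.smul_mk, Gr.zero_eq, Gr.mk_eq, sub_zero, pow_succ']
  exact Ideal.mul_mem_mul hr hx

/-- The `R`-linear map `R/I → I^s/I^{s+1}` sending `1` to `m`. -/
noncomputable def Gr.act {s : ℕ} (m : Gr I s) : (R ⧸ I) →ₗ[R] Gr I s :=
  Submodule.liftQ I (LinearMap.toSpanSingleton R _ m) (fun r hr => Gr.ideal_smul r hr m)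


variable (I)
/-- The canonical injection `I^{s+1}/I^{s+2} → I^s/I^{s+2}`. -/
def powMid (s : ℕ) : PowQuot I (s + 1) (s + 2) →ₗ[R] PowQuot I s (s + 2) :=
  Submodule.mapQ _ _ (Submodule.inclusion (Ideal.pow_le_pow_right (Nat.le_succ s)))
    (fun _ h => h)

/-- The canonical projection `I^s/I^{s+2} → I^s/I^{s+1}`. -/
def powProj (s : ℕ) : PowQuot I s (s + 2) →ₗ[R] PowQuot I s (s + 1) :=
  Submodule.factor (fun _ h => Ideal.pow_le_pow_right (Nat.le_succ (s + 1)) h)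

/-- `0 → I^{s+1}/I^{s+2} → I^s/I^{s+2} → I^s/I^{s+1} → 0`. -/
def powSequence (s : ℕ) : ShortComplex (ModuleCat.{u} R) :=
  ShortComplex.mk (X₁ := ModuleCat.of R (Gr I (s + 1))) (X₂ := ModuleCat.of R (PowQuot I s (s + 2)))
    (X₃ := ModuleCat.of R (Gr I s)) (ModuleCat.ofHom (powMid I s)) (ModuleCat.ofHom (powProj I s))
    (by
      refine ModuleCat.hom_ext (LinearMap.ext fun m => ?_)
      induction m using Gr.ind with | h x hx
      exact (Gr.mk_eq I _ (zero_mem _)).2 (by simpa using hx))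

lemma powSequence_shortExact (s : ℕ) : (powSequence I s).ShortExact := by
  apply ModuleCat.shortComplex_shortExact
  · intro m
    obtain ⟨⟨x, hx⟩, rfl⟩ := Submodule.Quotient.mk_surjective _ m
    constructor
    · intro h
      have h' : x ∈ I ^ (s + 1) :=
        (Submodule.Quotient.mk_eq_zero ((I ^ (s + 1) : Submodule R R).submoduleOf (I ^ s))).1 h
      exact ⟨Gr.mk x h', rfl⟩
    · rintro ⟨y, hy⟩
      rw [← hy]
      exact congrArg (fun f => f.hom y) (powSequence I s).zero
  · refine (injective_iff_map_eq_zero _).2 fun m h => ?_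
    obtain ⟨⟨x, hx⟩, rfl⟩ := Submodule.Quotient.mk_surjective _ m
    exact (Submodule.Quotient.mk_eq_zero _).2
      (show x ∈ I ^ (s + 2) from (Submodule.Quotient.mk_eq_zero
        ((I ^ (s + 2) : Submodule R R).submoduleOf (I ^ s))).1 h)
  · intro m
    induction m using Gr.ind with | h x hx
    exact ⟨Submodule.Quotient.mk ⟨x, hx⟩, rfl⟩
end gr


section Main
variable {R : Type u} [CommRing R] (I : Ideal R)

/-- `Tor_p^R(R/I, N)`, computed by projective resolutions of `N`. Its `R/I`-module structure is the
one induced by its `R`-module structure; as `R → R/I` is surjective, `R/I`-linear maps are the same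
as `R`-linear maps. -/
noncomputable abbrev TorQ (N : Type u) [AddCommGroup N] [Module R N] (p : ℕ) : ModuleCat.{u} R :=
  ((Tor (ModuleCat.{u} R) p).obj (ModuleCat.of R (R ⧸ I))).obj (ModuleCat.of R N)

/-- The graded module `Tor_*^R(R/I, N)`. -/
abbrev TorTot (N : Type u) [AddCommGroup N] [Module R N] : Type u := ⨁ p : ℕ, TorQ I N p

/-- The bigraded module `⨁_s Tor_*^R(R/I, I^s/I^{s+1})`. -/
abbrev TorGr : Type u := ⨁ s : ℕ, TorTot I (Gr I s)

/-- The map on `Tor_p^R(R/I, -)` induced by an `R`-linear map. -/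
noncomputable def torMap {N N' : Type u} [AddCommGroup N] [Module R N] [AddCommGroup N']
    [Module R N'] (f : N →ₗ[R] N') (p : ℕ) : TorQ I N p →ₗ[R] TorQ I N' p :=
  (((Tor (ModuleCat.{u} R) p).obj (ModuleCat.of R (R ⧸ I))).map (ModuleCat.ofHom f)).hom

/-- The map on `Tor_*^R(R/I, -)` induced by an `R`-linear map. -/
noncomputable def torTotMap {N N' : Type u} [AddCommGroup N] [Module R N] [AddCommGroup N']
    [Module R N'] (f : N →ₗ[R] N') : TorTot I N →ₗ[R] TorTot I N' :=
  DirectSum.lmap (fun p => torMap I f p)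

/-- The connecting homomorphism `Tor_{p+1}^R(R/I, I^s/I^{s+1}) → Tor_p^R(R/I, I^{s+1}/I^{s+2})`. -/
noncomputable def deltaDeg (s p : ℕ) :
    TorQ I (Gr I s) (p + 1) →ₗ[R] TorQ I (Gr I (s + 1)) p :=
  (leftDerivedδ ((MonoidalCategory.tensoringLeft (ModuleCat.{u} R)).obj (ModuleCat.of R (R ⧸ I)))
    (powSequence_shortExact I s) p).hom

/-- `δ^s : Tor_*^R(R/I, I^s/I^{s+1}) → Tor_{*-1}^R(R/I, I^{s+1}/I^{s+2})`; it is zero on `Tor_0`. -/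
noncomputable def delta (s : ℕ) : TorTot I (Gr I s) →ₗ[R] TorTot I (Gr I (s + 1)) :=
  DirectSum.toModule R ℕ _ fun p => match p with
    | 0 => 0
    | p + 1 => DirectSum.lof R ℕ (fun p => TorQ I (Gr I (s + 1)) p) p ∘ₗ deltaDeg I s p

/-- The direct sum `δ^*` of the connecting homomorphisms `δ^s`. -/
noncomputable def deltaTot : TorGr I →ₗ[R] TorGr I :=
  DirectSum.toModule R ℕ _ fun s =>
    DirectSum.lof R ℕ (fun s => TorTot I (Gr I s)) (s + 1) ∘ₗ delta I s

/-- `η : R/I ≅ Tor_0^R(R/I, R) → Tor_0^R(R/I, R/I)`. -/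
noncomputable def etaZero : (R ⧸ I) →ₗ[R] TorQ I (R ⧸ I) 0 :=
  ((MonoidalCategory.rightUnitor (ModuleCat.of R (R ⧸ I))).inv ≫
    (((MonoidalCategory.tensoringLeft (ModuleCat.{u} R)).obj
      (ModuleCat.of R (R ⧸ I))).leftDerivedZeroIsoSelf.inv.app (ModuleCat.of R R)) ≫
    ((Tor (ModuleCat.{u} R) 0).obj (ModuleCat.of R (R ⧸ I))).map (ModuleCat.ofHom I.mkQ)).hom

/-- The map `η : R/I → Tor_*^R(R/I, R/I)`, with image in degree zero. -/
noncomputable def eta : (R ⧸ I) →ₗ[R] TorTot I (R ⧸ I) :=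
  DirectSum.lof R ℕ (fun p => TorQ I (R ⧸ I) p) 0 ∘ₗ etaZero I

/-- `R/I ≅ I^0/I^1`. -/
noncomputable def unitGr : (R ⧸ I) →ₗ[R] Gr I 0 := Gr.act (Gr.mk 1 (Gr.mem_zero 1))

/-- `δ^0` as a map `Tor_*^R(R/I, R/I) → Tor_{*-1}^R(R/I, I/I^2)`. -/
noncomputable def deltaZero : TorTot I (R ⧸ I) →ₗ[R] TorTot I (Gr I 1) :=
  delta I 0 ∘ₗ torTotMap I (unitGr I)

end Main

section Resolution
variable {R : Type u} [CommRing R] {U : Type u} [AddCommGroup U] [Module R U] {n : ℕ}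
  (r : Fin n → R) (e : Module.Basis (Fin n) R U)

/-- The ideal generated by a finite sequence. -/
abbrev seqIdeal : Ideal R := Ideal.span (Set.range r)

/-- The linear form on `U` with `e_j ↦ r_j`. -/
noncomputable abbrev seqForm : U →ₗ[R] R := e.constr R r

lemma seqForm_mem (u : U) : seqForm r e u ∈ seqIdeal r := by
  rw [seqForm, Module.Basis.constr_apply_fintype]
  exact sum_mem fun j _ => Ideal.mul_mem_left _ _ (Ideal.subset_span ⟨j, rfl⟩)

/-- The Koszul complex `K(r_1, …, r_n)`, augmented over `R/(r_1, …, r_n)`. -/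
noncomputable def koszulSeqAug : koszulComplex (seqForm r e) ⟶
    (ChainComplex.single₀ (ModuleCat.{u} R)).obj (ModuleCat.of R (R ⧸ seqIdeal r)) :=
  koszulAug (seqForm r e) (seqIdeal r) (seqForm_mem r e)

/-- `K(r_1, …, r_n)` as a projective resolution of `R/(r_1, …, r_n)`, provided that its augmentation
is a quasi-isomorphism. -/
noncomputable def koszulResolution (h : QuasiIso (koszulSeqAug r e)) :
    ProjectiveResolution (ModuleCat.of R (R ⧸ seqIdeal r)) where
  complex := koszulComplex (seqForm r e)
  projective p := by
    have : Module.Free R (⋀[R]^p U) := Module.Free.of_basis (e.exteriorPower (R := R) (n := p))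
    exact inferInstanceAs (Projective (ModuleCat.of R (⋀[R]^p U)))
  π := koszulSeqAug r e
  quasiIso := h

/-- The complex `R/I ⊗ K(r_1, …, r_n)`. -/
noncomputable abbrev koszulTensor : ChainComplex (ModuleCat.{u} R) ℕ :=
  (((MonoidalCategory.tensoringLeft (ModuleCat.{u} R)).obj
    (ModuleCat.of R (R ⧸ seqIdeal r))).mapHomologicalComplex (ComplexShape.down ℕ)).obj
    (koszulComplex (seqForm r e))

/-- The map `x ↦ 1 ⊗ x` from `⋀^p U` to the degree `p` part of `R/I ⊗ K(r_1, …, r_n)`. -/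
noncomputable def oneTensor (p : ℕ) :
    ModuleCat.of R (⋀[R]^p U) ⟶ (koszulTensor r e).X p :=
  ModuleCat.ofHom (TensorProduct.mk R (R ⧸ seqIdeal r) (⋀[R]^p U) 1)

lemma one_tmul_eq_zero {I : Ideal R} {N : Type*} [AddCommGroup N] [Module R N] {x : N}
    (hx : x ∈ I • (⊤ : Submodule R N)) : (1 : R ⧸ I) ⊗ₜ[R] x = 0 := by
  refine Submodule.smul_induction_on hx ?_ ?_
  · intro c hc y _
    have : c • (1 : R ⧸ I) = 0 := by
      rw [Algebra.smul_def, mul_one]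
      exact Ideal.Quotient.eq_zero_iff_mem.2 hc
    rw [← TensorProduct.smul_tmul, this, TensorProduct.zero_tmul]
  · intro y z hy hz
    rw [TensorProduct.tmul_add, hy, hz, add_zero]

lemma oneTensor_d (p q : ℕ) : oneTensor r e p ≫ (koszulTensor r e).d p q = 0 := by
  by_cases h : q + 1 = p
  · subst h
    refine ModuleCat.hom_ext (LinearMap.ext fun x => ?_)
    have hx := koszulDeg_mem (seqForm r e) (seqIdeal r) (seqForm_mem r e) q x
    have hd : (koszulTensor r e).d (q + 1) q =
        ((MonoidalCategory.tensoringLeft (ModuleCat.{u} R)).obj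
          (ModuleCat.of R (R ⧸ seqIdeal r))).map (ModuleCat.ofHom (koszulDeg (seqForm r e) q)) :=
      congrArg (fun g => ((MonoidalCategory.tensoringLeft (ModuleCat.{u} R)).obj
        (ModuleCat.of R (R ⧸ seqIdeal r))).map g) (koszulComplex_d (seqForm r e) q)
    rw [hd]
    exact one_tmul_eq_zero hx
  · rw [(koszulTensor r e).shape p q h, comp_zero]

/-- The map `⋀^p U → Tor_p^R(R/I, R/I)` sending `x` to the homology class of the cycle `1 ⊗ x` of
`R/I ⊗ K(r_1, …, r_n)`. -/
noncomputable def koszulClass (h : QuasiIso (koszulSeqAug r e)) (p : ℕ) :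
    ⋀[R]^p U →ₗ[R] TorQ (seqIdeal r) (R ⧸ seqIdeal r) p :=
  ((koszulTensor r e).liftCycles (oneTensor r e p) _ rfl (oneTensor_d r e p _) ≫
    (koszulTensor r e).homologyπ p ≫
    ((koszulResolution r e h).isoLeftDerivedObj
      ((MonoidalCategory.tensoringLeft (ModuleCat.{u} R)).obj
        (ModuleCat.of R (R ⧸ seqIdeal r))) p).inv).hom

end Resolution

section Model
variable {R : Type u} [CommRing R] (I : Ideal R) (W : Type w) [AddCommGroup W] [Module (R ⧸ I) W]
  (U : Type u) [AddCommGroup U] [Module R U]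

/-- `Sym_{R/I}(W)` as an `R`-algebra. -/
noncomputable instance instAlgebraSym : Algebra R (SymmetricAlgebra (R ⧸ I) W) :=
  Algebra.compHom _ (Ideal.Quotient.mk I)

/-- `Λ^{Sym_{R/I}(W)}(Sym_{R/I}(W) ⊗_R U)`. -/
abbrev ModelKoszul : Type (max u w) :=
  ExteriorAlgebra (SymmetricAlgebra (R ⧸ I) W) (SymmetricAlgebra (R ⧸ I) W ⊗[R] U)

/-- The homogeneous component `Sym^s_{R/I}(W)`. -/
noncomputable def symPiece (s : ℕ) : Submodule (R ⧸ I) (SymmetricAlgebra (R ⧸ I) W) :=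
  LinearMap.range (SymmetricAlgebra.ι (R ⧸ I) W) ^ s

/-- The component `Sym^s_{R/I}(W) ⊗ ⋀^p U` of `Λ^{Sym_{R/I}(W)}(Sym_{R/I}(W) ⊗_R U)`. -/
noncomputable def modelPiece (s p : ℕ) : Submodule R (ModelKoszul I W U) :=
  Submodule.span R {x | ∃ a ∈ symPiece I W s, ∃ u : Fin p → U,
    x = a • ExteriorAlgebra.ιMulti (SymmetricAlgebra (R ⧸ I) W) p (fun i => 1 ⊗ₜ[R] u i)}

variable {I W U}
/-- The Koszul differential of the sequence `f_1, …, f_n` of elements of `Sym_{R/I}(W)`: the graded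
`Sym_{R/I}(W)`-derivation with `1 ⊗ e_j ↦ f_j`. -/
noncomputable def modelD {n : ℕ} (e : Module.Basis (Fin n) R U)
    (f : Module.Basis (Fin n) (R ⧸ I) W) :
    ModelKoszul I W U →ₗ[SymmetricAlgebra (R ⧸ I) W] ModelKoszul I W U :=
  koszulD ((e.baseChange (SymmetricAlgebra (R ⧸ I) W)).constr (SymmetricAlgebra (R ⧸ I) W)
    (fun j => SymmetricAlgebra.ι (R ⧸ I) W (f j)))
end Model

end KoszulTor

open KoszulTor

/-! Write S = R/I. Regularity enters through two facts. The Koszul complex K(r) resolves S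
(`koszul_exact`, `quasiIso_koszulSeqAug`), and r is quasi-regular: a form of degree s over R whose
value at r lies in I^{s+1} has all its coefficients in I (`coeff_mem_of_eval_mem`). The second fact
makes the evaluation S[X_1, …, X_n] → gr_I(R) at the classes of the r_j bijective. The map φ is its
inverse followed by X_j ↦ -f_j, and each I^s/I^{s+1} is finite projective over S
(`exists_finite_projective_gr`).

The differential of S ⊗ K(r) is zero, since the r_j lie in I, so Tor_p(S, S) = S ⊗ ⋀^p U. As Tor is
additive in its second variable, g ⊗ x ↦ g_* κ(x) is an isomorphism from Hom(S, N) ⊗ ⋀^p U to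
Tor_p(S, N) for every N that is a retract of a finite power of S (`torPairing_bijective`). For N =
I^s/I^{s+1} the source is I^s/I^{s+1} ⊗ ⋀^p U. Summing over s and p, and using φ and Sym(W) ⊗ Λ(U) =
Λ^{Sym(W)}(Sym(W) ⊗ U), gives ψ.

The heart is the formula δ(x_* κ(y)) = -∑_j (r_j x)_* κ(∂_j y), where ∂_j is the contraction with
the j-th coordinate form (`deltaDeg_torMap_koszulClass`). Take a short exact sequence of projective
resolutions P₁ → P₂ → P₃ of I^{s+1}/I^{s+2} → I^s/I^{s+2} → I^s/I^{s+1}. The map R → I^s/I^{s+2}, 1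
↦ x, does not vanish on the boundaries r_j of K(r), so it does not lift to a chain map K(r) → P₂. It
does lift to maps h with d h = h d - ∑_j c_j ∂_j, where c_j : K(r) → P₁ is a chain map over 1 ↦ r_j
x. On classes 1 ⊗ y the term h d disappears and the snake lemma reads off the other one.

Under φ, multiplication by the class of r_j is multiplication by -f_j, so the two signs cancel and
δ^* becomes the Koszul differential of f_1, …, f_n (`torModelEquiv_deltaTot`). These are the
variables of a polynomial ring, hence a regular sequence, so the homology of that differential is S
in bidegree (0, 0), which is the image of η. Exactness follows on splitting into bidegrees. -/

namespace KoszulTor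

/-! ### Regular sequences in terms of elements -/

section Regular
variable {A : Type*} [CommRing A] {n : ℕ}

/-- The ideal generated by the terms of index less than `i` of a finite sequence. -/
def initIdeal (r : Fin n → A) (i : ℕ) : Ideal A := Ideal.span (r '' {j | j.1 < i})

/-- A weakly regular sequence, expressed by elements: each term is a non-zero-divisor modulo the
ideal generated by the previous ones. -/
def ColonRegular (r : Fin n → A) : Prop :=
  ∀ (i : Fin n) (b : A), r i * b ∈ initIdeal r i → b ∈ initIdeal r i

lemma mem_initIdeal (r : Fin n → A) {i : ℕ} {j : Fin n} (h : j.1 < i) : r j ∈ initIdeal r i :=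
  Ideal.subset_span ⟨j, h, rfl⟩

lemma initIdeal_top (r : Fin n → A) : initIdeal r n = Ideal.span (Set.range r) := by
  simp [initIdeal, Set.image_univ]

lemma initIdeal_mono (r : Fin n → A) {i j : ℕ} (h : i ≤ j) : initIdeal r i ≤ initIdeal r j :=
  Ideal.span_mono (Set.image_mono fun _ hk => lt_of_lt_of_le hk h)

lemma index_lt_succ_eq (i : Fin n) : {j : Fin n | j.1 < i.1 + 1} = insert i {j | j.1 < i.1} := by
  ext j
  simp only [Set.mem_ofPred_eq, Set.mem_insert_iff, Fin.ext_iff]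
  omega

lemma colonRegular_of_isWeaklyRegular (r : Fin n → A)
    (hr : RingTheory.Sequence.IsWeaklyRegular A (List.ofFn r)) : ColonRegular r := by
  intro i b hb
  have h := hr.regular_mod_prev i (by simp)
  have e : (Ideal.ofList ((List.ofFn r).take i) • ⊤ : Submodule A A) = initIdeal r i := by
    rw [smul_eq_mul, Ideal.mul_top, Ideal.ofList, initIdeal]
    congr 1
    ext x
    simp only [Set.mem_ofPred_eq, List.mem_take_iff_getElem, List.getElem_ofFn, List.length_ofFn,
      Set.mem_image]
    constructor
    · rintro ⟨j, hj, rfl⟩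
      exact ⟨⟨j, by omega⟩, by simp; omega, rfl⟩
    · rintro ⟨j, hj, rfl⟩
      exact ⟨j, by simp at hj; omega, rfl⟩
  rw [e] at h
  have := @h (Submodule.Quotient.mk b) 0 (by
    simp only [smul_zero, List.getElem_ofFn]
    rw [← Submodule.Quotient.mk_smul, Submodule.Quotient.mk_eq_zero]
    exact hb)
  exact (Submodule.Quotient.mk_eq_zero _).1 this

lemma colonRegular_map {B : Type*} [CommRing B] (E : A ≃+* B) {r : Fin n → A} {r' : Fin n → B}
    (h : ∀ i, E (r i) = r' i) (hr : ColonRegular r) : ColonRegular r' := by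
  have e (i : ℕ) : initIdeal r' i = (initIdeal r i).map E := by
    rw [initIdeal, initIdeal, Ideal.map_span, ← Set.image_comp]
    congr 1
    exact Set.image_congr fun j _ => (h j).symm
  intro i b hb
  obtain ⟨c, rfl⟩ := E.surjective b
  rw [e, ← h, ← map_mul, Ideal.mem_map_of_equiv] at hb
  obtain ⟨x, hx, hxe⟩ := hb
  rw [e]
  exact Ideal.mem_map_of_mem _ (hr i c (E.injective hxe ▸ hx))

/-- Membership in an ideal generated by variables is tested monomial by monomial, and multiplication
by X_i does not change the exponents of the earlier variables. -/
lemma colonRegular_X :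
    ColonRegular (fun i : Fin n => (MvPolynomial.X i : MvPolynomial (Fin n) A)) := by
  intro i b hb
  rw [initIdeal, MvPolynomial.mem_ideal_span_X_image] at hb ⊢
  intro m hm
  obtain ⟨j, hj, hj0⟩ := hb (Finsupp.single i 1 + m) (by
    rw [MvPolynomial.mem_support_iff, MvPolynomial.coeff_X_mul]
    exact MvPolynomial.mem_support_iff.1 hm)
  refine ⟨j, hj, ?_⟩
  have : i ≠ j := fun h => by simp [h] at hj
  simpa [Finsupp.single_apply, this] using hj0

end Regular

/-! ### Regular sequences are quasi-regular -/

section QuasiRegular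
open MvPolynomial
variable {A : Type*} [CommRing A] {n : ℕ}

/-- Homogeneity of degree `s` in the variables of index less than `i`. -/
def HomogBelow (i s : ℕ) (F : MvPolynomial (Fin n) A) : Prop :=
  ∀ m, F.coeff m ≠ 0 → m.degree = s ∧ ∀ j : Fin n, i ≤ j.1 → m j = 0

lemma HomogBelow.add {i s : ℕ} {F G : MvPolynomial (Fin n) A} (hF : HomogBelow i s F)
    (hG : HomogBelow i s G) : HomogBelow i s (F + G) := by
  intro m hm
  rw [coeff_add] at hm
  by_cases h : F.coeff m = 0
  · rw [h, zero_add] at hm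
    exact hG m hm
  · exact hF m h

lemma HomogBelow.smul {i s : ℕ} {F : MvPolynomial (Fin n) A} (hF : HomogBelow i s F) (a : A) :
    HomogBelow i s (a • F) := fun m hm => hF m fun h => hm (by rw [coeff_smul, h, smul_zero])

lemma HomogBelow.sub {i s : ℕ} {F G : MvPolynomial (Fin n) A} (hF : HomogBelow i s F)
    (hG : HomogBelow i s G) : HomogBelow i s (F - G) := by
  have := hF.add (hG.smul (-1))
  rwa [neg_one_smul, ← sub_eq_add_neg] at this

lemma HomogBelow.mono {i j s : ℕ} (hij : i ≤ j) {F : MvPolynomial (Fin n) A}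
    (hF : HomogBelow i s F) : HomogBelow j s F :=
  fun m hm => ⟨(hF m hm).1, fun k hk => (hF m hm).2 k (hij.trans hk)⟩

lemma HomogBelow.X_mul {i s : ℕ} {F : MvPolynomial (Fin n) A} (hF : HomogBelow i s F)
    {j : Fin n} (hj : j.1 < i) : HomogBelow i (s + 1) (X j * F) := by
  classical
  intro m hm
  rw [coeff_X_mul'] at hm
  split_ifs at hm with h
  · obtain ⟨h1, h2⟩ := hF _ hm
    have hm' : m = (m - Finsupp.single j 1) + Finsupp.single j 1 :=
      (tsub_add_cancel_of_le (Finsupp.single_le_iff.2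
        (Nat.one_le_iff_ne_zero.2 (Finsupp.mem_support_iff.1 h)))).symm
    refine ⟨by rw [hm', map_add, h1]; simp, fun k hk => ?_⟩
    rw [hm', Finsupp.add_apply, h2 k hk, Finsupp.single_apply, if_neg (by rintro rfl; omega),
      add_zero]
  · exact absurd rfl hm

/-- Multiplying a value by a generator r_j amounts to multiplying the form by X_j. Taking K to be
the ideal J of the first i terms trades an element of J^{s+1} for a form of degree only s with
coefficients in J, which is how the degree is lowered below. -/
lemma exists_homogBelow (r : Fin n → A) (K : Ideal A) (i s : ℕ) :
    ∀ a ∈ K * initIdeal r i ^ s, ∃ F : MvPolynomial (Fin n) A,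
      HomogBelow i s F ∧ (∀ m, F.coeff m ∈ K) ∧ eval r F = a := by
  induction s with
  | zero =>
    intro a ha
    rw [pow_zero, mul_one] at ha
    refine ⟨C a, fun m hm => ?_, fun m => ?_, eval_C _⟩
    · rw [coeff_C] at hm
      obtain rfl : 0 = m := by by_contra h; simp [h] at hm
      simp
    · rw [coeff_C]; split_ifs
      exacts [ha, zero_mem _]
  | succ s ih =>
    intro a ha
    rw [pow_succ, ← mul_assoc] at ha
    refine Submodule.mul_induction_on ha ?_ ?_
    · intro x hx y hy
      obtain ⟨F, hF, hFK, rfl⟩ := ih x hx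
      refine Submodule.span_induction ?_ ?_ ?_ ?_ hy
      · rintro _ ⟨j, hj, rfl⟩
        refine ⟨X j * F, hF.X_mul hj, fun m => ?_, by simp [mul_comm]⟩
        classical
        rw [coeff_X_mul']; split_ifs
        exacts [hFK _, zero_mem _]
      · exact ⟨0, fun m hm => absurd rfl hm, fun m => zero_mem _, by simp⟩
      · rintro y z - - ⟨G, h1, h2, h3⟩ ⟨H, h4, h5, h6⟩
        exact ⟨G + H, h1.add h4, fun m => add_mem (h2 m) (h5 m), by simp [h3, h6, mul_add]⟩
      · rintro a y - ⟨G, h1, h2, h3⟩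
        refine ⟨a • G, h1.smul a, fun m => Ideal.mul_mem_left _ _ (h2 m), ?_⟩
        rw [smul_eval, h3, smul_eq_mul]; ring
    · rintro x y ⟨G, h1, h2, h3⟩ ⟨H, h4, h5, h6⟩
      exact ⟨G + H, h1.add h4, fun m => add_mem (h2 m) (h5 m), by simp [h3, h6]⟩

lemma HomogBelow.eval_mem {r : Fin n → A} {K : Ideal A} {i s : ℕ} {F : MvPolynomial (Fin n) A}
    (hF : HomogBelow i s F) (hK : ∀ m, F.coeff m ∈ K) : eval r F ∈ K * initIdeal r i ^ s := by
  rw [eval_eq']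
  refine sum_mem fun m hm => Ideal.mul_mem_mul (hK m) ?_
  obtain ⟨h1, h2⟩ := hF m (mem_support_iff.1 hm)
  have h1' : ∑ j, m j = s := by rw [← h1, Finsupp.degree_eq_sum]
  rw [← h1', ← Finset.prod_pow_eq_pow_sum]
  refine Ideal.prod_mem_prod fun j _ => ?_
  by_cases hj : j.1 < i
  · exact Ideal.pow_mem_pow (mem_initIdeal r hj) _
  · simp [h2 j (not_lt.1 hj)]

/-- Quasi-regularity of the terms of index less than `i` of a sequence. -/
def QuasiRegularBelow (r : Fin n → A) (i : ℕ) : Prop :=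
  ∀ s (F : MvPolynomial (Fin n) A), HomogBelow i s F → eval r F = 0 →
    ∀ m, F.coeff m ∈ initIdeal r i

/-- Since J^{s+1} = J · J^s, the value of F is also the value of a form G of degree s with
coefficients in J, and quasi-regularity applies to F - G. -/
lemma QuasiRegularBelow.coeff_mem {r : Fin n → A} {i : ℕ} (h : QuasiRegularBelow r i) {s : ℕ}
    {F : MvPolynomial (Fin n) A} (hF : HomogBelow i s F) (h0 : eval r F ∈ initIdeal r i ^ (s + 1))
    (m : Fin n →₀ ℕ) : F.coeff m ∈ initIdeal r i := by
  rw [pow_succ'] at h0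
  obtain ⟨G, hG, hGI, hGe⟩ := exists_homogBelow r _ i s _ h0
  have := h s (F - G) (hF.sub hG) (by rw [map_sub, hGe, sub_self]) m
  rw [coeff_sub] at this
  simpa using add_mem this (hGI m)

/-- By induction a is the value of a form of degree s. Quasi-regularity puts r_i times each
coefficient in the ideal J of the earlier terms, and regularity cancels r_i, so the coefficients lie
in J and a gains one more power. -/
lemma QuasiRegularBelow.mem_pow {r : Fin n → A} {i : Fin n} (h : QuasiRegularBelow r i)
    (hr : ColonRegular r) (s : ℕ) :
    ∀ a, r i * a ∈ initIdeal r i ^ s → a ∈ initIdeal r i ^ s := by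
  induction s with
  | zero => simp
  | succ s ih =>
    intro a ha
    have h1 := ih a (Ideal.pow_le_pow_right (Nat.le_succ s) ha)
    obtain ⟨G, hG, -, rfl⟩ := exists_homogBelow r ⊤ i s a (by rwa [Ideal.top_mul])
    rw [pow_succ']
    refine hG.eval_mem fun m => hr i _ ?_
    have := h.coeff_mem (hG.smul (r i)) (by rwa [smul_eval]) m
    rwa [coeff_smul] at this

lemma HomogBelow.modMonomial {i : Fin n} {s : ℕ} {F : MvPolynomial (Fin n) A}
    (hF : HomogBelow (i + 1) s F) : HomogBelow i s (F.modMonomial (Finsupp.single i 1)) := by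
  intro m hm
  by_cases h : Finsupp.single i 1 ≤ m
  · rw [coeff_modMonomial_of_le _ h] at hm; exact absurd rfl hm
  · rw [coeff_modMonomial_of_not_le _ h] at hm
    refine ⟨(hF m hm).1, fun j hj => ?_⟩
    rcases hj.eq_or_lt with hj | hj
    · obtain rfl : i = j := Fin.ext hj
      rw [Finsupp.single_le_iff] at h; omega
    · exact (hF m hm).2 j hj

lemma HomogBelow.divMonomial {i : Fin n} {s : ℕ} {F : MvPolynomial (Fin n) A}
    (hF : HomogBelow (i + 1) (s + 1) F) :
    HomogBelow (i + 1) s (F.divMonomial (Finsupp.single i 1)) := by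
  intro m hm
  rw [coeff_divMonomial] at hm
  obtain ⟨h1, h2⟩ := hF _ hm
  rw [map_add, Finsupp.degree_single] at h1
  refine ⟨by omega, fun j hj => ?_⟩
  have := h2 j hj
  rw [Finsupp.add_apply] at this
  omega

/-- Write F = X_i H + G with G free of X_i, and let J be the ideal of the terms before r_i. From r_i
H(r) = -G(r) ∈ J^{s+1} and the cancellation of r_i modulo powers of J one gets H(r) ∈ J^{s+1}. This
is used twice: H(r) is the value of a form H' of degree s with coefficients in J, and induction on
the degree applies to H - H'. It is also the value of a form L of degree s + 1 in the earlier
variables, and the hypothesis on J applies to r_i L + G. -/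
lemma QuasiRegularBelow.succ {r : Fin n → A} {i : Fin n} (h : QuasiRegularBelow r i)
    (hr : ColonRegular r) : QuasiRegularBelow r (i + 1) := by
  intro s
  induction s with
  | zero =>
    intro F hF h0 m
    have hF' : F = C (F.coeff 0) := by
      ext m
      rw [coeff_C]
      split_ifs with hm
      · rw [hm]
      · by_contra hne
        exact hm ((Finsupp.degree_eq_zero_iff m).1 (hF m hne).1).symm
    rw [hF', eval_C] at h0
    rw [hF', h0]; simp
  | succ s ih =>
    intro F hF h0 m
    set H := F.divMonomial (Finsupp.single i 1) with hHd
    set G := F.modMonomial (Finsupp.single i 1) with hGd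
    have hH : HomogBelow (i + 1) s H := hF.divMonomial
    have hG : HomogBelow i (s + 1) G := hF.modMonomial
    have e : X i * H + G = F := divMonomial_add_modMonomial_single F i
    have h0' : r i * eval r H + eval r G = 0 := by rw [← h0, ← e]; simp
    have hGm : eval r G ∈ initIdeal r i ^ (s + 1) := by
      have := hG.eval_mem (r := r) (K := ⊤) (fun _ => trivial)
      rwa [Ideal.top_mul] at this
    have hHm : eval r H ∈ initIdeal r i ^ (s + 1) := by
      refine h.mem_pow hr _ _ ?_
      rw [eq_neg_of_add_eq_zero_left h0']
      exact neg_mem hGm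
    have hHc : ∀ m, H.coeff m ∈ initIdeal r (i + 1) := by
      obtain ⟨H', hH', hH'I, hH'e⟩ := exists_homogBelow r (initIdeal r i) i s (eval r H)
        (by rwa [← pow_succ'])
      intro m
      have := ih (H - H') (hH.sub (hH'.mono (Nat.le_succ _))) (by rw [map_sub, hH'e, sub_self]) m
      rw [coeff_sub] at this
      simpa using add_mem this (initIdeal_mono r (Nat.le_succ _) (hH'I m))
    obtain ⟨L, hL, -, hLe⟩ := exists_homogBelow r ⊤ i (s + 1) (eval r H) (by rwa [Ideal.top_mul])
    have hGc : G.coeff m ∈ initIdeal r (i + 1) := by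
      have := h (s + 1) (r i • L + G) ((hL.smul _).add hG) (by rw [map_add, smul_eval, hLe, h0']) m
      rw [coeff_add, coeff_smul] at this
      have h2 : r i • L.coeff m ∈ initIdeal r (i + 1) :=
        Ideal.mul_mem_right _ _ (mem_initIdeal r (Nat.lt_succ_self _))
      simpa using sub_mem (initIdeal_mono r (Nat.le_succ _) this) h2
    rw [← e, coeff_add]
    refine add_mem ?_ hGc
    classical
    rw [coeff_X_mul']; split_ifs
    exacts [hHc _, zero_mem _]

/-- A regular sequence is quasi-regular. -/
lemma quasiRegularBelow (r : Fin n → A) (hr : ColonRegular r) (i : ℕ) (hi : i ≤ n) :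
    QuasiRegularBelow r i := by
  induction i with
  | zero =>
    intro s F hF h0 m
    have hm0 : ∀ m, F.coeff m ≠ 0 → m = 0 := fun m hm =>
      Finsupp.ext fun j => (hF m hm).2 j (Nat.zero_le _)
    have hF' : F = C (F.coeff 0) := by
      ext m
      rw [coeff_C]
      split_ifs with h
      · rw [h]
      · by_contra hne
        exact h (hm0 m hne).symm
    rw [hF', eval_C] at h0
    rw [hF', h0]; simp
  | succ i ih => exact (ih (by omega)).succ (i := ⟨i, hi⟩) hr

lemma coeff_mem_of_eval_mem (r : Fin n → A) (hr : ColonRegular r) {s : ℕ}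
    {F : MvPolynomial (Fin n) A} (hF : F.IsHomogeneous s)
    (h : eval r F ∈ Ideal.span (Set.range r) ^ (s + 1)) (m : Fin n →₀ ℕ) :
    F.coeff m ∈ Ideal.span (Set.range r) := by
  rw [← initIdeal_top] at h ⊢
  refine (quasiRegularBelow r hr n le_rfl).coeff_mem (fun m hm => ⟨?_, fun j hj => ?_⟩) h m
  · by_contra hne
    exact hm (hF.coeff_eq_zero hne)
  · omega

end QuasiRegular

/-! ### Exactness of the Koszul complex of a regular sequence -/

section Acyclic
variable {A : Type*} [CommRing A] {M : Type*} [AddCommGroup M] [Module A M] {n : ℕ}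

lemma koszulD_ι (ξ : M →ₗ[A] A) (a : M) :
    koszulD ξ (ExteriorAlgebra.ι A a) = algebraMap A _ (ξ a) :=
  CliffordAlgebra.contractLeft_ι (Q := (0 : QuadraticForm A M)) ξ a

lemma koszulD_comm (ξ ζ : M →ₗ[A] A) (x : ExteriorAlgebra A M) :
    koszulD ξ (koszulD ζ x) = -koszulD ζ (koszulD ξ x) :=
  CliffordAlgebra.contractLeft_comm (Q := (0 : QuadraticForm A M)) _ _ x

lemma koszulD_sum {κ : Type*} (s : Finset κ) (c : κ → A) (ξ : κ → M →ₗ[A] A)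
    (x : ExteriorAlgebra A M) :
    koszulD (∑ j ∈ s, c j • ξ j) x = ∑ j ∈ s, c j • koszulD (ξ j) x := by
  have h (ζ : M →ₗ[A] A) : koszulD ζ x =
    (CliffordAlgebra.contractLeft (Q := (0 : QuadraticForm A M)) : _ →ₗ[A] _) ζ x := rfl
  simp only [h, map_sum, map_smul, LinearMap.sum_apply, LinearMap.smul_apply]

/-- The span of the degree one elements `e_j`, `j < i`, of the exterior algebra. -/
def initSpan (e : Fin n → M) (i : ℕ) : Submodule A (ExteriorAlgebra A M) :=
  Submodule.span A ((fun j => ExteriorAlgebra.ι A (e j)) '' {j | j.1 < i})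

lemma initSpan_succ (e : Fin n → M) (i : Fin n) :
    initSpan (A := A) e (i + 1) = Submodule.span A {ExteriorAlgebra.ι A (e i)} ⊔ initSpan e i := by
  rw [initSpan, index_lt_succ_eq, Set.image_insert_eq, Submodule.span_insert]; rfl

lemma initSpan_mono (e : Fin n → M) {i j : ℕ} (h : i ≤ j) :
    initSpan (A := A) e i ≤ initSpan e j :=
  Submodule.span_mono (Set.image_mono fun _ hk => lt_of_lt_of_le hk h)

lemma initSpan_top (e : Module.Basis (Fin n) A M) :
    initSpan (A := A) e n = LinearMap.range (ExteriorAlgebra.ι A : M →ₗ[A] _) := by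
  rw [LinearMap.range_eq_map, ← e.span_eq, Submodule.map_span, initSpan, ← Set.range_comp]
  simp [Set.image_univ, Function.comp_def]

lemma ι_anticomm_initSpan (e : Fin n → M) (i : ℕ) (a : M) :
    ∀ v ∈ initSpan (A := A) e i, v * ExteriorAlgebra.ι A a = -(ExteriorAlgebra.ι A a * v) := by
  intro v hv
  refine Submodule.span_induction ?_ (by simp) ?_ ?_ hv
  · rintro _ ⟨j, -, rfl⟩
    exact eq_neg_of_add_eq_zero_left (ExteriorAlgebra.ι_add_mul_swap _ _)
  · rintro x y - - hx hy
    rw [add_mul, hx, hy, mul_add, neg_add]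
  · rintro c x - hx
    rw [smul_mul_assoc, hx, mul_smul_comm, smul_neg]

/-- Anticommutation moves every factor e_i to the left, and e_i ∧ e_i = 0 leaves at most one of
them. -/
lemma exists_decomp (e : Fin n → M) (i : Fin n) (p : ℕ) :
    ∀ x ∈ initSpan (A := A) e (i + 1) ^ (p + 1), ∃ a ∈ initSpan (A := A) e i ^ (p + 1),
      ∃ b ∈ initSpan (A := A) e i ^ p, x = a + ExteriorAlgebra.ι A (e i) * b := by
  have h1 : ∀ x ∈ initSpan (A := A) e (i + 1), ∃ c : A, ∃ v ∈ initSpan (A := A) e i,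
      x = c • ExteriorAlgebra.ι A (e i) + v := by
    intro x hx
    rw [initSpan_succ, Submodule.mem_sup] at hx
    obtain ⟨y, hy, v, hv, rfl⟩ := hx
    obtain ⟨c, rfl⟩ := Submodule.mem_span_singleton.1 hy
    exact ⟨c, v, hv, rfl⟩
  induction p with
  | zero =>
    intro x hx
    rw [zero_add, pow_one] at hx ⊢
    obtain ⟨c, v, hv, rfl⟩ := h1 x hx
    refine ⟨v, hv, algebraMap A _ c, by rw [pow_zero]; exact Submodule.algebraMap_mem c, ?_⟩
    rw [← Algebra.commutes, ← Algebra.smul_def, add_comm]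
  | succ p ih =>
    intro x hx
    rw [pow_succ'] at hx
    refine Submodule.mul_induction_on hx ?_ ?_
    · intro y hy z hz
      obtain ⟨c, v, hv, rfl⟩ := h1 y hy
      obtain ⟨a, ha, b, hb, rfl⟩ := ih z hz
      refine ⟨v * a, by rw [pow_succ']; exact Submodule.mul_mem_mul hv ha, c • a - v * b,
        sub_mem (Submodule.smul_mem _ _ ha)
          (by rw [pow_succ']; exact Submodule.mul_mem_mul hv hb), ?_⟩
      have h2 := ι_anticomm_initSpan e i (e i) v hv
      have h3 := ExteriorAlgebra.ι_sq_zero (R := A) (e i)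
      simp only [add_mul, mul_add, mul_sub, smul_mul_assoc, mul_smul_comm]
      rw [← mul_assoc (ExteriorAlgebra.ι A (e i)) (ExteriorAlgebra.ι A (e i)), h3, ← mul_assoc v,
        h2, ← mul_assoc _ v]
      simp only [zero_mul, smul_zero, neg_mul]
      abel
    · rintro _ _ ⟨a, ha, b, hb, rfl⟩ ⟨a', ha', b', hb', rfl⟩
      refine ⟨a + a', add_mem ha ha', b + b', add_mem hb hb', ?_⟩
      rw [mul_add]; abel

lemma koszulD_initSpan_one (e : Module.Basis (Fin n) A M) (r : Fin n → A) (i : ℕ) :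
    ∀ x ∈ initSpan (A := A) e i, ∃ c ∈ initIdeal r i,
      koszulD (e.constr A r) x = algebraMap A _ c := by
  intro x hx
  refine Submodule.span_induction ?_ ?_ ?_ ?_ hx
  · rintro _ ⟨j, hj, rfl⟩
    exact ⟨r j, mem_initIdeal r hj, by rw [koszulD_ι, Module.Basis.constr_basis]⟩
  · exact ⟨0, zero_mem _, by simp⟩
  · rintro x y - - ⟨c, hc, h⟩ ⟨d, hd, h'⟩
    exact ⟨c + d, add_mem hc hd, by rw [map_add, h, h', map_add]⟩
  · rintro a x - ⟨c, hc, h⟩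
    exact ⟨a * c, Ideal.mul_mem_left _ _ hc, by rw [map_smul, h, map_mul, Algebra.smul_def]⟩

lemma exists_koszulD_eq (e : Module.Basis (Fin n) A M) (r : Fin n → A) (i : ℕ) :
    ∀ c ∈ initIdeal r i, ∃ x ∈ initSpan (A := A) e i,
      koszulD (e.constr A r) x = algebraMap A _ c := by
  intro c hc
  refine Submodule.span_induction ?_ ?_ ?_ ?_ hc
  · rintro _ ⟨j, hj, rfl⟩
    exact ⟨_, Submodule.subset_span ⟨j, hj, rfl⟩, by rw [koszulD_ι, Module.Basis.constr_basis]⟩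
  · exact ⟨0, zero_mem _, by simp⟩
  · rintro x y - - ⟨c, hc, h⟩ ⟨d, hd, h'⟩
    exact ⟨c + d, add_mem hc hd, by rw [map_add, h, h', map_add]⟩
  · rintro a x - ⟨c, hc, h⟩
    exact ⟨a • c, Submodule.smul_mem _ _ hc, by
      rw [map_smul, h, smul_eq_mul, map_mul, Algebra.smul_def]⟩

lemma koszulD_initSpan (e : Fin n → M) (ξ : M →ₗ[A] A) (i p : ℕ) :
    ∀ x ∈ initSpan (A := A) e i ^ (p + 1), koszulD ξ x ∈ initSpan (A := A) e i ^ p := by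
  have h1 : ∀ v ∈ initSpan (A := A) e i, ∃ u : M, ExteriorAlgebra.ι A u = v := by
    intro v hv
    have : initSpan (A := A) e i ≤ LinearMap.range (ExteriorAlgebra.ι A : M →ₗ[A] _) :=
      Submodule.span_le.2 (by rintro _ ⟨j, -, rfl⟩; exact ⟨_, rfl⟩)
    exact this hv
  induction p with
  | zero =>
    intro x hx
    rw [zero_add, pow_one] at hx
    obtain ⟨u, rfl⟩ := h1 x hx
    rw [koszulD_ι, pow_zero]
    exact Submodule.algebraMap_mem _
  | succ p ih =>
    intro x hx
    rw [pow_succ'] at hx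
    refine Submodule.mul_induction_on hx ?_ fun x y hx hy => by rw [map_add]; exact add_mem hx hy
    intro v hv y hy
    obtain ⟨u, rfl⟩ := h1 v hv
    rw [koszulD_ι_mul]
    refine sub_mem (Submodule.smul_mem _ _ hy) ?_
    rw [pow_succ']
    exact Submodule.mul_mem_mul hv (ih y hy)

lemma koszulD_initSpan_eq_zero (e : Fin n → M) (ξ : M →ₗ[A] A) (i p : ℕ)
    (h : ∀ j : Fin n, j.1 < i → ξ (e j) = 0) :
    ∀ x ∈ initSpan (A := A) e i ^ p, koszulD ξ x = 0 := by
  induction p with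
  | zero =>
    intro x hx
    rw [pow_zero] at hx
    obtain ⟨c, rfl⟩ := Submodule.mem_one.1 hx
    exact koszulD_algebraMap ξ c
  | succ p ih =>
    intro x hx
    rw [pow_succ'] at hx
    refine Submodule.mul_induction_on hx ?_ fun x y hx hy => by rw [map_add, hx, hy, add_zero]
    intro v hv y hy
    refine Submodule.span_induction ?_ (by simp) ?_ ?_ hv
    · rintro _ ⟨j, hj, rfl⟩
      dsimp only
      rw [koszulD_ι_mul, h j hj, ih y hy, zero_smul, mul_zero, sub_zero]
    · rintro a b - - ha hb
      rw [add_mul, map_add, ha, hb, add_zero]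
    · rintro c a - ha
      rw [smul_mul_assoc, map_smul, ha, smul_zero]

/-- Contraction with the i-th coordinate form kills a and b and sends e_i to 1, so it recovers b
from a + e_i ∧ b. -/
lemma eq_zero_of_decomp_eq_zero (e : Module.Basis (Fin n) A M) (i : Fin n) {p q : ℕ}
    {a b : ExteriorAlgebra A M} (ha : a ∈ initSpan (A := A) e i ^ p)
    (hb : b ∈ initSpan (A := A) e i ^ q) (h : a + ExteriorAlgebra.ι A (e i) * b = 0) : b = 0 := by
  have h0 : ∀ j : Fin n, j.1 < i.1 → e.coord i (e j) = 0 := fun j hj => by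
    rw [Module.Basis.coord_apply, Module.Basis.repr_self, Finsupp.single_apply,
      if_neg (by rintro rfl; omega)]
  have := congrArg (koszulD (e.coord i)) h
  rw [map_add, koszulD_initSpan_eq_zero e _ i p h0 a ha, koszulD_ι_mul,
    koszulD_initSpan_eq_zero e _ i q h0 b hb, map_zero, mul_zero, sub_zero, zero_add,
    Module.Basis.coord_apply, Module.Basis.repr_self, Finsupp.single_eq_same, one_smul] at this
  exact this

/-- The complex on one more element is the mapping cone of multiplication by r_i. If x = a + e_i ∧ b
is a cycle, then D b = 0 and D a = -r_i b. If b = D c, then a + r_i c is a cycle on the earlier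
elements, hence some D y, and D(y - e_i ∧ c) = x. Regularity is needed only to find c when b is a
scalar. -/
lemma koszul_exact_initSpan (e : Module.Basis (Fin n) A M) {r : Fin n → A} (hr : ColonRegular r)
    (i : ℕ) (hi : i ≤ n) : ∀ p, ∀ x ∈ initSpan (A := A) e i ^ (p + 1),
      koszulD (e.constr A r) x = 0 →
        ∃ y ∈ initSpan (A := A) e i ^ (p + 2), koszulD (e.constr A r) y = x := by
  induction i with
  | zero =>
    intro p x hx _
    have : initSpan (A := A) e 0 = ⊥ := by simp [initSpan]
    rw [this, pow_succ, Submodule.mul_bot] at hx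
    exact ⟨0, zero_mem _, by rw [map_zero, (Submodule.mem_bot A).1 hx]⟩
  | succ i ih =>
    have ih := ih (by omega)
    intro p x hx hx0
    obtain ⟨a, ha, b, hb, rfl⟩ := exists_decomp (fun j => e j) (⟨i, hi⟩ : Fin n) p x hx
    set k : Fin n := ⟨i, hi⟩ with hk
    set D := koszulD (e.constr A r) with hD
    have hda : D a ∈ initSpan (A := A) e i ^ p := koszulD_initSpan _ _ _ _ a ha
    have hDe (z) : D (ExteriorAlgebra.ι A (e k) * z) =
        r k • z - ExteriorAlgebra.ι A (e k) * D z := by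
      rw [hD, koszulD_ι_mul, Module.Basis.constr_basis]
    rw [map_add, hDe] at hx0
    -- The exponent is left free because b is a scalar when p = 0, and then D b = 0 has no natural
    -- degree.
    have hdb : ∃ q, D b ∈ initSpan (A := A) e i ^ q := by
      rcases p with _ | p
      · rw [pow_zero] at hb
        obtain ⟨c, rfl⟩ := Submodule.mem_one.1 hb
        exact ⟨0, by rw [hD, koszulD_algebraMap]; exact zero_mem _⟩
      · exact ⟨p, koszulD_initSpan _ _ _ _ b hb⟩
    obtain ⟨q, hq⟩ := hdb
    have hb0 : D b = 0 := by
      have := eq_zero_of_decomp_eq_zero e k (a := D a + r k • b) (b := -D b)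
        (add_mem hda (Submodule.smul_mem _ _ hb)) (neg_mem hq) (by rw [← hx0, mul_neg]; abel)
      rwa [neg_eq_zero] at this
    rw [hb0, mul_zero, sub_zero] at hx0
    obtain ⟨c, hc, hcb⟩ : ∃ c ∈ initSpan (A := A) e i ^ (p + 1), D c = b := by
      rcases p with _ | p
      · rw [pow_zero] at hb
        obtain ⟨b, rfl⟩ := Submodule.mem_one.1 hb
        rw [zero_add, pow_one] at ha ⊢
        obtain ⟨t, ht, hta⟩ := koszulD_initSpan_one e r i a ha
        -- Here D a + r_k b = 0 with D a in the ideal of the earlier terms, so r_k b, and then b,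
        -- lies in that ideal and is a boundary.
        refine exists_koszulD_eq e r i b (hr k b ?_)
        rw [← hD] at hta
        rw [hta, Algebra.smul_def, ← map_mul, ← map_add,
          ExteriorAlgebra.algebraMap_eq_zero_iff] at hx0
        rw [← neg_eq_of_add_eq_zero_right hx0]
        exact neg_mem ht
      · exact ih p b hb hb0
    obtain ⟨y, hy, hya⟩ := ih p (a + r k • c) (add_mem ha (Submodule.smul_mem _ _ hc))
      (by rw [map_add, map_smul, hcb, hx0])
    have hle := initSpan_mono (A := A) e (Nat.le_succ i)
    refine ⟨y - ExteriorAlgebra.ι A (e k) * c, sub_mem (pow_le_pow_left' hle _ hy) ?_, ?_⟩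
    · rw [pow_succ' _ (p + 1)]
      exact Submodule.mul_mem_mul (Submodule.subset_span ⟨k, Nat.lt_succ_self i, rfl⟩)
        (pow_le_pow_left' hle _ hc)
    · rw [map_sub, hya, hDe, hcb]; abel

/-- The Koszul complex of a regular sequence is exact in positive degrees. -/
lemma koszul_exact (e : Module.Basis (Fin n) A M) {r : Fin n → A} (hr : ColonRegular r) (p : ℕ)
    (x : ExteriorAlgebra A M) (hx : x ∈ ⋀[A]^(p + 1) M) (h : koszulD (e.constr A r) x = 0) :
    ∃ y ∈ ⋀[A]^(p + 2) M, koszulD (e.constr A r) y = x := by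
  have := koszul_exact_initSpan e hr n le_rfl p x (by rw [initSpan_top]; exact hx) h
  rwa [initSpan_top] at this

lemma exists_koszulD_eq_algebraMap (e : Module.Basis (Fin n) A M) (r : Fin n → A) (c : A)
    (hc : c ∈ Ideal.span (Set.range r)) :
    ∃ y ∈ ⋀[A]^1 M, koszulD (e.constr A r) y = algebraMap A _ c := by
  have := exists_koszulD_eq e r n c (by rwa [initIdeal_top])
  rw [initSpan_top] at this
  change ∃ y ∈ LinearMap.range (ExteriorAlgebra.ι A : M →ₗ[A] ExteriorAlgebra A M) ^ 1, _
  rwa [pow_one]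

end Acyclic

/-! ### The Koszul complex as a resolution of R/I -/

section Resolution
variable {R : Type u} [CommRing R] {U : Type u} [AddCommGroup U] [Module R U] {n : ℕ}
  (r : Fin n → R) (e : Module.Basis (Fin n) R U)

lemma koszulSeqAug_f_zero : (koszulSeqAug r e).f 0 =
    ModuleCat.ofHom ((seqIdeal r).mkQ ∘ₗ (exteriorPower.zeroEquiv R U).toLinearMap) :=
  ChainComplex.toSingle₀Equiv_symm_apply_f_zero _ _

lemma coe_zeroEquiv_symm (a : R) : (((exteriorPower.zeroEquiv R U).symm a : ⋀[R]^0 U) :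
    ExteriorAlgebra R U) = algebraMap R _ a := by
  have : (exteriorPower.zeroEquiv R U).symm a = a • exteriorPower.ιMulti R 0 (fun _ => 0) := by
    rw [LinearEquiv.symm_apply_eq, map_smul, exteriorPower.zeroEquiv_ιMulti, smul_eq_mul, mul_one]
  rw [this, Submodule.coe_smul, exteriorPower.ιMulti_apply_coe, ExteriorAlgebra.ιMulti_zero_apply,
    Algebra.algebraMap_eq_smul_one]

lemma coe_eq_algebraMap_zeroEquiv (x : ⋀[R]^0 U) :
    (x : ExteriorAlgebra R U) = algebraMap R _ (exteriorPower.zeroEquiv R U x) := by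
  rw [← coe_zeroEquiv_symm, LinearEquiv.symm_apply_apply]

/-- The Koszul complex of a regular sequence is a resolution. -/
lemma quasiIso_koszulSeqAug (hr : ColonRegular r) : QuasiIso (koszulSeqAug r e) := by
  rw [quasiIso_iff]
  rintro (_ | p)
  · rw [ChainComplex.quasiIsoAt₀_iff, ShortComplex.quasiIso_iff_of_zeros' _
      ((koszulComplex (seqForm r e)).shape 0 0 (by simp)) rfl rfl]
    constructor
    · rw [ShortComplex.moduleCat_exact_iff]
      intro (x : ⋀[R]^0 U) hx
      change (koszulSeqAug r e).f 0 x = 0 at hx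
      rw [koszulSeqAug_f_zero] at hx
      have hx' : exteriorPower.zeroEquiv R U x ∈ seqIdeal r :=
        (Submodule.Quotient.mk_eq_zero _).1 hx
      obtain ⟨y, hy, hyx⟩ := exists_koszulD_eq_algebraMap e r _ hx'
      refine ⟨(⟨y, hy⟩ : ⋀[R]^1 U), ?_⟩
      change (koszulComplex (seqForm r e)).d (0 + 1) 0 (⟨y, hy⟩ : ⋀[R]^1 U) = _
      rw [koszulComplex_d]
      refine Subtype.ext ?_
      rw [coe_eq_algebraMap_zeroEquiv x, ← hyx]
      rfl
    · change Epi ((koszulSeqAug r e).f 0)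
      rw [koszulSeqAug_f_zero]
      exact (ModuleCat.epi_iff_surjective (ModuleCat.ofHom
        ((seqIdeal r).mkQ ∘ₗ (exteriorPower.zeroEquiv R U).toLinearMap))).2
        ((Submodule.mkQ_surjective _).comp (exteriorPower.zeroEquiv R U).surjective)
  · rw [quasiIsoAt_iff_exactAt' _ _ (ChainComplex.exactAt_succ_single_obj _ _),
      HomologicalComplex.exactAt_iff' _ (p + 2) (p + 1) p (by simp) (by simp),
      ShortComplex.moduleCat_exact_iff]
    intro (x : ⋀[R]^(p + 1) U) hx
    change (koszulComplex (seqForm r e)).d (p + 1) p x = 0 at hx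
    rw [koszulComplex_d] at hx
    obtain ⟨y, hy, hyx⟩ := koszul_exact e hr p x x.2 (congrArg Subtype.val hx)
    refine ⟨(⟨y, hy⟩ : ⋀[R]^(p + 2) U), ?_⟩
    change (koszulComplex (seqForm r e)).d (p + 1 + 1) (p + 1) (⟨y, hy⟩ : ⋀[R]^(p + 2) U) = _
    rw [koszulComplex_d]
    exact Subtype.ext hyx

end Resolution

/-! ### Left derived functors on classes of cycles -/

section LeftDerived
variable {C D : Type*} [Category* C] [Category* D] [Abelian C] [Abelian D]
  (F : C ⥤ D) [F.Additive]

lemma comp_map_f_d {K L : ChainComplex C ℕ} (φ : K ⟶ L) {p q : ℕ} {A : D}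
    (x : A ⟶ ((F.mapHomologicalComplex (ComplexShape.down ℕ)).obj K).X p)
    (hx : x ≫ ((F.mapHomologicalComplex (ComplexShape.down ℕ)).obj K).d p q = 0) :
    (x ≫ ((F.mapHomologicalComplex (ComplexShape.down ℕ)).map φ).f p) ≫
      ((F.mapHomologicalComplex (ComplexShape.down ℕ)).obj L).d p q = 0 := by
  rw [Category.assoc, HomologicalComplex.Hom.comm, ← Category.assoc, hx, zero_comp]

/-- The effect of a left derived functor on the class of a cycle. -/
lemma liftCycles_isoLeftDerivedObj_naturality [EnoughProjectives C] {X Y : C} (f : X ⟶ Y)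
    (P : ProjectiveResolution X)
    (Q : ProjectiveResolution Y) (φ : P.complex ⟶ Q.complex)
    (comm : φ.f 0 ≫ Q.π.f 0 = P.π.f 0 ≫ f) {p : ℕ} {A : D}
    (x : A ⟶ ((F.mapHomologicalComplex (ComplexShape.down ℕ)).obj P.complex).X p)
    (hx : x ≫ ((F.mapHomologicalComplex (ComplexShape.down ℕ)).obj P.complex).d p _ = 0) :
    (((F.mapHomologicalComplex _).obj P.complex).liftCycles x _ rfl hx ≫
      ((F.mapHomologicalComplex _).obj P.complex).homologyπ p ≫
        (P.isoLeftDerivedObj F p).inv) ≫ (F.leftDerived p).map f ≫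
          (Q.isoLeftDerivedObj F p).hom =
    ((F.mapHomologicalComplex _).obj Q.complex).liftCycles
      (x ≫ ((F.mapHomologicalComplex _).map φ).f p) _ rfl (comp_map_f_d F φ x hx) ≫
      ((F.mapHomologicalComplex _).obj Q.complex).homologyπ p := by
  have h : ∀ {Z Z' T T' B : D} (i : T ≅ Z) (j : T' ⟶ B) (a : A ⟶ Z') (b : Z' ⟶ Z) (m : T ⟶ T')
      (k : Z ⟶ B), m ≫ j = i.hom ≫ k → (a ≫ b ≫ i.inv) ≫ m ≫ j = a ≫ b ≫ k := by
    intro Z Z' T T' B i j a b m k h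
    rw [h, Category.assoc, Category.assoc, Iso.inv_hom_id_assoc]
  refine (h (P.isoLeftDerivedObj F p) (Q.isoLeftDerivedObj F p).hom _ _ _ _
    (ProjectiveResolution.isoLeftDerivedObj_hom_naturality f P Q φ comm F p)).trans ?_
  change _ ≫ _ ≫ HomologicalComplex.homologyMap _ p = _
  rw [HomologicalComplex.homologyπ_naturality, ← Category.assoc,
    HomologicalComplex.liftCycles_comp_cyclesMap]

end LeftDerived

/-! ### Images of Koszul classes in Tor -/

section Tor
variable {R : Type u} [CommRing R] {U : Type u} [AddCommGroup U] [Module R U] {n : ℕ}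
  {r : Fin n → R} {e : Module.Basis (Fin n) R U} (hK : QuasiIso (koszulSeqAug r e))

/-- The functor `R/I ⊗ -`. -/
noncomputable abbrev tensorFunctor (r : Fin n → R) : ModuleCat.{u} R ⥤ ModuleCat.{u} R :=
  (MonoidalCategory.tensoringLeft (ModuleCat.{u} R)).obj (ModuleCat.of R (R ⧸ seqIdeal r))

/-- The functor `R/I ⊗ -` on chain complexes. -/
noncomputable abbrev tensorComplex (r : Fin n → R) :
    ChainComplex (ModuleCat.{u} R) ℕ ⥤ ChainComplex (ModuleCat.{u} R) ℕ :=
  (tensorFunctor r).mapHomologicalComplex (ComplexShape.down ℕ)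

variable {N : Type u} [AddCommGroup N] [Module R N]

/-- The class of `1 ⊗ c x` in `Tor`, for a chain map `c` from the Koszul complex to a projective
resolution. -/
lemma torMap_koszulClass (P : ProjectiveResolution (ModuleCat.of R N))
    (g : (R ⧸ seqIdeal r) →ₗ[R] N) (c : koszulComplex (seqForm r e) ⟶ P.complex)
    (hc : c.f 0 ≫ P.π.f 0 = (koszulSeqAug r e).f 0 ≫ ModuleCat.ofHom g) (p : ℕ) :
    ModuleCat.ofHom (koszulClass r e hK p) ≫ ModuleCat.ofHom (torMap (seqIdeal r) g p) ≫
      (P.isoLeftDerivedObj (tensorFunctor r) p).hom =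
    ((tensorComplex r).obj P.complex).liftCycles
      (oneTensor r e p ≫ ((tensorComplex r).map c).f p) _ rfl
        (comp_map_f_d (tensorFunctor r) c (oneTensor r e p) (oneTensor_d r e p _)) ≫
      ((tensorComplex r).obj P.complex).homologyπ p :=
  liftCycles_isoLeftDerivedObj_naturality (tensorFunctor r) (ModuleCat.ofHom g)
    (koszulResolution r e hK) P c hc (oneTensor r e p) (oneTensor_d r e p _)

end Tor

lemma comp_liftCycles_eq {C : Type*} [Category* C] [HasZeroMorphisms C] {κ : Type*}
    {c : ComplexShape κ} (K : HomologicalComplex C c) {i j : κ} [K.HasHomology i]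
    (hj : c.next i = j) {A B : C} {b : A ⟶ B} (x : B ⟶ K.X i) (y : A ⟶ K.X i) (h : b ≫ x = y)
    (hx : x ≫ K.d i j = 0) (hy : y ≫ K.d i j = 0) :
    b ≫ K.liftCycles x j hj hx = K.liftCycles y j hj hy := by
  subst h
  rw [← cancel_mono (K.iCycles i), Category.assoc, HomologicalComplex.liftCycles_i,
    HomologicalComplex.liftCycles_i]

/-- A sum of lifts of f and g to projective resolutions is a lift of f + g, and any lift computes
the derived map. -/
lemma leftDerived_map_add {C D : Type*} [Category* C] [Category* D] [Abelian C]
    [EnoughProjectives C] [Abelian D] (F : C ⥤ D) [F.Additive] (p : ℕ) {X Y : C} (f g : X ⟶ Y) :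
    (F.leftDerived p).map (f + g) = (F.leftDerived p).map f + (F.leftDerived p).map g := by
  have hf := ProjectiveResolution.lift_commutes f (projectiveResolution X) (projectiveResolution Y)
  have hg := ProjectiveResolution.lift_commutes g (projectiveResolution X) (projectiveResolution Y)
  rw [F.leftDerived_map_eq p f _ hf, F.leftDerived_map_eq p g _ hg,
    F.leftDerived_map_eq p (f + g) _ (by
      rw [Functor.map_add, Preadditive.comp_add, ← hf, ← hg, ← Preadditive.add_comp]),
    Functor.map_add, Preadditive.add_comp, Preadditive.comp_add]

/-! ### Functoriality and additivity of Tor in the second variable -/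

section TorMap
variable {R : Type u} [CommRing R] (I : Ideal R) {N N' N'' : Type u} [AddCommGroup N] [Module R N]
  [AddCommGroup N'] [Module R N'] [AddCommGroup N''] [Module R N'']

lemma torMap_eq (f : N →ₗ[R] N') (p : ℕ) : torMap I f p =
    ((((MonoidalCategory.tensoringLeft (ModuleCat.{u} R)).obj
      (ModuleCat.of R (R ⧸ I))).leftDerived p).map (ModuleCat.ofHom f)).hom := rfl

lemma torMap_comp (g : N' →ₗ[R] N'') (f : N →ₗ[R] N') (p : ℕ) :
    torMap I (g ∘ₗ f) p = torMap I g p ∘ₗ torMap I f p := by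
  rw [torMap_eq, ModuleCat.ofHom_comp, Functor.map_comp]; rfl

lemma torMap_id (p : ℕ) : torMap I (LinearMap.id : N →ₗ[R] N) p = LinearMap.id :=
  congrArg ModuleCat.Hom.hom ((((MonoidalCategory.tensoringLeft (ModuleCat.{u} R)).obj
    (ModuleCat.of R (R ⧸ I))).leftDerived p).map_id (ModuleCat.of R N))

lemma torMap_add (f g : N →ₗ[R] N') (p : ℕ) :
    torMap I (f + g) p = torMap I f p + torMap I g p :=
  congrArg ModuleCat.Hom.hom (leftDerived_map_add
    ((MonoidalCategory.tensoringLeft (ModuleCat.{u} R)).obj (ModuleCat.of R (R ⧸ I))) p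
    (ModuleCat.ofHom f) (ModuleCat.ofHom g))

/-- `torMap` as a homomorphism of abelian groups. -/
noncomputable def torMapAddHom (p : ℕ) : (N →ₗ[R] N') →+ (TorQ I N p →ₗ[R] TorQ I N' p) :=
  AddMonoidHom.mk' (fun f => torMap I f p) (fun f g => torMap_add I f g p)

lemma torMap_sum {κ : Type*} (s : Finset κ) (f : κ → N →ₗ[R] N') (p : ℕ) :
    torMap I (∑ i ∈ s, f i) p = ∑ i ∈ s, torMap I (f i) p :=
  map_sum (torMapAddHom I p) f s

end TorMap

/-! ### The pairing of Hom(R/I, N) and ⋀^p U into Tor -/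

section Pairing
variable {R : Type u} [CommRing R] {U : Type u} [AddCommGroup U] [Module R U] {n : ℕ}
  {r : Fin n → R} {e : Module.Basis (Fin n) R U} (hK : QuasiIso (koszulSeqAug r e))

variable (r e) in
-- The Koszul differential takes values in I times its target, and tensoring with R/I kills these.
lemma koszulTensor_d (q : ℕ) : (koszulTensor r e).d (q + 1) q = 0 := by
  have hd : (koszulTensor r e).d (q + 1) q =
      (tensorFunctor r).map (ModuleCat.ofHom (koszulDeg (seqForm r e) q)) :=
    congrArg (fun g => (tensorFunctor r).map g) (koszulComplex_d (seqForm r e) q)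
  rw [hd]
  refine ModuleCat.hom_ext (TensorProduct.ext' fun a x => ?_)
  obtain ⟨a, rfl⟩ := Ideal.Quotient.mk_surjective a
  change (Ideal.Quotient.mk (seqIdeal r) a) ⊗ₜ[R] (koszulDeg (seqForm r e) q x) = 0
  have : Ideal.Quotient.mk (seqIdeal r) a = a • (1 : R ⧸ seqIdeal r) := by
    rw [Algebra.smul_def, mul_one]; rfl
  rw [this, ← TensorProduct.smul_tmul',
    one_tmul_eq_zero (koszulDeg_mem (seqForm r e) (seqIdeal r) (seqForm_mem r e) q x), smul_zero]

variable (r e) in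
lemma koszulTensor_d' (p q : ℕ) : (koszulTensor r e).d p q = 0 := by
  by_cases h : q + 1 = p
  · subst h; exact koszulTensor_d r e q
  · exact (koszulTensor r e).shape p q h

/-- `Tor^R(R/I, R/I)` computed by the Koszul complex. -/
noncomputable def koszulTensorIso (p : ℕ) :
    (koszulTensor r e).X p ≅ TorQ (seqIdeal r) (R ⧸ seqIdeal r) p :=
  ((koszulTensor r e).iCyclesIso p _ rfl (koszulTensor_d' r e _ _)).symm ≪≫
    ((koszulTensor r e).isoHomologyπ _ p rfl (koszulTensor_d' r e _ _)) ≪≫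
    ((koszulResolution r e hK).isoLeftDerivedObj (tensorFunctor r) p).symm

lemma oneTensor_koszulTensorIso (p : ℕ) :
    oneTensor r e p ≫ (koszulTensorIso hK p).hom = ModuleCat.ofHom (koszulClass r e hK p) := by
  have h1 : oneTensor r e p ≫
      ((koszulTensor r e).iCyclesIso p _ rfl (koszulTensor_d' r e _ _)).inv =
      (koszulTensor r e).liftCycles (oneTensor r e p) _ rfl (oneTensor_d r e p _) := by
    rw [← cancel_mono ((koszulTensor r e).iCycles p), HomologicalComplex.liftCycles_i,
      Category.assoc, HomologicalComplex.iCyclesIso_inv_hom_id, Category.comp_id]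
  change _ = (koszulTensor r e).liftCycles (oneTensor r e p) _ rfl (oneTensor_d r e p _) ≫ _
  rw [← h1]
  exact (Category.assoc _ _ _).symm

/-- `koszulTensorIso` as a linear equivalence. -/
noncomputable def koszulTensorEquiv (p : ℕ) :
    ((R ⧸ seqIdeal r) ⊗[R] ⋀[R]^p U) ≃ₗ[R] TorQ (seqIdeal r) (R ⧸ seqIdeal r) p :=
  (koszulTensorIso hK p).toLinearEquiv

lemma koszulTensorEquiv_one_tmul (p : ℕ) (x : ⋀[R]^p U) :
    koszulTensorEquiv hK p (1 ⊗ₜ x) = koszulClass r e hK p x :=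
  congrArg (fun f => f.hom x) (oneTensor_koszulTensorIso hK p)

/-- Multiplication by a on the Koszul complex lifts multiplication by a on R/I, so both sides are
the class of 1 ⊗ a x. This makes the pairing below R-bilinear. -/
lemma torMap_smul_id (a : R) (p : ℕ) (x : ⋀[R]^p U) :
    torMap (seqIdeal r) (a • LinearMap.id) p (koszulClass r e hK p x) =
      a • koszulClass r e hK p x := by
  have h := torMap_koszulClass hK (koszulResolution r e hK) (a • LinearMap.id)
    (a • 𝟙 (koszulComplex (seqForm r e))) (by
      change (a • 𝟙 ((koszulComplex (seqForm r e)).X 0)) ≫ (koszulSeqAug r e).f 0 = _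
      rw [koszulSeqAug_f_zero]
      refine ModuleCat.hom_ext (LinearMap.ext fun x => ?_)
      exact map_smul ((seqIdeal r).mkQ ∘ₗ (exteriorPower.zeroEquiv R U).toLinearMap) a x) p
  have h1 := torMap_koszulClass hK (koszulResolution r e hK) LinearMap.id
    (𝟙 (koszulComplex (seqForm r e))) (by
      change (𝟙 ((koszulComplex (seqForm r e)).X 0)) ≫ (koszulSeqAug r e).f 0 = _
      rw [Category.id_comp]
      rfl) p
  set P := koszulResolution r e hK with hP
  have h2 : ModuleCat.ofHom (a • LinearMap.id : ⋀[R]^p U →ₗ[R] ⋀[R]^p U) ≫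
      ((tensorComplex r).obj P.complex).liftCycles
        (oneTensor r e p ≫ ((tensorComplex r).map (𝟙 (koszulComplex (seqForm r e)))).f p) _ rfl
        (comp_map_f_d (tensorFunctor r) _ (oneTensor r e p) (oneTensor_d r e p _)) =
      ((tensorComplex r).obj P.complex).liftCycles
        (oneTensor r e p ≫ ((tensorComplex r).map (a • 𝟙 (koszulComplex (seqForm r e)))).f p) _ rfl
        (comp_map_f_d (tensorFunctor r) _ (oneTensor r e p) (oneTensor_d r e p _)) :=
    comp_liftCycles_eq _ rfl _ _ rfl _ _
  have h3 := congrArg (fun f => f.hom x) h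
  have h4 := congrArg (fun f => f.hom (a • x)) h1
  have h5 := congrArg (fun f => (f ≫ ((tensorComplex r).obj P.complex).homologyπ p).hom x) h2
  have h6 := (h3.trans h5.symm).trans h4.symm
  have h7 := (P.isoLeftDerivedObj (tensorFunctor r) p).toLinearEquiv.injective h6
  refine h7.trans ?_
  rw [torMap_id]
  exact map_smul (koszulClass r e hK p) a x

variable (N : Type u) [AddCommGroup N] [Module R N]

/-- The pairing `g ⊗ x ↦ g_* κ(x)`. -/
noncomputable def torPairing (p : ℕ) :
    (((R ⧸ seqIdeal r) →ₗ[R] N) ⊗[R] ⋀[R]^p U) →ₗ[R] TorQ (seqIdeal r) N p :=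
  TensorProduct.lift (LinearMap.mk₂ R (fun g x => torMap (seqIdeal r) g p (koszulClass r e hK p x))
    (fun g g' x => by rw [torMap_add]; rfl)
    (fun a g x => by
      have : a • g = g ∘ₗ (a • LinearMap.id) := by ext; simp
      rw [this, torMap_comp, LinearMap.comp_apply, torMap_smul_id, map_smul])
    (fun g x y => by rw [map_add, map_add])
    (fun a g x => by rw [map_smul, map_smul]))

lemma torPairing_tmul (p : ℕ) (g : (R ⧸ seqIdeal r) →ₗ[R] N) (x : ⋀[R]^p U) :
    torPairing hK N p (g ⊗ₜ x) = torMap (seqIdeal r) g p (koszulClass r e hK p x) := rfl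

/-- Composition with a linear map, on the homomorphisms from `R/I`. -/
def postComp (I : Ideal R) {N N' : Type u} [AddCommGroup N] [Module R N] [AddCommGroup N']
    [Module R N'] (h : N →ₗ[R] N') : ((R ⧸ I) →ₗ[R] N) →ₗ[R] ((R ⧸ I) →ₗ[R] N') where
  toFun g := h ∘ₗ g
  map_add' g g' := LinearMap.comp_add g g' h
  map_smul' a g := LinearMap.comp_smul h a g

lemma torPairing_naturality {N' : Type u} [AddCommGroup N'] [Module R N'] (h : N →ₗ[R] N') (p : ℕ)
    (y : ((R ⧸ seqIdeal r) →ₗ[R] N) ⊗[R] ⋀[R]^p U) :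
    torPairing hK N' p ((postComp (seqIdeal r) h).rTensor _ y) =
      torMap (seqIdeal r) h p (torPairing hK N p y) := by
  induction y with
  | zero => simp
  | add y z hy hz => simp only [map_add, hy, hz]
  | tmul g x =>
    rw [LinearMap.rTensor_tmul, torPairing_tmul, torPairing_tmul]
    change torMap _ (h ∘ₗ g) p _ = _
    rw [torMap_comp]; rfl

/-- Evaluation at `1` as an isomorphism from the `R`-endomorphisms of `R/I` to `R/I`. -/
noncomputable def quotEndEquiv (I : Ideal R) : ((R ⧸ I) →ₗ[R] (R ⧸ I)) ≃ₗ[R] (R ⧸ I) where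
  toFun g := g 1
  map_add' _ _ := rfl
  map_smul' _ _ := rfl
  invFun a := LinearMap.mulLeft R a
  left_inv g := by
    ext
    simp
  right_inv a := by simp

/-- Endomorphisms of R/I are multiplications by elements of R, so the pairing becomes the
identification of R/I ⊗ ⋀^p U with Tor_p coming from the vanishing of the differential. -/
lemma torPairing_quot_bijective (p : ℕ) :
    Function.Bijective (torPairing hK (R ⧸ seqIdeal r) p) := by
  have h : torPairing hK (R ⧸ seqIdeal r) p =
      (((quotEndEquiv (seqIdeal r)).rTensor (⋀[R]^p U)) ≪≫ₗ
        koszulTensorEquiv hK p).toLinearMap := by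
    refine TensorProduct.ext' fun g x => ?_
    obtain ⟨a, ha⟩ := Ideal.Quotient.mk_surjective (g 1)
    have hg : g = a • LinearMap.id := by
      refine (quotEndEquiv (seqIdeal r)).injective ?_
      change g 1 = a • (1 : R ⧸ seqIdeal r)
      rw [← ha, Algebra.smul_def, mul_one]; rfl
    rw [torPairing_tmul, hg, torMap_smul_id]
    change _ = koszulTensorEquiv hK p ((a • (1 : R ⧸ seqIdeal r)) ⊗ₜ x)
    rw [← TensorProduct.smul_tmul', map_smul, koszulTensorEquiv_one_tmul]
  rw [h]
  exact LinearEquiv.bijective _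

/-- The pairing is an isomorphism on every `N` that is a finite projective `R/I`-module. -/
lemma torPairing_bijective {κ : Type*} (s : Finset κ) (i : κ → (R ⧸ seqIdeal r) →ₗ[R] N)
    (q : κ → N →ₗ[R] (R ⧸ seqIdeal r)) (hs : ∑ k ∈ s, i k ∘ₗ q k = LinearMap.id) (p : ℕ) :
    Function.Bijective (torPairing hK N p) := by
  constructor
  · refine (injective_iff_map_eq_zero _).2 fun y hy => ?_
    -- The maps q_k move the question to R/I, where it is settled, and ∑ i_k q_k = id reassembles
    -- the answer. Surjectivity below uses the same device on Tor.
    have h1 (k : κ) : (postComp (seqIdeal r) (q k)).rTensor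
        (⋀[R]^p U) y = 0 := by
      refine (torPairing_quot_bijective hK p).1 ?_
      rw [torPairing_naturality, hy, map_zero, map_zero]
    have h2 : ∑ k ∈ s, postComp (seqIdeal r) (i k) ∘ₗ
        postComp (seqIdeal r) (q k) = LinearMap.id := by
      ext g : 1
      rw [LinearMap.sum_apply]
      have := congrArg (fun f : N →ₗ[R] N => f ∘ₗ g) hs
      refine Eq.trans ?_ this
      ext
      simp [postComp]
    have h3 := LinearMap.congr_fun (congrArg (LinearMap.rTensor (⋀[R]^p U)) h2) y
    rw [LinearMap.rTensor_id, LinearMap.id_apply] at h3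
    rw [← h3, ← LinearMap.coe_rTensorHom, map_sum, LinearMap.sum_apply]
    simp only [LinearMap.coe_rTensorHom]
    refine Finset.sum_eq_zero fun k _ => ?_
    rw [LinearMap.rTensor_comp, LinearMap.comp_apply, h1, map_zero]
  · intro t
    have h := LinearMap.congr_fun (congrArg (fun f => torMap (seqIdeal r) f p) hs) t
    simp only [torMap_id, torMap_sum, torMap_comp, LinearMap.sum_apply, LinearMap.id_apply,
      LinearMap.comp_apply] at h
    choose y hy using fun k => (torPairing_quot_bijective hK p).2 (torMap (seqIdeal r) (q k) p t)
    refine ⟨∑ k ∈ s, (postComp (seqIdeal r) (i k)).rTensor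
      (⋀[R]^p U) (y k), ?_⟩
    rw [map_sum, ← h]
    refine Finset.sum_congr rfl fun k _ => ?_
    rw [torPairing_naturality, hy]

end Pairing
end KoszulTor

namespace CategoryTheory

/-! ### Connecting homomorphisms via lifts that are chain maps up to a twist -/

section TwistedLift
variable {C : Type u} [Category.{v} C] [Abelian C]

open Horseshoe

/-- A lifting problem twisted by a chain map of degree `-1` with anticommuting squares. -/
lemma exists_twisted_lift {K : ChainComplex C ℕ} [∀ p, Projective (K.X p)] {Y : C}
    (P : ProjectiveResolution Y) (θ : ∀ p, K.X (p + 1) ⟶ P.complex.X p)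
    (hθ : ∀ p, θ (p + 1) ≫ P.complex.d (p + 1) p + K.d (p + 2) (p + 1) ≫ θ p = 0)
    (ε : K.X 0 ⟶ Y) (hε : K.d 1 0 ≫ ε + θ 0 ≫ aug P = 0) :
    ∃ h : ∀ p, K.X p ⟶ P.complex.X p, h 0 ≫ aug P = ε ∧
      ∀ p, h (p + 1) ≫ P.complex.d (p + 1) p = K.d (p + 1) p ≫ h p + θ p := by
  let h₀ : K.X 0 ⟶ P.complex.X 0 := Projective.factorThru ε (aug P)
  have h₀ε : h₀ ≫ aug P = ε := Projective.factorThru_comp _ _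
  have h₁ : (K.d 1 0 ≫ h₀ + θ 0) ≫ aug P = 0 := by
    rw [Preadditive.add_comp, Category.assoc, h₀ε, hε]
  -- Two consecutive components are carried along with their relation, because that relation is what
  -- makes the next right-hand side a cycle.
  let State (p : ℕ) := {q : (K.X p ⟶ P.complex.X p) × (K.X (p + 1) ⟶ P.complex.X (p + 1)) //
    q.2 ≫ P.complex.d (p + 1) p = K.d (p + 1) p ≫ q.1 + θ p}
  have hstep {p : ℕ} (q : State p) :
      (K.d (p + 2) (p + 1) ≫ q.1.2 + θ (p + 1)) ≫ P.complex.d (p + 1) p = 0 := by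
    rw [Preadditive.add_comp, Category.assoc, q.2, Preadditive.comp_add,
      HomologicalComplex.d_comp_d_assoc, zero_comp, zero_add]
    exact (add_comm _ _).trans (hθ p)
  let step (p : ℕ) (q : State p) : State (p + 1) :=
    ⟨(q.1.2, (P.exact_succ p).liftFromProjective _ (hstep q)),
      (P.exact_succ p).liftFromProjective_comp _ _⟩
  let seq (p : ℕ) : State p := Nat.rec
    ⟨(h₀, (aug_exact P).liftFromProjective _ h₁), (aug_exact P).liftFromProjective_comp _ _⟩ step p
  exact ⟨fun p => (seq p).1.1, h₀ε, fun p => (seq p).2⟩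

variable {D : Type w} [Category.{v} D] [Abelian D]

/-- This is the snake lemma with F h as the lift to the middle complex: x kills F(d), so the
boundary of the lift of x is the image of its composite with F θ alone. -/
lemma ResolvedSequence.liftCycles_δ {S : ShortComplex C} (T : ResolvedSequence S) (F : C ⥤ D)
    [F.Additive] {K : ChainComplex C ℕ} (h : ∀ p, K.X p ⟶ T.P₂.complex.X p)
    (θ : ∀ p, K.X (p + 1) ⟶ T.P₁.complex.X p) (k : K ⟶ T.P₃.complex)
    (hk : ∀ p, h p ≫ T.g.f p = k.f p)
    (hh : ∀ p, h (p + 1) ≫ T.P₂.complex.d (p + 1) p = K.d (p + 1) p ≫ h p + θ p ≫ T.f.f p)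
    {A : D} {p : ℕ} (x : A ⟶ F.obj (K.X (p + 1))) (hx : x ≫ F.map (K.d (p + 1) p) = 0)
    (q₃ : ℕ) (hq₃ : (ComplexShape.down ℕ).next (p + 1) = q₃)
    (hx₃ : (x ≫ F.map (k.f (p + 1))) ≫
      ((F.mapHomologicalComplex (ComplexShape.down ℕ)).obj T.P₃.complex).d (p + 1) q₃ = 0)
    (q : ℕ) (hq : (ComplexShape.down ℕ).next p = q)
    (hxθ : (x ≫ F.map (θ p)) ≫
      ((F.mapHomologicalComplex (ComplexShape.down ℕ)).obj T.P₁.complex).d p q = 0) :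
    ((F.mapHomologicalComplex (ComplexShape.down ℕ)).obj T.P₃.complex).liftCycles
        (x ≫ F.map (k.f (p + 1))) q₃ hq₃ hx₃ ≫
      ((F.mapHomologicalComplex (ComplexShape.down ℕ)).obj T.P₃.complex).homologyπ (p + 1) ≫
        (T.shortExact_map F).δ (p + 1) p rfl =
    ((F.mapHomologicalComplex (ComplexShape.down ℕ)).obj T.P₁.complex).liftCycles
        (x ≫ F.map (θ p)) q hq hxθ ≫
      ((F.mapHomologicalComplex (ComplexShape.down ℕ)).obj T.P₁.complex).homologyπ p := by
  obtain rfl : p = q₃ := by simpa using hq₃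
  refine (T.shortExact_map F).δ_eq (p + 1) p rfl (x ≫ F.map (k.f (p + 1))) hx₃
    (x ≫ F.map (h (p + 1))) ?_ (x ≫ F.map (θ p)) ?_ q hq
  · change (x ≫ F.map (h (p + 1))) ≫ F.map (T.g.f (p + 1)) = _
    rw [Category.assoc, ← F.map_comp, hk]
    rfl
  · change (x ≫ F.map (θ p)) ≫ F.map (T.f.f p) =
      (x ≫ F.map (h (p + 1))) ≫ F.map (T.P₂.complex.d (p + 1) p)
    rw [Category.assoc, Category.assoc, ← F.map_comp, ← F.map_comp, hh, F.map_add,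
      Preadditive.comp_add, F.map_comp (K.d _ _), reassoc_of% hx, zero_comp, zero_add]

lemma liftCycles_neg_sum {κ ι : Type*} [Fintype κ] {c : ComplexShape ι}
    (L : HomologicalComplex D c) {i j : ι} (hj : c.next i = j) {A : D} (x : A ⟶ L.X i)
    (y : κ → (A ⟶ L.X i)) (e : x = -∑ k, y k) (hy : ∀ k, y k ≫ L.d i j = 0) :
    ∃ hx : x ≫ L.d i j = 0, L.liftCycles x j hj hx = -∑ k, L.liftCycles (y k) j hj (hy k) := by
  have hx : x ≫ L.d i j = 0 := by
    rw [e, Preadditive.neg_comp, Preadditive.sum_comp, Finset.sum_eq_zero fun k _ => hy k, neg_zero]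
  refine ⟨hx, ?_⟩
  rw [← cancel_mono (L.iCycles i), HomologicalComplex.liftCycles_i, Preadditive.neg_comp,
    Preadditive.sum_comp]
  simpa only [HomologicalComplex.liftCycles_i] using e

/-- The connecting homomorphism of a left derived functor on the classes coming from a chain
complex `K` with anticommuting endomorphisms of degree `-1`. -/
lemma ResolvedSequence.exists_comp_δ_eq [EnoughProjectives C] {S : ShortComplex C}
    (T : ResolvedSequence S) (F : C ⥤ D)
    [F.Additive] {K : ChainComplex C ℕ} [∀ p, Projective (K.X p)] {κ : Type*} [Fintype κ]
    (b : κ → ∀ p, K.X (p + 1) ⟶ K.X p)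
    (hb : ∀ j p, b j (p + 1) ≫ K.d (p + 1) p = -(K.d (p + 2) (p + 1) ≫ b j p))
    (c : κ → (K ⟶ T.P₁.complex)) (ε : K.X 0 ⟶ S.X₂)
    (hε : K.d 1 0 ≫ ε = ∑ j, b j 0 ≫ (c j).f 0 ≫ aug T.P₁ ≫ S.f) :
    ∃ k : K ⟶ T.P₃.complex, k.f 0 ≫ T.P₃.π.f 0 = ε ≫ S.g ∧
      ∀ {A : D} {p : ℕ} (x : A ⟶ F.obj (K.X (p + 1))) (_ : x ≫ F.map (K.d (p + 1) p) = 0)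
        (hx₃ : (x ≫ F.map (k.f (p + 1))) ≫
          ((F.mapHomologicalComplex (ComplexShape.down ℕ)).obj T.P₃.complex).d (p + 1) _ = 0)
        (hx₁ : ∀ j, (x ≫ F.map (b j p) ≫ F.map ((c j).f p)) ≫
          ((F.mapHomologicalComplex (ComplexShape.down ℕ)).obj T.P₁.complex).d p _ = 0)
        (a₃ : A ⟶ (F.leftDerived (p + 1)).obj S.X₃)
        (_ : a₃ ≫ (T.P₃.isoLeftDerivedObj F (p + 1)).hom =
          ((F.mapHomologicalComplex (ComplexShape.down ℕ)).obj T.P₃.complex).liftCycles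
            (x ≫ F.map (k.f (p + 1))) _ rfl hx₃ ≫
          ((F.mapHomologicalComplex (ComplexShape.down ℕ)).obj T.P₃.complex).homologyπ (p + 1))
        (a₁ : κ → (A ⟶ (F.leftDerived p).obj S.X₁))
        (_ : ∀ j, a₁ j ≫ (T.P₁.isoLeftDerivedObj F p).hom =
          ((F.mapHomologicalComplex (ComplexShape.down ℕ)).obj T.P₁.complex).liftCycles
            (x ≫ F.map (b j p) ≫ F.map ((c j).f p)) _ rfl (hx₁ j) ≫
          ((F.mapHomologicalComplex (ComplexShape.down ℕ)).obj T.P₁.complex).homologyπ p),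
        a₃ ≫ T.δ F p = -∑ j, a₁ j := by
  -- The sign is forced by `hε`: in degree zero θ has to cancel the failure of ε to vanish on
  -- boundaries. It is the origin of the minus sign in the formula for δ.
  let θ (p : ℕ) : K.X (p + 1) ⟶ T.P₁.complex.X p := -∑ j, b j p ≫ (c j).f p
  have hθ (p : ℕ) : θ (p + 1) ≫ T.P₁.complex.d (p + 1) p + K.d (p + 2) (p + 1) ≫ θ p = 0 := by
    simp only [θ, Preadditive.neg_comp, Preadditive.comp_neg, Preadditive.sum_comp,
      Preadditive.comp_sum, Category.assoc, HomologicalComplex.Hom.comm]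
    rw [← neg_add, neg_eq_zero, ← Finset.sum_add_distrib]
    refine Finset.sum_eq_zero fun j _ => ?_
    rw [← Category.assoc, hb, Preadditive.neg_comp, Category.assoc]
    exact neg_add_cancel _
  have hf : T.f.f 0 ≫ aug T.P₂ = aug T.P₁ ≫ S.f := by
    have := congrArg (fun φ => φ.f 0) T.comm_f
    rwa [HomologicalComplex.comp_f, HomologicalComplex.comp_f,
      ChainComplex.single₀_map_f_zero] at this
  have hg : T.g.f 0 ≫ aug T.P₃ = aug T.P₂ ≫ S.g := by
    have := congrArg (fun φ => φ.f 0) T.comm_g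
    rwa [HomologicalComplex.comp_f, HomologicalComplex.comp_f,
      ChainComplex.single₀_map_f_zero] at this
  obtain ⟨h, h0, hh⟩ := exists_twisted_lift T.P₂ (fun p => θ p ≫ T.f.f p) (fun p => by
    rw [Category.assoc, HomologicalComplex.Hom.comm, ← Category.assoc, ← Category.assoc,
      ← Preadditive.add_comp, hθ, zero_comp]) ε (by
    rw [hε, Category.assoc, hf]
    simp only [θ, Preadditive.neg_comp, Preadditive.sum_comp, Category.assoc]
    exact add_neg_cancel _)
  have hgf (p : ℕ) : T.f.f p ≫ T.g.f p = 0 := congrArg (fun φ => φ.f p) T.zero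
  -- The defect of h comes from P₁, so it disappears in P₃ and h induces a genuine chain map there.
  let k : K ⟶ T.P₃.complex :=
    { f := fun p => h p ≫ T.g.f p
      comm' := by
        rintro _ p rfl
        rw [Category.assoc, HomologicalComplex.Hom.comm, ← Category.assoc, hh,
          Preadditive.add_comp, Category.assoc, Category.assoc, hgf, comp_zero, add_zero] }
  refine ⟨k, ?_, ?_⟩
  · change (h 0 ≫ T.g.f 0) ≫ aug T.P₃ = _
    rw [Category.assoc, hg, ← Category.assoc, h0]
  intro A p x hx hx₃ hx₁ a₃ ha₃ a₁ ha₁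
  have e : x ≫ F.map (θ p) = -∑ j, x ≫ F.map (b j p) ≫ F.map ((c j).f p) := by
    simp only [θ, Functor.map_neg, Functor.map_sum, Functor.map_comp, Preadditive.comp_neg,
      Preadditive.comp_sum]
  obtain ⟨hxθ, h6⟩ := liftCycles_neg_sum
    ((F.mapHomologicalComplex (ComplexShape.down ℕ)).obj T.P₁.complex)
    (rfl : (ComplexShape.down ℕ).next p = _) (x ≫ F.map (θ p)) _ e hx₁
  have h5 := T.liftCycles_δ F h θ k (fun _ => rfl) hh x hx _ rfl hx₃ _ rfl hxθ
  have h7 : ∀ {Z Z' Z₁ T T' : D} (i : T ≅ Z) (j : T' ≅ Z') (a : A ⟶ T) (l : A ⟶ Z₁) (m : Z₁ ⟶ Z)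
      (d : Z ⟶ Z') (t : A ⟶ T'), a ≫ i.hom = l ≫ m → l ≫ m ≫ d = t ≫ j.hom →
        a ≫ i.hom ≫ d ≫ j.inv = t := by
    intro Z Z' Z₁ T T' i j a l m d t h h'
    rw [← Category.assoc, ← Category.assoc, h, Iso.comp_inv_eq, Category.assoc, h']
  refine h7 (T.P₃.isoLeftDerivedObj F (p + 1)) (T.P₁.isoLeftDerivedObj F p) a₃ _ _ _ _ ha₃
    (h5.trans ?_)
  rw [h6, Preadditive.neg_comp, Preadditive.neg_comp, Preadditive.sum_comp, Preadditive.sum_comp]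
  exact congrArg Neg.neg (Finset.sum_congr rfl fun j _ => (ha₁ j).symm)

end TwistedLift
end CategoryTheory

namespace KoszulTor

lemma hom_sum_apply {R : Type*} [Ring R] {M N : ModuleCat R} {κ : Type*} (s : Finset κ)
    (g : κ → (M ⟶ N)) (z : M) : (∑ j ∈ s, g j).hom z = ∑ j ∈ s, (g j).hom z := by
  rw [ModuleCat.hom_sum, LinearMap.sum_apply]

/-! ### The connecting homomorphism on Koszul classes -/

section Delta
variable {R : Type u} [CommRing R] {U : Type u} [AddCommGroup U] [Module R U] {n : ℕ}
  {r : Fin n → R} {e : Module.Basis (Fin n) R U} (hK : QuasiIso (koszulSeqAug r e))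

variable (r e) in
lemma koszulD_seqForm (x : ExteriorAlgebra R U) :
    koszulD (seqForm r e) x = ∑ j, r j • koszulD (e.coord j) x := by
  have : seqForm r e = ∑ j, r j • e.coord j := by
    ext u
    simp [seqForm, Module.Basis.constr_apply_fintype, mul_comm]
  rw [this, koszulD_sum]

variable (r e) in
lemma koszulDeg_seqForm (p : ℕ) (x : ⋀[R]^(p + 1) U) :
    koszulDeg (seqForm r e) p x = ∑ j, r j • koszulDeg (e.coord j) p x := by
  refine Subtype.ext ?_
  rw [Submodule.coe_sum]
  exact koszulD_seqForm r e x

/-- The contraction `⋀^{p+1} U → ⋀^p U` with a coordinate form, as a morphism between terms of the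
Koszul complex. -/
noncomputable def koszulContract (r : Fin n → R) (e : Module.Basis (Fin n) R U) (j : Fin n)
    (p : ℕ) : (koszulComplex (seqForm r e)).X (p + 1) ⟶ (koszulComplex (seqForm r e)).X p :=
  ModuleCat.ofHom (koszulDeg (e.coord j) p)

lemma koszulContract_d (j : Fin n) (p : ℕ) :
    koszulContract r e j (p + 1) ≫ (koszulComplex (seqForm r e)).d (p + 1) p =
      -((koszulComplex (seqForm r e)).d (p + 2) (p + 1) ≫ koszulContract r e j p) := by
  rw [koszulComplex_d, koszulComplex_d]
  refine ModuleCat.hom_ext (LinearMap.ext fun x => Subtype.ext ?_)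
  exact koszulD_comm (seqForm r e) (e.coord j) x.1

/-- A lift to the Koszul resolution of a linear map out of `R/I`. -/
lemma exists_koszul_lift (hK : QuasiIso (koszulSeqAug r e)) {N : Type u} [AddCommGroup N]
    [Module R N] (P : ProjectiveResolution (ModuleCat.of R N)) (g : (R ⧸ seqIdeal r) →ₗ[R] N) :
    ∃ c : koszulComplex (seqForm r e) ⟶ P.complex,
      c.f 0 ≫ P.π.f 0 = (koszulSeqAug r e).f 0 ≫ ModuleCat.ofHom g := by
  refine ⟨ProjectiveResolution.lift (ModuleCat.ofHom g) (koszulResolution r e hK) P, ?_⟩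
  have := ProjectiveResolution.lift_commutes (ModuleCat.ofHom g) (koszulResolution r e hK) P
  exact congrArg (fun φ => φ.f 0) this

/-- The connecting homomorphism on Koszul classes. -/
lemma deltaDeg_torMap_koszulClass (s p : ℕ) (x : R) (hx : x ∈ seqIdeal r ^ s)
    (hrx : ∀ j, r j * x ∈ seqIdeal r ^ (s + 1)) (y : ⋀[R]^(p + 1) U) :
    deltaDeg (seqIdeal r) s p
      (torMap (seqIdeal r) (Gr.act (Gr.mk x hx)) (p + 1) (koszulClass r e hK (p + 1) y)) =
    -∑ j, torMap (seqIdeal r) (Gr.act (Gr.mk (r j * x) (hrx j))) p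
      (koszulClass r e hK p (koszulDeg (e.coord j) p y)) := by
  set I := seqIdeal r with hI
  set K := koszulComplex (seqForm r e) with hKdef
  have hproj (p : ℕ) : Projective (K.X p) := (koszulResolution r e hK).projective p
  let T : ResolvedSequence (powSequence I s) :=
    (exists_resolvedSequence (powSequence_shortExact I s)).some
  choose c hc using fun j => exists_koszul_lift (e := e) hK T.P₁ (Gr.act (Gr.mk (r j * x) (hrx j)))
  -- The map 1 ↦ x into I^s/I^{s+2} need not factor through R/I, as r_j x need not lie in I^{s+2}.
  -- The next identity measures this: d = ∑ r_j ∂_j, and r_j times the class of x comes from the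
  -- class of r_j x in I^{s+1}/I^{s+2}.
  let ε : K.X 0 ⟶ (powSequence I s).X₂ := ModuleCat.ofHom
    ((LinearMap.toSpanSingleton R (PowQuot I s (s + 2)) (Submodule.Quotient.mk ⟨x, hx⟩)) ∘ₗ
      (exteriorPower.zeroEquiv R U).toLinearMap)
  have hε : K.d 1 0 ≫ ε = ∑ j, koszulContract r e j 0 ≫ (c j).f 0 ≫ Horseshoe.aug T.P₁ ≫
      (powSequence I s).f := by
    rw [koszulComplex_d]
    have hc' (j : Fin n) : (c j).f 0 ≫ Horseshoe.aug T.P₁ ≫ (powSequence I s).f =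
        (koszulSeqAug r e).f 0 ≫ ModuleCat.ofHom (Gr.act (Gr.mk (r j * x) (hrx j))) ≫
          (powSequence I s).f :=
      ((Category.assoc _ _ _).symm.trans (congrArg (· ≫ (powSequence I s).f) (hc j))).trans
        (Category.assoc _ _ _)
    simp only [hc', koszulSeqAug_f_zero]
    refine ModuleCat.hom_ext (LinearMap.ext fun (z : ⋀[R]^(0 + 1) U) => ?_)
    refine Eq.trans ?_ (hom_sum_apply (M := K.X 1)
      (N := (powSequence I s).X₂) Finset.univ _ z).symm
    change exteriorPower.zeroEquiv R U (koszulDeg (seqForm r e) 0 z) •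
      (Submodule.Quotient.mk ⟨x, hx⟩ : PowQuot I s (s + 2)) =
      ∑ j, (powMid I s) (exteriorPower.zeroEquiv R U (koszulDeg (e.coord j) 0 z) •
        Gr.mk (r j * x) (hrx j))
    have hz := congrArg (exteriorPower.zeroEquiv R U) (koszulDeg_seqForm r e 0 z)
    rw [map_sum] at hz
    rw [hz, Finset.sum_smul]
    refine Finset.sum_congr rfl fun j _ => ?_
    rw [map_smul, map_smul, smul_eq_mul, mul_comm, mul_smul]
    rfl
  obtain ⟨k, hk, h⟩ := T.exists_comp_δ_eq (tensorFunctor r) (koszulContract r e) koszulContract_d c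
    ε hε
  have hk' : k.f 0 ≫ T.P₃.π.f 0 =
      (koszulSeqAug r e).f 0 ≫ ModuleCat.ofHom (Gr.act (Gr.mk x hx)) := by
    rw [hk, koszulSeqAug_f_zero]
    refine ModuleCat.hom_ext (LinearMap.ext fun z => ?_)
    rfl
  have h1 := torMap_koszulClass hK T.P₃ (Gr.act (Gr.mk x hx)) k hk' (p + 1)
  have h2 (j : Fin n) := torMap_koszulClass hK T.P₁ (Gr.act (Gr.mk (r j * x) (hrx j)))
    (c j) (hc j) p
  have e1 (j : Fin n) : oneTensor r e (p + 1) ≫ (tensorFunctor r).map (koszulContract r e j p) ≫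
      (tensorFunctor r).map ((c j).f p) = ModuleCat.ofHom (koszulDeg (e.coord j) p) ≫
        oneTensor r e p ≫ ((tensorComplex r).map (c j)).f p := rfl
  have hx₁ (j : Fin n) := (congrArg (· ≫ ((tensorComplex r).obj T.P₁.complex).d p
    ((ComplexShape.down ℕ).next p)) (e1 j)).trans ((Category.assoc _ _ _).trans
      ((congrArg (ModuleCat.ofHom (koszulDeg (e.coord j) p) ≫ ·)
        (comp_map_f_d (tensorFunctor r) (c j) (oneTensor r e p) (oneTensor_d r e p _))).trans
        comp_zero))
  have h8 : ∀ {A B C C' C'' D : ModuleCat.{u} R} (a : A ⟶ B) (b : B ⟶ C) (t : C ⟶ C')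
      (i : C' ⟶ C'') (l : B ⟶ D) (π : D ⟶ C'') (l' : A ⟶ D), b ≫ t ≫ i = l ≫ π → a ≫ l = l' →
        (a ≫ b ≫ t) ≫ i = l' ≫ π := by
    rintro A B C C' C'' D a b t i l π _ h rfl
    rw [Category.assoc, Category.assoc, h, Category.assoc]
  have h3 := h (oneTensor r e (p + 1)) (oneTensor_d r e (p + 1) p) _ hx₁
    (ModuleCat.ofHom (koszulClass r e hK (p + 1)) ≫
      ModuleCat.ofHom (torMap I (Gr.act (Gr.mk x hx)) (p + 1))) h1
    (fun j => ModuleCat.ofHom (koszulDeg (e.coord j) p) ≫ ModuleCat.ofHom (koszulClass r e hK p) ≫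
      ModuleCat.ofHom (torMap I (Gr.act (Gr.mk (r j * x) (hrx j))) p))
    (fun j => h8 _ _ _ _ _ _ _ (h2 j) (comp_liftCycles_eq _ rfl _ _ (e1 j).symm _ _))
  refine (congrArg (fun φ => φ.hom y) h3).trans ?_
  rw [ModuleCat.hom_neg]
  exact congrArg Neg.neg (hom_sum_apply (M := ModuleCat.of R (⋀[R]^(p + 1) U))
    (N := TorQ I (Gr I (s + 1)) p) Finset.univ (fun j =>
      ModuleCat.ofHom (koszulDeg (e.coord j) p) ≫ ModuleCat.ofHom (koszulClass r e hK p) ≫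
        ModuleCat.ofHom (torMap I (Gr.act (Gr.mk (r j * x) (hrx j))) p)) y)

end Delta

/-! ### The associated graded ring as a polynomial ring -/

section GradedEval
open MvPolynomial
variable {R : Type u} [CommRing R]

/-- The ring homomorphism from `R/I` to the degree zero part of the associated graded ring. -/
noncomputable def quotToGr (I : Ideal R) : (R ⧸ I) →+* ⨁ s, Gr I s :=
  Ideal.Quotient.lift I (algebraMap R (⨁ s, Gr I s)) fun a ha => by
    have h : Gr.mk a (Gr.mem_zero a) = (0 : Gr I 0) := by
      rw [Gr.zero_eq, Gr.mk_eq, sub_zero, zero_add, pow_one]; exact ha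
    exact (congrArg (DirectSum.of (Gr I) 0) h).trans (map_zero _)

lemma quotToGr_mk (I : Ideal R) (a : R) :
    quotToGr I (Ideal.Quotient.mk I a) = DirectSum.of (Gr I) 0 (Gr.mk a (Gr.mem_zero a)) := rfl

lemma of_mk_congr {I : Ideal R} {s t : ℕ} (h : s = t) {x y : R} (hx : x ∈ I ^ s) (hy : y ∈ I ^ t)
    (hxy : x = y) : DirectSum.of (Gr I) s (Gr.mk x hx) = DirectSum.of (Gr I) t (Gr.mk y hy) :=
  DirectSum.of_eq_of_gradedMonoid_eq (Gr.sigma_eq h hx hy hxy)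

lemma of_mk_mul_of_mk {I : Ideal R} {s t : ℕ} {x y : R} (hx : x ∈ I ^ s) (hy : y ∈ I ^ t) :
    DirectSum.of (Gr I) s (Gr.mk x hx) * DirectSum.of (Gr I) t (Gr.mk y hy) =
      DirectSum.of (Gr I) (s + t) (Gr.mk (x * y) (Gr.mul_mem hx hy)) :=
  DirectSum.of_mul_of _ _

lemma sum_of_mk {I : Ideal R} {s : ℕ} {κ : Type*} (t : Finset κ) (x : κ → R)
    (hx : ∀ k, x k ∈ I ^ s) :
    ∑ k ∈ t, Gr.mk (x k) (hx k) = Gr.mk (∑ k ∈ t, x k) (sum_mem fun k _ => hx k) := by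
  have := map_sum (Submodule.mkQ ((I ^ (s + 1) : Submodule R R).submoduleOf (I ^ s)))
    (fun k => (⟨x k, hx k⟩ : (I ^ s : Submodule R R))) t
  refine this.symm.trans (congrArg (Submodule.mkQ _) (Subtype.ext ?_))
  simp

variable {n : ℕ} (r : Fin n → R)

lemma mem_seqIdeal_pow_one (j : Fin n) : r j ∈ seqIdeal r ^ 1 := by
  rw [pow_one]; exact Ideal.subset_span ⟨j, rfl⟩

/-- The ring homomorphism sending the variables to the classes of the `r_j` in `I/I^2`. -/
noncomputable def gradedEval : MvPolynomial (Fin n) (R ⧸ seqIdeal r) →+* ⨁ s, Gr (seqIdeal r) s :=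
  eval₂Hom (quotToGr (seqIdeal r))
    fun j => DirectSum.of (Gr (seqIdeal r)) 1 (Gr.mk (r j) (mem_seqIdeal_pow_one r j))

lemma prod_pow_mem (m : Fin n → ℕ) (t : Finset (Fin n)) :
    ∏ j ∈ t, r j ^ m j ∈ seqIdeal r ^ ∑ j ∈ t, m j := by
  rw [← Finset.prod_pow_eq_pow_sum]
  exact Ideal.prod_mem_prod fun j _ =>
    Ideal.pow_mem_pow (Ideal.subset_span (Set.mem_range_self j)) _

lemma of_mk_pow (j : Fin n) (k : ℕ) (h : r j ^ k ∈ seqIdeal r ^ k) :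
    DirectSum.of (Gr (seqIdeal r)) 1 (Gr.mk (r j) (mem_seqIdeal_pow_one r j)) ^ k =
      DirectSum.of (Gr (seqIdeal r)) k (Gr.mk (r j ^ k) h) := by
  induction k with
  | zero =>
    rw [pow_zero, DirectSum.one_def]
    exact of_mk_congr rfl (Gr.mem_zero 1) h (pow_zero _).symm
  | succ k ih =>
    rw [pow_succ, ih (Ideal.pow_mem_pow (Ideal.subset_span (Set.mem_range_self j)) _),
      of_mk_mul_of_mk]
    exact of_mk_congr rfl _ _ (pow_succ _ _).symm

lemma prod_of_mk (m : Fin n → ℕ) (t : Finset (Fin n)) :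
    ∏ j ∈ t, DirectSum.of (Gr (seqIdeal r)) 1 (Gr.mk (r j) (mem_seqIdeal_pow_one r j)) ^ m j =
      DirectSum.of (Gr (seqIdeal r)) (∑ j ∈ t, m j)
        (Gr.mk (∏ j ∈ t, r j ^ m j) (prod_pow_mem r m t)) := by
  induction t using Finset.cons_induction with
  | empty =>
    rw [Finset.prod_empty, DirectSum.one_def]
    exact of_mk_congr rfl (Gr.mem_zero 1) _ Finset.prod_empty.symm
  | cons j t hj ih =>
    rw [Finset.prod_cons, ih,
      of_mk_pow r j _ (Ideal.pow_mem_pow (Ideal.subset_span (Set.mem_range_self j)) _),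
      of_mk_mul_of_mk]
    exact of_mk_congr (Finset.sum_cons hj).symm _ _
      (Finset.prod_cons (f := fun j => r j ^ m j) hj).symm

lemma gradedEval_monomial (m : Fin n →₀ ℕ) (a : R) {s : ℕ} (hs : m.degree = s)
    (h : a * ∏ j, r j ^ m j ∈ seqIdeal r ^ s) :
    gradedEval r (monomial m (Ideal.Quotient.mk _ a)) =
      DirectSum.of (Gr (seqIdeal r)) s (Gr.mk _ h) := by
  rw [gradedEval, coe_eval₂Hom, eval₂_monomial, Finsupp.prod_fintype _ _ (fun _ => pow_zero _),
    prod_of_mk, quotToGr_mk, of_mk_mul_of_mk]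
  exact of_mk_congr (by rw [← hs, zero_add, Finsupp.degree_eq_sum]) _ _ rfl

lemma coeff_mul_prod_mem {F : MvPolynomial (Fin n) R} {s : ℕ} (hF : F.IsHomogeneous s)
    (m : Fin n →₀ ℕ) : F.coeff m * ∏ j, r j ^ m j ∈ seqIdeal r ^ s := by
  by_cases h : m.degree = s
  · have := prod_pow_mem r m Finset.univ
    rw [← Finsupp.degree_eq_sum, h] at this
    exact Ideal.mul_mem_left _ _ this
  · rw [hF.coeff_eq_zero h, zero_mul]; exact zero_mem _

lemma eval_mem_pow {F : MvPolynomial (Fin n) R} {s : ℕ} (hF : F.IsHomogeneous s) :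
    eval r F ∈ seqIdeal r ^ s := by
  rw [eval_eq']
  exact sum_mem fun m _ => coeff_mul_prod_mem r hF m

lemma gradedEval_map_of_isHomogeneous {F : MvPolynomial (Fin n) R} {s : ℕ}
    (hF : F.IsHomogeneous s) (h : eval r F ∈ seqIdeal r ^ s) :
    gradedEval r (map (Ideal.Quotient.mk _) F) =
      DirectSum.of (Gr (seqIdeal r)) s (Gr.mk (eval r F) h) := by
  conv_lhs => rw [← support_sum_monomial_coeff F]
  rw [map_sum, map_sum]
  refine Eq.trans (Finset.sum_congr rfl fun m hm => ?_) ((map_sum (DirectSum.of (Gr (seqIdeal r)) s)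
    (fun m => Gr.mk _ (coeff_mul_prod_mem r hF m)) F.support).symm.trans ?_)
  · rw [map_monomial]
    exact gradedEval_monomial r m _ (by
      by_contra hne
      exact mem_support_iff.1 hm (hF.coeff_eq_zero hne)) _
  · rw [sum_of_mk]
    exact of_mk_congr rfl _ _ (eval_eq' _ _).symm

lemma gradedEval_map_apply (F : MvPolynomial (Fin n) R) (s : ℕ) :
    gradedEval r (map (Ideal.Quotient.mk _) F) s = Gr.mk (eval r (homogeneousComponent s F))
      (eval_mem_pow r (homogeneousComponent_isHomogeneous s F)) := by
  conv_lhs => rw [← sum_homogeneousComponent F]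
  rw [map_sum, map_sum, DFinsupp.finsetSum_apply]
  have h (i : ℕ) := gradedEval_map_of_isHomogeneous r (homogeneousComponent_isHomogeneous i F)
    (eval_mem_pow r (homogeneousComponent_isHomogeneous i F))
  simp only [h]
  rw [Finset.sum_eq_single s]
  · exact DirectSum.of_eq_same _ _
  · intro i _ hi
    exact DirectSum.of_eq_of_ne _ _ _ hi.symm
  -- The sum stops at the total degree of F. Beyond it the component of degree s is zero.
  · intro hs
    rw [Finset.mem_range, not_lt] at hs
    refine (DirectSum.of_eq_same _ _).trans ?_
    rw [Gr.zero_eq, Gr.mk_eq, homogeneousComponent_eq_zero _ _ hs, map_zero, sub_zero]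
    exact zero_mem _

/-- Lift the polynomial to R. If its image vanishes in degree s, the component of degree s of the
lift has value in I^{s+1}, and by quasi-regularity its coefficients die in R/I. -/
lemma gradedEval_injective (hr : ColonRegular r) : Function.Injective (gradedEval r) := by
  refine (injective_iff_map_eq_zero _).2 fun P hP => ?_
  obtain ⟨F, rfl⟩ := map_surjective _ Ideal.Quotient.mk_surjective P
  ext m
  rw [coeff_map, coeff_zero, Ideal.Quotient.eq_zero_iff_mem]
  have h := gradedEval_map_apply r F m.degree
  rw [hP, DirectSum.zero_apply] at h
  have := coeff_mem_of_eval_mem r hr (homogeneousComponent_isHomogeneous m.degree F)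
    (by simpa using (Gr.mk_eq _ _ (zero_mem _)).1 h.symm) m
  rwa [coeff_homogeneousComponent, if_pos rfl] at this

lemma exists_isHomogeneous_eval_eq {s : ℕ} {x : R} (hx : x ∈ seqIdeal r ^ s) :
    ∃ F : MvPolynomial (Fin n) R, F.IsHomogeneous s ∧ eval r F = x := by
  obtain ⟨F, hF, -, hFx⟩ := exists_homogBelow r ⊤ n s x (by rwa [Ideal.top_mul, initIdeal_top])
  refine ⟨F, fun m hm => ?_, hFx⟩
  have := (hF m hm).1
  rw [← this, Finsupp.degree_eq_weight_one]; rfl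

lemma gradedEval_surjective : Function.Surjective (gradedEval r) := by
  intro y
  induction y using DirectSum.induction_on with
  | zero => exact ⟨0, map_zero _⟩
  | of s m =>
    induction m using Gr.ind with | h x hx
    obtain ⟨F, hF, rfl⟩ := exists_isHomogeneous_eval_eq r hx
    exact ⟨_, gradedEval_map_of_isHomogeneous r hF hx⟩
  | add y z hy hz =>
    obtain ⟨P, rfl⟩ := hy
    obtain ⟨Q, rfl⟩ := hz
    exact ⟨P + Q, map_add _ _ _⟩

lemma image_gradedEval (s : ℕ) :
    gradedEval r '' (homogeneousSubmodule (Fin n) (R ⧸ seqIdeal r) s) =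
      Set.range (DirectSum.of (Gr (seqIdeal r)) s) := by
  ext y
  constructor
  · rintro ⟨P, hP, rfl⟩
    obtain ⟨F, rfl⟩ := map_surjective _ Ideal.Quotient.mk_surjective P
    -- A lift of a homogeneous polynomial need not be homogeneous, but dropping its other components
    -- does not change the reduction.
    have : MvPolynomial.map (Ideal.Quotient.mk (seqIdeal r)) F =
        MvPolynomial.map (Ideal.Quotient.mk _) (homogeneousComponent s F) := by
      ext m
      rw [coeff_map, coeff_map, coeff_homogeneousComponent]
      split_ifs with h
      · rfl
      · rw [map_zero, ← coeff_map]
        exact ((mem_homogeneousSubmodule _ _).1 hP).coeff_eq_zero h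
    rw [this, gradedEval_map_of_isHomogeneous r (homogeneousComponent_isHomogeneous s F)
      (eval_mem_pow r (homogeneousComponent_isHomogeneous s F))]
    exact ⟨_, rfl⟩
  · rintro ⟨m, rfl⟩
    induction m using Gr.ind with | h x hx
    obtain ⟨F, hF, rfl⟩ := exists_isHomogeneous_eval_eq r hx
    exact ⟨_, hF.map _, gradedEval_map_of_isHomogeneous r hF hx⟩

/-- The isomorphism of a polynomial ring over `R/I` with the associated graded ring of `R`. -/
noncomputable def gradedEquiv (hr : ColonRegular r) :
    MvPolynomial (Fin n) (R ⧸ seqIdeal r) ≃ₐ[R] ⨁ s, Gr (seqIdeal r) s :=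
  AlgEquiv.ofBijective { gradedEval r with
    commutes' := fun a => by
      change gradedEval r (C (Ideal.Quotient.mk _ a)) = _
      rw [gradedEval, coe_eval₂Hom, eval₂_C]; rfl }
    ⟨gradedEval_injective r hr, gradedEval_surjective r⟩

lemma gradedEquiv_apply (hr : ColonRegular r) (P) : gradedEquiv r hr P = gradedEval r P := rfl

/-- `I^s/I^{s+1}` is a finite projective `R/I`-module. -/
lemma exists_finite_projective_gr (hr : ColonRegular r) (s : ℕ) :
    ∃ (κ : Type) (t : Finset κ) (i : κ → (R ⧸ seqIdeal r) →ₗ[R] Gr (seqIdeal r) s)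
      (q : κ → Gr (seqIdeal r) s →ₗ[R] R ⧸ seqIdeal r),
      ∑ k ∈ t, i k ∘ₗ q k = LinearMap.id := by
  classical
  have hmem (k : {m : Fin n →₀ ℕ // m.degree = s}) : ∏ j, r j ^ k.1 j ∈ seqIdeal r ^ s := by
    have := prod_pow_mem r k.1 Finset.univ
    rwa [← Finsupp.degree_eq_sum, k.2] at this
  have hT (m : Fin n →₀ ℕ) : m ∈ Finset.univ.finsuppAntidiag s ↔ m.degree = s := by
    rw [Finset.mem_finsuppAntidiag, Finsupp.degree_eq_sum, and_iff_left (Finset.subset_univ _)]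
  let _ : Fintype {m : Fin n →₀ ℕ // m.degree = s} := Fintype.subtype _ hT
  -- The dual basis consists of the monomials of degree s in the r_j together with the coefficient
  -- functionals read through the polynomial ring.
  refine ⟨_, Finset.univ, fun k => Gr.act (Gr.mk _ (hmem k)),
    fun k => (((lcoeff (R ⧸ seqIdeal r) k.1).restrictScalars R) ∘ₗ
      (gradedEquiv r hr).symm.toLinearMap) ∘ₗ DirectSum.lof R ℕ (Gr (seqIdeal r)) s, ?_⟩
  refine LinearMap.ext fun m => ?_
  induction m using Gr.ind with | h x hx
  obtain ⟨F, hF, rfl⟩ := exists_isHomogeneous_eval_eq r hx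
  have h : (gradedEquiv r hr).symm (DirectSum.of (Gr (seqIdeal r)) s (Gr.mk (eval r F) hx)) =
      MvPolynomial.map (Ideal.Quotient.mk _) F := by
    rw [AlgEquiv.symm_apply_eq, gradedEquiv_apply, gradedEval_map_of_isHomogeneous r hF hx]
  rw [LinearMap.sum_apply]
  refine Eq.trans (Finset.sum_congr rfl (g := fun k =>
    Gr.mk (F.coeff k.1 * ∏ j, r j ^ k.1 j) (coeff_mul_prod_mem r hF k.1)) fun k _ => ?_) ?_
  · have h' : coeff k.1 ((gradedEquiv r hr).symm (DirectSum.of (Gr (seqIdeal r)) s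
        (Gr.mk (eval r F) hx))) = Ideal.Quotient.mk _ (F.coeff k.1) := by rw [h, coeff_map]
    exact congrArg (Gr.act (Gr.mk _ (hmem k))) h'
  · rw [sum_of_mk, LinearMap.id_apply, Gr.mk_eq]
    refine (sub_eq_zero.2 ?_ : _ - _ = (0 : R)) ▸ zero_mem (seqIdeal r ^ (s + 1))
    rw [eval_eq', Finset.sum_subset (s₂ := Finset.univ.finsuppAntidiag s)]
    · exact (Finset.sum_subtype _ hT fun m => F.coeff m * ∏ j, r j ^ m j).symm
    · intro m hm
      rw [hT]
      by_contra hne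
      exact mem_support_iff.1 hm (hF.coeff_eq_zero hne)
    · intro m _ hm
      rw [notMem_support_iff.1 hm, zero_mul]

end GradedEval

/-! ### Gradings and regularity in the symmetric algebra -/

section SymGraded
variable {S : Type*} [CommRing S] {W : Type*} [AddCommGroup W] [Module S W] {n : ℕ}

lemma map_range_ι_pow (f : Module.Basis (Fin n) S W) (s : ℕ) :
    (LinearMap.range (SymmetricAlgebra.ι S W) ^ s).map
      (SymmetricAlgebra.equivMvPolynomial f).toLinearMap =
        MvPolynomial.homogeneousSubmodule (Fin n) S s := by
  have h := Submodule.map_pow (LinearMap.range (SymmetricAlgebra.ι S W))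
    (SymmetricAlgebra.equivMvPolynomial f).toAlgHom s
  refine h.trans ?_
  rw [← MvPolynomial.homogeneousSubmodule_one_pow,
    MvPolynomial.homogeneousSubmodule_one_eq_span_X]
  congr 1
  rw [LinearMap.range_eq_map, ← f.span_eq, Submodule.map_span, Submodule.map_span,
    ← Set.range_comp, ← Set.range_comp]
  congr 2
  ext1 j
  exact SymmetricAlgebra.equivMvPolynomial_ι_apply f j

lemma colonRegular_ι (f : Module.Basis (Fin n) S W) :
    ColonRegular (fun j => SymmetricAlgebra.ι S W (f j)) :=
  colonRegular_map (SymmetricAlgebra.equivMvPolynomial f).symm.toRingEquiv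
    (fun j => SymmetricAlgebra.equivMvPolynomial_symm_X f j) colonRegular_X

lemma range_ι_pow_succ_le (f : Module.Basis (Fin n) S W) (s : ℕ) :
    ∀ x ∈ LinearMap.range (SymmetricAlgebra.ι S W) ^ (s + 1),
      x ∈ Ideal.span (Set.range fun j => SymmetricAlgebra.ι S W (f j)) := by
  intro x hx
  rw [pow_succ] at hx
  refine Submodule.mul_induction_on hx ?_ fun _ _ => add_mem
  rintro a - _ ⟨w, rfl⟩
  refine Ideal.mul_mem_left _ _ ?_
  rw [← f.sum_repr w, map_sum]
  refine sum_mem fun j _ => ?_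
  rw [map_smul, Algebra.smul_def]
  exact Ideal.mul_mem_left _ _ (Ideal.subset_span ⟨j, rfl⟩)

end SymGraded

/-! ### The isomorphism φ -/

section GrSym
variable {R : Type u} [CommRing R] {n : ℕ} {r : Fin n → R}
  {W : Type w} [AddCommGroup W] [Module (R ⧸ seqIdeal r) W]

/-- The isomorphism `gr_I(R) ≅ Sym_{R/I}(W)` sending the class of `r_j` to `-f_j`. -/
noncomputable def grSymEquiv (hr : ColonRegular r) (f : Module.Basis (Fin n) (R ⧸ seqIdeal r) W) :
    (⨁ s, Gr (seqIdeal r) s) ≃ₐ[R] SymmetricAlgebra (R ⧸ seqIdeal r) W :=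
  AlgEquiv.ofRingEquiv (f := (gradedEquiv r hr).symm.toRingEquiv.trans
    -- The basis is negated so that φ absorbs the minus sign of the connecting homomorphism.
    (SymmetricAlgebra.equivMvPolynomial (f.map (LinearEquiv.neg _))).symm.toRingEquiv) fun a => by
      refine (congrArg (SymmetricAlgebra.equivMvPolynomial (f.map (LinearEquiv.neg _))).symm
        ((gradedEquiv r hr).symm.commutes a)).trans ?_
      exact (SymmetricAlgebra.equivMvPolynomial (f.map (LinearEquiv.neg _))).symm.commutes
        (Ideal.Quotient.mk _ a)

lemma grSymEquiv_apply (hr : ColonRegular r) (f : Module.Basis (Fin n) (R ⧸ seqIdeal r) W) (x) :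
    grSymEquiv hr f x = (SymmetricAlgebra.equivMvPolynomial (f.map (LinearEquiv.neg _))).symm
      ((gradedEquiv r hr).symm x) := rfl

lemma grSymEquiv_of_one (hr : ColonRegular r) (f : Module.Basis (Fin n) (R ⧸ seqIdeal r) W)
    (j : Fin n) (hj : r j ∈ seqIdeal r ^ 1) :
    grSymEquiv hr f (DirectSum.of (Gr (seqIdeal r)) 1 (Gr.mk (r j) hj)) =
      -SymmetricAlgebra.ι (R ⧸ seqIdeal r) W (f j) := by
  have h : (gradedEquiv r hr).symm (DirectSum.of (Gr (seqIdeal r)) 1 (Gr.mk (r j) hj)) =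
      MvPolynomial.X j := by
    rw [AlgEquiv.symm_apply_eq, gradedEquiv_apply, gradedEval, MvPolynomial.coe_eval₂Hom,
      MvPolynomial.eval₂_X]
  rw [grSymEquiv_apply, h, SymmetricAlgebra.equivMvPolynomial_symm_X, Module.Basis.map_apply,
    LinearEquiv.neg_apply, map_neg]

lemma grSymEquiv_of_mk_mul (hr : ColonRegular r) (f : Module.Basis (Fin n) (R ⧸ seqIdeal r) W)
    (j : Fin n) {s : ℕ} {x : R} (hx : x ∈ seqIdeal r ^ s) (h : r j * x ∈ seqIdeal r ^ (s + 1)) :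
    grSymEquiv hr f (DirectSum.of (Gr (seqIdeal r)) (s + 1) (Gr.mk (r j * x) h)) =
      -(SymmetricAlgebra.ι (R ⧸ seqIdeal r) W (f j) *
        grSymEquiv hr f (DirectSum.of (Gr (seqIdeal r)) s (Gr.mk x hx))) := by
  have h' := neg_mul (SymmetricAlgebra.ι (R ⧸ seqIdeal r) W (f j))
    (grSymEquiv hr f (DirectSum.of (Gr (seqIdeal r)) s (Gr.mk x hx)))
  refine Eq.trans ?_ h'
  rw [← grSymEquiv_of_one hr f j (mem_seqIdeal_pow_one r j), ← map_mul, of_mk_mul_of_mk]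
  exact congrArg _ (of_mk_congr (add_comm s 1) _ _ rfl)

lemma image_grSymEquiv (hr : ColonRegular r) (f : Module.Basis (Fin n) (R ⧸ seqIdeal r) W)
    (s : ℕ) : grSymEquiv hr f '' Set.range (DirectSum.of (Gr (seqIdeal r)) s) =
      symPiece (seqIdeal r) W s := by
  rw [← image_gradedEval, ← map_range_ι_pow (f.map (LinearEquiv.neg (R ⧸ seqIdeal r))),
    ← Set.image_comp, Submodule.map_coe, ← Set.image_comp]
  refine (Set.image_congr fun x _ => ?_).trans (Set.image_id _)
  change (SymmetricAlgebra.equivMvPolynomial (f.map (LinearEquiv.neg _))).symm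
      ((gradedEquiv r hr).symm (gradedEquiv r hr
        (SymmetricAlgebra.equivMvPolynomial (f.map (LinearEquiv.neg _)) x))) = x
  rw [AlgEquiv.symm_apply_apply, AlgEquiv.symm_apply_apply]

lemma grSymEquiv_of_zero (hr : ColonRegular r) (f : Module.Basis (Fin n) (R ⧸ seqIdeal r) W)
    (a : R) : grSymEquiv hr f (DirectSum.of (Gr (seqIdeal r)) 0 (Gr.mk a (Gr.mem_zero a))) =
      algebraMap (R ⧸ seqIdeal r) _ (Ideal.Quotient.mk _ a) :=
  (grSymEquiv hr f).commutes a

end GrSym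

/-! ### Base change of exterior algebras and Koszul differentials -/

section ExteriorBaseChange
variable {R : Type*} [CommRing R] {U : Type*} [AddCommGroup U] [Module R U]
  (A : Type*) [CommRing A] [Algebra R A] {n : ℕ}

/-- The algebra homomorphism `Λ^R(U) → Λ^A(A ⊗ U)`. -/
noncomputable def exteriorBase : ExteriorAlgebra R U →ₐ[R] ExteriorAlgebra A (A ⊗[R] U) :=
  ExteriorAlgebra.lift R
    ⟨(ExteriorAlgebra.ι A).restrictScalars R ∘ₗ TensorProduct.mk R A U 1,
      fun u => ExteriorAlgebra.ι_sq_zero (R := A) ((1 : A) ⊗ₜ[R] u)⟩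

lemma exteriorBase_ι (u : U) : exteriorBase A (ExteriorAlgebra.ι R u) =
    ExteriorAlgebra.ι A ((1 : A) ⊗ₜ[R] u) :=
  ExteriorAlgebra.lift_ι_apply R _ _ u

lemma exteriorBase_ιMulti (p : ℕ) (v : Fin p → U) :
    exteriorBase A (ExteriorAlgebra.ιMulti R p v) =
      ExteriorAlgebra.ιMulti A p (fun i => (1 : A) ⊗ₜ[R] v i) := by
  rw [ExteriorAlgebra.ιMulti_apply, ExteriorAlgebra.ιMulti_apply, map_list_prod, List.map_ofFn]
  congr 2
  funext i
  exact exteriorBase_ι A (v i)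

/-- The basis of products of the e_j goes to the basis of products of the 1 ⊗ e_j. -/
lemma liftBaseChange_exteriorBase_bijective (e : Module.Basis (Fin n) R U) :
    Function.Bijective ((exteriorBase A).toLinearMap.liftBaseChange A :
      A ⊗[R] ExteriorAlgebra R U →ₗ[A] ExteriorAlgebra A (A ⊗[R] U)) := by
  have h : ((exteriorBase A).toLinearMap.liftBaseChange A :
      A ⊗[R] ExteriorAlgebra R U →ₗ[A] ExteriorAlgebra A (A ⊗[R] U)) =
      ((e.ExteriorAlgebra.baseChange A).equiv (e.baseChange A).ExteriorAlgebra
        (Equiv.refl _)).toLinearMap := by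
    refine (e.ExteriorAlgebra.baseChange A).ext fun s => ?_
    rw [LinearEquiv.coe_coe, Module.Basis.equiv_apply, Module.Basis.baseChange_apply,
      LinearMap.liftBaseChange_tmul, one_smul, Equiv.refl_apply, ExteriorAlgebra.basis_apply,
      ExteriorAlgebra.basis_apply]
    refine (exteriorBase_ιMulti A _ _).trans ?_
    refine congrArg (ExteriorAlgebra.ιMulti A s.card) (funext fun i => ?_)
    exact (Module.Basis.baseChange_apply A e _).symm
  rw [h]
  exact LinearEquiv.bijective _

/-- The isomorphism `A ⊗ Λ^R(U) ≅ Λ^A(A ⊗ U)`. -/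
noncomputable def exteriorBaseEquiv (e : Module.Basis (Fin n) R U) :
    A ⊗[R] ExteriorAlgebra R U ≃ₗ[A] ExteriorAlgebra A (A ⊗[R] U) :=
  LinearEquiv.ofBijective _ (liftBaseChange_exteriorBase_bijective A e)

lemma exteriorBaseEquiv_tmul (e : Module.Basis (Fin n) R U) (a : A) (x : ExteriorAlgebra R U) :
    exteriorBaseEquiv A e (a ⊗ₜ x) = a • exteriorBase A x :=
  LinearMap.liftBaseChange_tmul A (exteriorBase A).toLinearMap a x

/-- Both sides obey the same antiderivation rule under left multiplication by a vector. The right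
side involves only contractions over R, which are the ones appearing in the formula for δ. -/
lemma koszulD_exteriorBase (e : Module.Basis (Fin n) R U) (g : Fin n → A)
    (y : ExteriorAlgebra R U) :
    koszulD ((e.baseChange A).constr A g) (exteriorBase A y) =
      ∑ j, g j • exteriorBase A (koszulD (e.coord j) y) := by
  induction y using CliffordAlgebra.left_induction with
  | algebraMap a =>
    have h1 : exteriorBase A (algebraMap R (ExteriorAlgebra R U) a) =
        algebraMap A _ (algebraMap R A a) :=
      (exteriorBase A).commutes a
    have h2 (j) : koszulD (e.coord j) (algebraMap R (ExteriorAlgebra R U) a) = 0 :=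
      koszulD_algebraMap _ _
    refine (congrArg _ h1).trans ((koszulD_algebraMap _ _).trans ?_)
    refine (Finset.sum_eq_zero fun j _ => ?_).symm
    exact (congrArg (fun z => g j • exteriorBase A z) (h2 j)).trans
      (by rw [map_zero, smul_zero])
  | add x y hx hy => simp only [map_add, hx, hy, smul_add, Finset.sum_add_distrib]
  | ι_mul x u hx =>
    change koszulD _ (exteriorBase A (ExteriorAlgebra.ι R u * x)) =
      ∑ j, g j • exteriorBase A (koszulD (e.coord j) (ExteriorAlgebra.ι R u * x))
    have hu : (e.baseChange A).constr A g ((1 : A) ⊗ₜ[R] u) =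
        ∑ j, algebraMap R A (e.coord j u) * g j := by
      rw [Module.Basis.constr_apply_fintype]
      refine Finset.sum_congr rfl fun j _ => ?_
      simp [Module.Basis.equivFun_apply, Algebra.smul_def]
    rw [map_mul, exteriorBase_ι, koszulD_ι_mul, hx, hu]
    simp only [koszulD_ι_mul, map_sub, map_mul, exteriorBase_ι, smul_sub, map_smul]
    rw [Finset.sum_sub_distrib, Finset.sum_smul, Finset.mul_sum]
    congr 1
    · refine Finset.sum_congr rfl fun j _ => ?_
      rw [mul_comm, mul_smul, algebraMap_smul]
    · refine Finset.sum_congr rfl fun j _ => ?_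
      rw [mul_smul_comm]

lemma exteriorBase_mem (p : ℕ) : ∀ x ∈ ⋀[R]^p U, exteriorBase A x ∈ ⋀[A]^p (A ⊗[R] U) := by
  intro x hx
  rw [← exteriorPower.ιMulti_span_fixedDegree] at hx
  refine Submodule.span_induction ?_ ?_ ?_ ?_ hx
  · rintro _ ⟨v, rfl⟩
    rw [exteriorBase_ιMulti]
    exact ExteriorAlgebra.ιMulti_range A p ⟨_, rfl⟩
  · rw [map_zero]; exact zero_mem _
  · rintro x y - - hx hy
    rw [map_add]; exact add_mem hx hy
  · rintro c x - hx
    rw [map_smul, ← algebraMap_smul A]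
    exact Submodule.smul_mem _ _ hx

lemma smul_exteriorBase_algebraMap (a : A) (c : R) :
    a • exteriorBase A (algebraMap R (ExteriorAlgebra R U) c) =
      algebraMap A _ (algebraMap R A c * a) := by
  have h : exteriorBase A (algebraMap R (ExteriorAlgebra R U) c) =
      algebraMap A _ (algebraMap R A c) :=
    (exteriorBase A).commutes c
  rw [h, Algebra.smul_def, ← map_mul, mul_comm]

lemma smul_exteriorBase_mem (a : A) (p : ℕ) (x : ⋀[R]^p U) :
    a • exteriorBase A (x : ExteriorAlgebra R U) ∈ ⋀[A]^p (A ⊗[R] U) :=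
  Submodule.smul_mem _ _ (exteriorBase_mem A p x.1 x.2)

lemma koszul_exact_baseChange (e : Module.Basis (Fin n) R U) {g : Fin n → A} (hg : ColonRegular g)
    (p : ℕ) (x : ExteriorAlgebra A (A ⊗[R] U)) (hx : x ∈ ⋀[A]^(p + 1) (A ⊗[R] U))
    (h : koszulD ((e.baseChange A).constr A g) x = 0) :
    ∃ y, koszulD ((e.baseChange A).constr A g) y = x := by
  obtain ⟨y, -, hy⟩ := koszul_exact (e.baseChange A) hg p x hx h
  exact ⟨y, hy⟩

lemma exists_koszulD_baseChange_eq_algebraMap (e : Module.Basis (Fin n) R U) (g : Fin n → A)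
    (c : A) (hc : c ∈ Ideal.span (Set.range g)) :
    ∃ y, koszulD ((e.baseChange A).constr A g) y =
      algebraMap A (ExteriorAlgebra A (A ⊗[R] U)) c := by
  obtain ⟨y, -, hy⟩ := exists_koszulD_eq_algebraMap (e.baseChange A) g c hc
  exact ⟨y, hy⟩

end ExteriorBaseChange

/-! ### The bigraded Tor as gr_I(R) ⊗ Λ(U) -/

section GrTensor
variable {R : Type u} [CommRing R] {U : Type u} [AddCommGroup U] [Module R U] {n : ℕ}
  {r : Fin n → R} {e : Module.Basis (Fin n) R U} (hK : QuasiIso (koszulSeqAug r e))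

lemma Gr.act_one {I : Ideal R} {s : ℕ} (m : Gr I s) : Gr.act m 1 = m :=
  one_smul R m

/-- The isomorphism `I^s/I^{s+1} ≅ Hom_R(R/I, I^s/I^{s+1})`. -/
noncomputable def Gr.actEquiv (I : Ideal R) (s : ℕ) : Gr I s ≃ₗ[R] ((R ⧸ I) →ₗ[R] Gr I s) where
  toFun m := Gr.act m
  map_add' m m' := by
    refine LinearMap.ext fun a => ?_
    obtain ⟨a, rfl⟩ := Ideal.Quotient.mk_surjective a
    exact smul_add a m m'
  map_smul' c m := by
    refine LinearMap.ext fun a => ?_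
    obtain ⟨a, rfl⟩ := Ideal.Quotient.mk_surjective a
    exact smul_comm a c m
  invFun g := g 1
  left_inv m := Gr.act_one m
  right_inv g := by
    refine LinearMap.ext fun a => ?_
    obtain ⟨a, rfl⟩ := Ideal.Quotient.mk_surjective a
    refine (map_smul g a 1).symm.trans ?_
    rw [Algebra.smul_def, mul_one]; rfl

/-- The isomorphism `I^s/I^{s+1} ⊗ ⋀^p U ≅ Tor_p^R(R/I, I^s/I^{s+1})`. -/
noncomputable def grTensorEquiv (hr : ColonRegular r) (s p : ℕ) :
    Gr (seqIdeal r) s ⊗[R] ⋀[R]^p U ≃ₗ[R] TorQ (seqIdeal r) (Gr (seqIdeal r) s) p :=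
  (Gr.actEquiv (seqIdeal r) s).rTensor (⋀[R]^p U) ≪≫ₗ
    LinearEquiv.ofBijective (torPairing hK (Gr (seqIdeal r) s) p) (by
      obtain ⟨κ, t, i, q, h⟩ := exists_finite_projective_gr r hr s
      exact torPairing_bijective hK _ t i q h p)

/-- The component in bidegree `(s, p)` of `⨁_s Tor_*^R(R/I, I^s/I^{s+1})`. -/
noncomputable def torIncl (I : Ideal R) (s p : ℕ) : TorQ I (Gr I s) p →ₗ[R] TorGr I :=
  DirectSum.lof R ℕ (fun s => TorTot I (Gr I s)) s ∘ₗ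
    DirectSum.lof R ℕ (fun p => TorQ I (Gr I s) p) p

/-- The direct sum of a family of linear equivalences. -/
noncomputable def directSumCongr {κ : Type*} {M N : κ → Type*} [∀ i, AddCommMonoid (M i)]
    [∀ i, Module R (M i)] [∀ i, AddCommMonoid (N i)] [∀ i, Module R (N i)]
    (f : ∀ i, M i ≃ₗ[R] N i) : (⨁ i, M i) ≃ₗ[R] ⨁ i, N i :=
  DFinsupp.mapRange.linearEquiv f

lemma directSumCongr_lof {κ : Type*} [DecidableEq κ] {M N : κ → Type*} [∀ i, AddCommMonoid (M i)]
    [∀ i, Module R (M i)] [∀ i, AddCommMonoid (N i)] [∀ i, Module R (N i)]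
    (f : ∀ i, M i ≃ₗ[R] N i) (i : κ) (y : M i) :
    directSumCongr f (DirectSum.lof R κ M i y) = DirectSum.lof R κ N i (f i y) :=
  DFinsupp.mapRange_single (hf := fun i => map_zero (f i))

/-- The isomorphism `⨁_s Tor_*^R(R/I, I^s/I^{s+1}) ≅ gr_I(R) ⊗ Λ(U)`. -/
noncomputable def torGrEquiv (hr : ColonRegular r) :
    TorGr (seqIdeal r) ≃ₗ[R] (⨁ s, Gr (seqIdeal r) s) ⊗[R] ExteriorAlgebra R U :=
  directSumCongr (fun s => directSumCongr (fun p => (grTensorEquiv hK hr s p).symm) ≪≫ₗ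
    (TensorProduct.directSumRight R R (Gr (seqIdeal r) s) (fun p => ⋀[R]^p U)).symm) ≪≫ₗ
  (TensorProduct.directSumLeft R R (Gr (seqIdeal r)) (⨁ p, ⋀[R]^p U)).symm ≪≫ₗ
  (DirectSum.decomposeLinearEquiv (fun p => ⋀[R]^p U)).symm.lTensor _

lemma torGrEquiv_torIncl (hr : ColonRegular r) (s p : ℕ) (m : Gr (seqIdeal r) s) (x : ⋀[R]^p U) :
    torGrEquiv hK hr (torIncl (seqIdeal r) s p
      (torMap (seqIdeal r) (Gr.act m) p (koszulClass r e hK p x))) =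
      DirectSum.of (Gr (seqIdeal r)) s m ⊗ₜ (x : ExteriorAlgebra R U) := by
  have h1 : (directSumCongr (fun p => (grTensorEquiv hK hr s p).symm))
      (DirectSum.lof R ℕ (fun p => TorQ (seqIdeal r) (Gr (seqIdeal r) s) p) p
        (grTensorEquiv hK hr s p (m ⊗ₜ x))) =
      DirectSum.lof R ℕ (fun p => Gr (seqIdeal r) s ⊗[R] ⋀[R]^p U) p (m ⊗ₜ x) :=
    (directSumCongr_lof (fun p => (grTensorEquiv hK hr s p).symm) p _).trans
      (congrArg _ (LinearEquiv.symm_apply_apply _ _))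
  have h2 := TensorProduct.directSumRight_symm_lof_tmul R (S := R) (M₂ := fun p => ⋀[R]^p U) m p x
  have h3 := directSumCongr_lof (fun s => directSumCongr (fun p =>
    (grTensorEquiv hK hr s p).symm) ≪≫ₗ (TensorProduct.directSumRight R R (Gr (seqIdeal r) s)
      (fun p => ⋀[R]^p U)).symm) s (DirectSum.lof R ℕ (fun p => TorQ (seqIdeal r)
        (Gr (seqIdeal r) s) p) p (grTensorEquiv hK hr s p (m ⊗ₜ x)))
  have h4 := TensorProduct.directSumLeft_symm_lof_tmul R (S := R) (M₁ := Gr (seqIdeal r)) s m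
    (DirectSum.lof R ℕ (fun p => ⋀[R]^p U) p x)
  have h5 := h3.trans (congrArg _ ((congrArg _ h1).trans h2))
  refine (congrArg (fun z => (DirectSum.decomposeLinearEquiv (fun p => ⋀[R]^p U)).symm.lTensor _
    ((TensorProduct.directSumLeft R R (Gr (seqIdeal r)) (⨁ p, ⋀[R]^p U)).symm z)) h5).trans ?_
  refine (congrArg ((DirectSum.decomposeLinearEquiv (fun p => ⋀[R]^p U)).symm.lTensor _)
    h4).trans ?_
  refine (LinearEquiv.lTensor_tmul _ _ _ _).trans ?_
  exact congrArg _ (DirectSum.decompose_symm_of (fun p => ⋀[R]^p U) x)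

end GrTensor

/-! ### The isomorphism ψ and its bigrading -/

section Psi
variable {R : Type u} [CommRing R] {U : Type u} [AddCommGroup U] [Module R U] {n : ℕ}
  {r : Fin n → R} {e : Module.Basis (Fin n) R U} (hK : QuasiIso (koszulSeqAug r e))
  {W : Type w} [AddCommGroup W] [Module (R ⧸ seqIdeal r) W]

/-- The isomorphism from `⨁_s Tor_*^R(R/I, I^s/I^{s+1})` to the exterior algebra
`Λ^{Sym(W)}(Sym(W) ⊗ U)`. -/
noncomputable def torModelEquiv (hr : ColonRegular r)
    (f : Module.Basis (Fin n) (R ⧸ seqIdeal r) W) :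
    TorGr (seqIdeal r) ≃ₗ[R] ModelKoszul (seqIdeal r) W U :=
  torGrEquiv hK hr ≪≫ₗ (grSymEquiv hr f).toLinearEquiv.rTensor (ExteriorAlgebra R U) ≪≫ₗ
    (exteriorBaseEquiv (SymmetricAlgebra (R ⧸ seqIdeal r) W) e).restrictScalars R

lemma torModelEquiv_torIncl (hr : ColonRegular r)
    (f : Module.Basis (Fin n) (R ⧸ seqIdeal r) W) (s p : ℕ) (m : Gr (seqIdeal r) s)
    (x : ⋀[R]^p U) :
    torModelEquiv hK hr f (torIncl (seqIdeal r) s p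
      (torMap (seqIdeal r) (Gr.act m) p (koszulClass r e hK p x))) =
      grSymEquiv hr f (DirectSum.of (Gr (seqIdeal r)) s m) •
        exteriorBase (SymmetricAlgebra (R ⧸ seqIdeal r) W) (x : ExteriorAlgebra R U) := by
  refine (congrArg (fun z => exteriorBaseEquiv (SymmetricAlgebra (R ⧸ seqIdeal r) W) e
    ((grSymEquiv hr f).toLinearEquiv.rTensor (ExteriorAlgebra R U) z))
      (torGrEquiv_torIncl hK hr s p m x)).trans ?_
  refine (congrArg (exteriorBaseEquiv (SymmetricAlgebra (R ⧸ seqIdeal r) W) e)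
    (LinearEquiv.rTensor_tmul _ _ _ _)).trans ?_
  exact exteriorBaseEquiv_tmul _ e _ _

/-- Surjectivity of the pairing says that sums of classes m_* κ(x) exhaust Tor, so additive
statements need only be checked on these. -/
lemma tor_induction (hr : ColonRegular r) (s p : ℕ)
    {P : TorQ (seqIdeal r) (Gr (seqIdeal r) s) p → Prop} (zero : P 0)
    (add : ∀ x y, P x → P y → P (x + y))
    (h : ∀ (m : Gr (seqIdeal r) s) (x : ⋀[R]^p U),
      P (torMap (seqIdeal r) (Gr.act m) p (koszulClass r e hK p x))) (y) : P y := by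
  obtain ⟨z, rfl⟩ := (grTensorEquiv hK hr s p).surjective y
  induction z with
  | zero => rw [map_zero]; exact zero
  | add x y hx hy => rw [map_add]; exact add _ _ hx hy
  | tmul m x => exact h m x

lemma torGr_induction {I : Ideal R} {P : TorGr I → Prop} (zero : P 0)
    (add : ∀ x y, P x → P y → P (x + y))
    (h : ∀ s p (y : TorQ I (Gr I s) p), P (torIncl I s p y)) (x) : P x := by
  induction x using DirectSum.induction_on with
  | zero => exact zero
  | add x y hx hy => exact add _ _ hx hy
  | of s x =>
    induction x using DirectSum.induction_on with
    | zero => rw [map_zero]; exact zero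
    | add x y hx hy => rw [map_add]; exact add _ _ hx hy
    | of p y => exact h s p y

lemma torModelEquiv_map_range (hr : ColonRegular r)
    (f : Module.Basis (Fin n) (R ⧸ seqIdeal r) W) (s p : ℕ) :
    (LinearMap.range (torIncl (seqIdeal r) s p)).map
      (torModelEquiv hK hr f : TorGr (seqIdeal r) →ₗ[R] ModelKoszul (seqIdeal r) W U) =
        modelPiece (seqIdeal r) W U s p := by
  apply le_antisymm
  · rintro _ ⟨_, ⟨y, rfl⟩, rfl⟩
    refine tor_induction hK hr s p (P := fun y => torModelEquiv hK hr f
      (torIncl (seqIdeal r) s p y) ∈ modelPiece (seqIdeal r) W U s p) ?_ ?_ ?_ y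
    · simp only [map_zero, zero_mem]
    · intro x y hx hy
      simp only [map_add]
      exact add_mem hx hy
    · intro m x
      rw [torModelEquiv_torIncl]
      have hm : grSymEquiv hr f (DirectSum.of (Gr (seqIdeal r)) s m) ∈
        symPiece (seqIdeal r) W s := by
        rw [← SetLike.mem_coe, ← image_grSymEquiv hr f s]
        exact ⟨_, ⟨m, rfl⟩, rfl⟩
      obtain ⟨x, hx⟩ := x
      dsimp only
      rw [← exteriorPower.ιMulti_span_fixedDegree] at hx
      refine Submodule.span_induction ?_ ?_ ?_ ?_ hx
      · rintro _ ⟨v, rfl⟩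
        exact Submodule.subset_span ⟨_, hm, v, by rw [exteriorBase_ιMulti]⟩
      · rw [map_zero, smul_zero]; exact zero_mem _
      · rintro x y - - hx hy
        rw [map_add, smul_add]; exact add_mem hx hy
      · rintro c x - hx
        rw [map_smul, smul_comm]
        exact Submodule.smul_mem _ _ hx
  · refine Submodule.span_le.2 ?_
    rintro _ ⟨a, ha, v, rfl⟩
    rw [← SetLike.mem_coe, ← image_grSymEquiv hr f s] at ha
    obtain ⟨_, ⟨m, rfl⟩, rfl⟩ := ha
    refine ⟨_, ⟨torMap (seqIdeal r) (Gr.act m) p (koszulClass r e hK p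
      (exteriorPower.ιMulti R p v)), rfl⟩, ?_⟩
    refine (torModelEquiv_torIncl hK hr f s p m _).trans ?_
    rw [exteriorPower.ιMulti_apply_coe, exteriorBase_ιMulti]

end Psi

/-! ### Comparison of L_0 F with F -/

section LeftDerivedZero
variable {C D : Type*} [Category* C] [Category* D] [Abelian C] [Abelian D]
  (F : C ⥤ D) [F.Additive]

/-- The image under `L_0 F → F` of the class of a cycle. -/
lemma liftCycles_fromLeftDerivedZero [EnoughProjectives C] {X : C} (P : ProjectiveResolution X)
    {A : D} (x : A ⟶ ((F.mapHomologicalComplex (ComplexShape.down ℕ)).obj P.complex).X 0)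
    {q : ℕ} (hq : (ComplexShape.down ℕ).next 0 = q)
    (hx : x ≫ ((F.mapHomologicalComplex (ComplexShape.down ℕ)).obj P.complex).d 0 q = 0) :
    (((F.mapHomologicalComplex _).obj P.complex).liftCycles x q hq hx ≫
      ((F.mapHomologicalComplex _).obj P.complex).homologyπ 0 ≫
        (P.isoLeftDerivedObj F 0).inv) ≫ F.fromLeftDerivedZero.app X = x ≫ F.map (P.π.f 0) := by
  have h : ∀ {Z Z' T B : D} (i : T ≅ Z) (a : A ⟶ Z') (b : Z' ⟶ Z) (m : T ⟶ B) (k : Z ⟶ B),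
      m = i.hom ≫ k → (a ≫ b ≫ i.inv) ≫ m = a ≫ b ≫ k := by
    intro Z Z' T B i a b m k h
    rw [h, Category.assoc, Category.assoc, Iso.inv_hom_id_assoc]
  refine (h (P.isoLeftDerivedObj F 0) _ _ _ _ (P.fromLeftDerivedZero_eq F)).trans ?_
  change _ ≫ _ ≫ HomologicalComplex.homologyι _ 0 ≫ _ = _
  rw [HomologicalComplex.homology_π_ι_assoc, HomologicalComplex.liftCycles_i_assoc]
  exact congrArg _ (P.pOpcycles_comp_fromLeftDerivedZero' F)

lemma inv_app_map_fromLeftDerivedZero [EnoughProjectives C] [PreservesFiniteColimits F] {X Y : C}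
    {A : D} (g : X ⟶ Y) (x : A ⟶ F.obj X) :
    (x ≫ F.leftDerivedZeroIsoSelf.inv.app X ≫ (F.leftDerived 0).map g) ≫
      F.fromLeftDerivedZero.app Y = x ≫ F.map g := by
  rw [Category.assoc, Category.assoc, F.fromLeftDerivedZero.naturality,
    F.leftDerivedZeroIsoSelf_inv_hom_id_app_assoc]

end LeftDerivedZero

/-! ### The map η in terms of Koszul classes -/

section Eta
variable {R : Type u} [CommRing R] {U : Type u} [AddCommGroup U] [Module R U] {n : ℕ}
  {r : Fin n → R} {e : Module.Basis (Fin n) R U} (hK : QuasiIso (koszulSeqAug r e))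

/-- Tensoring is right exact, so classes in Tor_0 can be compared in R/I ⊗ R/I, where both sides
become 1 ⊗ 1. -/
lemma etaZero_one : etaZero (seqIdeal r) 1 =
    koszulClass r e hK 0 ((exteriorPower.zeroEquiv R U).symm 1) := by
  have h1 := inv_app_map_fromLeftDerivedZero (tensorFunctor r)
    (ModuleCat.ofHom (seqIdeal r).mkQ)
    (MonoidalCategory.rightUnitor (ModuleCat.of R (R ⧸ seqIdeal r))).inv
  have h2 := liftCycles_fromLeftDerivedZero (tensorFunctor r) (koszulResolution r e hK)
    (oneTensor r e 0) rfl (oneTensor_d r e 0 _)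
  have hi : Function.Injective ((tensorFunctor r).fromLeftDerivedZero.app
      (ModuleCat.of R (R ⧸ seqIdeal r))).hom :=
    (asIso ((tensorFunctor r).fromLeftDerivedZero.app
      (ModuleCat.of R (R ⧸ seqIdeal r)))).toLinearEquiv.injective
  apply hi
  refine (congrArg (fun g => g.hom (1 : R ⧸ seqIdeal r)) h1).trans ?_
  refine Eq.trans ?_ (congrArg (fun g => g.hom ((exteriorPower.zeroEquiv R U).symm 1)) h2).symm
  have h3 : (koszulResolution r e hK).π.f 0 = ModuleCat.ofHom ((seqIdeal r).mkQ ∘ₗ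
      (exteriorPower.zeroEquiv R U).toLinearMap) := koszulSeqAug_f_zero r e
  change (1 : R ⧸ seqIdeal r) ⊗ₜ[R] (seqIdeal r).mkQ 1 = (1 : R ⧸ seqIdeal r) ⊗ₜ[R]
    (((koszulResolution r e hK).π.f 0).hom ((exteriorPower.zeroEquiv R U).symm 1))
  refine congrArg (fun z => (1 : R ⧸ seqIdeal r) ⊗ₜ[R] z) ?_
  refine Eq.trans ?_ (congrArg (fun g => g.hom ((exteriorPower.zeroEquiv R U).symm 1)) h3).symm
  exact congrArg (seqIdeal r).mkQ (LinearEquiv.apply_symm_apply _ _).symm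

variable {W : Type w} [AddCommGroup W] [Module (R ⧸ seqIdeal r) W]

lemma torModelEquiv_eta (hr : ColonRegular r)
    (f : Module.Basis (Fin n) (R ⧸ seqIdeal r) W) (a : R ⧸ seqIdeal r) :
    torModelEquiv hK hr f (DirectSum.lof R ℕ (fun s => TorTot (seqIdeal r) (Gr (seqIdeal r) s)) 0
      (torTotMap (seqIdeal r) (unitGr (seqIdeal r)) (eta (seqIdeal r) a))) =
        algebraMap (SymmetricAlgebra (R ⧸ seqIdeal r) W) _
          (algebraMap (R ⧸ seqIdeal r) _ a) := by
  obtain ⟨a, rfl⟩ := Ideal.Quotient.mk_surjective a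
  have h1 : torTotMap (seqIdeal r) (unitGr (seqIdeal r))
      (eta (seqIdeal r) (Ideal.Quotient.mk _ a)) =
      DirectSum.lof R ℕ (fun p => TorQ (seqIdeal r) (Gr (seqIdeal r) 0) p) 0
        (torMap (seqIdeal r) (Gr.act (Gr.mk 1 (Gr.mem_zero 1))) 0
          (koszulClass r e hK 0 ((exteriorPower.zeroEquiv R U).symm a))) := by
    have h2 : etaZero (seqIdeal r) (Ideal.Quotient.mk _ a) =
        koszulClass r e hK 0 ((exteriorPower.zeroEquiv R U).symm a) := by
      have h3 : (Ideal.Quotient.mk (seqIdeal r) a) = a • (1 : R ⧸ seqIdeal r) := by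
        rw [Algebra.smul_def, mul_one]; rfl
      have h4 : (exteriorPower.zeroEquiv R U).symm a =
          a • (exteriorPower.zeroEquiv R U).symm 1 := by
        rw [← map_smul, smul_eq_mul, mul_one]
      rw [h3, h4]
      exact (map_smul (etaZero (seqIdeal r)) a 1).trans
        ((congrArg (fun z => a • z) (etaZero_one hK)).trans
          (map_smul (koszulClass r e hK 0) a _).symm)
    refine (DirectSum.lmap_lof (fun p => torMap (seqIdeal r) (unitGr (seqIdeal r)) p) 0 _).trans ?_
    exact congrArg (fun z => DirectSum.lof R ℕ (fun p => TorQ (seqIdeal r) (Gr (seqIdeal r) 0) p) 0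
      (torMap (seqIdeal r) (unitGr (seqIdeal r)) 0 z)) h2
  rw [h1]
  refine (torModelEquiv_torIncl hK hr f 0 0 _ _).trans ?_
  rw [grSymEquiv_of_zero, map_one, map_one, one_smul, coe_zeroEquiv_symm]
  exact (exteriorBase (SymmetricAlgebra (R ⧸ seqIdeal r) W)).commutes a

end Eta

/-! ### The total connecting homomorphism is the Koszul differential -/

section Delta
variable {R : Type u} [CommRing R]

lemma delta_lof_zero (I : Ideal R) (s : ℕ) (y) :
    delta I s (DirectSum.lof R ℕ (fun p => TorQ I (Gr I s) p) 0 y) = 0 := by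
  rw [delta, DirectSum.toModule_lof]; rfl

lemma delta_lof_succ (I : Ideal R) (s p : ℕ) (y) :
    delta I s (DirectSum.lof R ℕ (fun p => TorQ I (Gr I s) p) (p + 1) y) =
      DirectSum.lof R ℕ (fun p => TorQ I (Gr I (s + 1)) p) p (deltaDeg I s p y) := by
  rw [delta, DirectSum.toModule_lof]; rfl

lemma deltaTot_lof (I : Ideal R) (s : ℕ) (x : TorTot I (Gr I s)) :
    deltaTot I (DirectSum.lof R ℕ (fun s => TorTot I (Gr I s)) s x) =
      DirectSum.lof R ℕ (fun s => TorTot I (Gr I s)) (s + 1) (delta I s x) := by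
  rw [deltaTot, DirectSum.toModule_lof]; rfl

variable {U : Type u} [AddCommGroup U] [Module R U] {n : ℕ}
  {r : Fin n → R} {e : Module.Basis (Fin n) R U} (hK : QuasiIso (koszulSeqAug r e))
  {W : Type w} [AddCommGroup W] [Module (R ⧸ seqIdeal r) W]

/-- By additivity it suffices to treat m_* κ(x). There the minus sign in δ meets the one in φ(r_j m)
= -f_j φ(m), and what remains is the expansion of the Koszul differential in contractions. -/
lemma torModelEquiv_deltaTot (hr : ColonRegular r)
    (f : Module.Basis (Fin n) (R ⧸ seqIdeal r) W) (x : TorGr (seqIdeal r)) :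
    torModelEquiv hK hr f (deltaTot (seqIdeal r) x) = modelD e f (torModelEquiv hK hr f x) := by
  induction x using torGr_induction with
  | zero => simp only [map_zero]
  | add x y hx hy => simp only [map_add, hx, hy]
  | h s p y =>
    induction y using tor_induction hK hr s p with
    | zero => simp only [map_zero]
    | add x y hx hy => simp only [map_add, hx, hy]
    | h m x =>
      have hD (a : SymmetricAlgebra (R ⧸ seqIdeal r) W) (y : ExteriorAlgebra R U) :
          modelD e f (a • exteriorBase (SymmetricAlgebra (R ⧸ seqIdeal r) W) y) =
            a • ∑ j, SymmetricAlgebra.ι (R ⧸ seqIdeal r) W (f j) •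
              exteriorBase (SymmetricAlgebra (R ⧸ seqIdeal r) W) (koszulD (e.coord j) y) :=
        (map_smul (modelD e f) a _).trans
          (congrArg (fun z => a • z) (koszulD_exteriorBase _ e _ y))
      refine Eq.trans ?_ ((congrArg (modelD e f) (torModelEquiv_torIncl hK hr f s p m x)).trans
        (hD _ _)).symm
      -- For p = 0 both sides vanish: δ is zero on Tor_0, and the Koszul differential kills scalars.
      rcases p with _ | p
      · have h1 : deltaTot (seqIdeal r) (torIncl (seqIdeal r) s 0 (torMap (seqIdeal r) (Gr.act m) 0
            (koszulClass r e hK 0 x))) = 0 :=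
          (deltaTot_lof _ s _).trans ((congrArg _ (delta_lof_zero _ s _)).trans (map_zero _))
        rw [h1, map_zero, coe_eq_algebraMap_zeroEquiv]
        simp only [koszulD_algebraMap, map_zero, smul_zero, Finset.sum_const_zero]
      · induction m using Gr.ind with | h a ha
        have hra (j : Fin n) : r j * a ∈ seqIdeal r ^ (s + 1) := by
          rw [pow_succ']; exact Ideal.mul_mem_mul (Ideal.subset_span ⟨j, rfl⟩) ha
        have h1 : deltaTot (seqIdeal r) (torIncl (seqIdeal r) s (p + 1) (torMap (seqIdeal r)
            (Gr.act (Gr.mk a ha)) (p + 1) (koszulClass r e hK (p + 1) x))) =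
            torIncl (seqIdeal r) (s + 1) p (deltaDeg (seqIdeal r) s p (torMap (seqIdeal r)
              (Gr.act (Gr.mk a ha)) (p + 1) (koszulClass r e hK (p + 1) x))) :=
          (deltaTot_lof _ s _).trans (congrArg _ (delta_lof_succ _ s p _))
        rw [h1, deltaDeg_torMap_koszulClass hK s p a ha hra x, map_neg, map_neg, map_sum, map_sum,
          Finset.smul_sum, ← Finset.sum_neg_distrib]
        refine Finset.sum_congr rfl fun j _ => ?_
        rw [torModelEquiv_torIncl, grSymEquiv_of_mk_mul hr f j ha (hra j)]
        have h2 := neg_smul (SymmetricAlgebra.ι (R ⧸ seqIdeal r) W (f j) *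
          grSymEquiv hr f (DirectSum.of (Gr (seqIdeal r)) s (Gr.mk a ha)))
          (exteriorBase (SymmetricAlgebra (R ⧸ seqIdeal r) W)
            (koszulDeg (e.coord j) p x : ExteriorAlgebra R U))
        refine (neg_eq_iff_eq_neg.2 h2).trans ?_
        rw [mul_comm, mul_smul]
        rfl

end Delta

/-! ### Bihomogeneous components -/

section Components
variable {R : Type u} [CommRing R] (I : Ideal R)

lemma delta_apply (s : ℕ) (y : TorTot I (Gr I s)) (p : ℕ) :
    delta I s y p = deltaDeg I s p (y (p + 1)) := by
  induction y using DirectSum.induction_on with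
  | zero => simp only [map_zero, DirectSum.zero_apply]
  | add x y hx hy => simp only [map_add, DirectSum.add_apply, hx, hy]
  | of q y =>
    rcases q with _ | q
    · refine (congrArg (fun z => z p) (delta_lof_zero I s y)).trans ?_
      have h := DirectSum.of_eq_of_ne (β := fun p => TorQ I (Gr I s) p) 0 (p + 1) y (by omega)
      exact ((congrArg (deltaDeg I s p) h).trans (map_zero _)).symm
    · refine (congrArg (fun z => z p) (delta_lof_succ I s q y)).trans ?_
      by_cases h : p = q
      · subst h
        refine (DirectSum.of_eq_same _ _).trans ?_
        exact congrArg (deltaDeg I s p) (DirectSum.of_eq_same (β := fun p => TorQ I (Gr I s) p)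
          (p + 1) y).symm
      · refine (DirectSum.of_eq_of_ne _ _ _ h).trans ?_
        have h := DirectSum.of_eq_of_ne (β := fun p => TorQ I (Gr I s) p)
          (q + 1) (p + 1) y (by omega)
        exact ((congrArg (deltaDeg I s p) h).trans (map_zero _)).symm

lemma deltaTot_apply_succ (w : TorGr I) (s : ℕ) : deltaTot I w (s + 1) = delta I s (w s) := by
  induction w using DirectSum.induction_on with
  | zero => simp only [map_zero, DirectSum.zero_apply]
  | add x y hx hy => simp only [map_add, DirectSum.add_apply, hx, hy]
  | of t y =>
    refine (congrArg (fun z => z (s + 1)) (deltaTot_lof I t y)).trans ?_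
    by_cases h : s = t
    · subst h
      refine (DirectSum.of_eq_same _ _).trans ?_
      exact congrArg (delta I s) (DirectSum.of_eq_same (β := fun s => TorTot I (Gr I s)) s y).symm
    · refine (DirectSum.of_eq_of_ne _ _ _ (by omega)).trans ?_
      have h := DirectSum.of_eq_of_ne (β := fun s => TorTot I (Gr I s)) t s y h
      exact ((congrArg (delta I s) h).trans (map_zero _)).symm

lemma deltaTot_apply_zero (w : TorGr I) : deltaTot I w 0 = 0 := by
  induction w using DirectSum.induction_on with
  | zero => simp only [map_zero, DirectSum.zero_apply]
  | add x y hx hy => rw [map_add, DirectSum.add_apply, hx, hy, add_zero]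
  | of t y =>
    exact (congrArg (fun z => z 0) (deltaTot_lof I t y)).trans
      (DirectSum.of_eq_of_ne _ _ _ (Nat.succ_ne_zero t).symm)

/-- The map δ^s is homogeneous for the Tor degree, so its kernel contains the components of each of
its elements. -/
lemma deltaTot_torIncl_eq_zero {s : ℕ} {y : TorTot I (Gr I s)} (h : delta I s y = 0) (p : ℕ) :
    deltaTot I (torIncl I s p (y p)) = 0 := by
  have h1 : delta I s (DirectSum.lof R ℕ (fun p => TorQ I (Gr I s) p) p (y p)) = 0 := by
    rcases p with _ | p
    · exact delta_lof_zero I s _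
    · rw [delta_lof_succ, ← delta_apply, h]
      exact map_zero _
  exact (deltaTot_lof I s _).trans ((congrArg _ h1).trans (map_zero _))

/-- An element of a direct sum belongs to a submodule as soon as its components do. -/
lemma mem_of_lof_mem {κ : Type*} [DecidableEq κ] {M : κ → Type*} [∀ i, AddCommMonoid (M i)]
    [∀ i, Module R (M i)] (N : Submodule R (⨁ i, M i)) (y : ⨁ i, M i)
    (h : ∀ i, DirectSum.lof R κ M i (y i) ∈ N) : y ∈ N := by
  classical
  rw [← DirectSum.sum_support_of y]
  exact sum_mem fun i _ => h i

/-- `R/I → I^0/I^1` as a linear equivalence. -/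
noncomputable def unitGrEquiv : (R ⧸ I) ≃ₗ[R] Gr I 0 :=
  LinearEquiv.ofBijective (unitGr I) (by
    constructor
    · refine (injective_iff_map_eq_zero _).2 fun a ha => ?_
      obtain ⟨a, rfl⟩ := Ideal.Quotient.mk_surjective a
      have h : Gr.mk (a * 1) (Gr.mem_zero _) = Gr.mk 0 (zero_mem (I ^ 0)) := ha
      rw [Gr.mk_eq, mul_one, sub_zero, zero_add, pow_one] at h
      exact Ideal.Quotient.eq_zero_iff_mem.2 h
    · intro m
      induction m using Gr.ind with | h x hx
      refine ⟨Ideal.Quotient.mk _ x, ?_⟩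
      change Gr.mk (x * 1) (Gr.mem_zero _) = _
      rw [Gr.mk_eq, mul_one, sub_self]
      exact zero_mem _)

end Components

/-! ### Invariance of the total Tor under isomorphism -/

section TorTot
variable {R : Type u} [CommRing R] {n : ℕ} {r : Fin n → R}

lemma torTotMap_bijective {N N' : Type u} [AddCommGroup N] [Module R N] [AddCommGroup N']
    [Module R N'] (g : N ≃ₗ[R] N') : Function.Bijective (torTotMap (seqIdeal r) g.toLinearMap) := by
  have h (p : ℕ) : Function.Bijective (torMap (seqIdeal r) g.toLinearMap p) := by
    refine Function.bijective_iff_has_inverse.2 ⟨torMap (seqIdeal r) g.symm.toLinearMap p,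
      fun x => ?_, fun x => ?_⟩
    · rw [← LinearMap.comp_apply, ← torMap_comp, LinearEquiv.symm_comp, torMap_id]; rfl
    · rw [← LinearMap.comp_apply, ← torMap_comp, LinearEquiv.comp_symm, torMap_id]; rfl
  exact ⟨(DirectSum.lmap_injective _).2 fun p => (h p).1,
    (DirectSum.lmap_surjective _).2 fun p => (h p).2⟩

end TorTot

/-! ### Exactness of the sequence -/

section Exactness
variable {R : Type u} [CommRing R] {U : Type u} [AddCommGroup U] [Module R U] {n : ℕ}
  {r : Fin n → R} {e : Module.Basis (Fin n) R U}
  {W : Type w} [AddCommGroup W] [Module (R ⧸ seqIdeal r) W]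

lemma torModelEquiv_torIncl_mem (hK : QuasiIso (koszulSeqAug r e))
    (hr : ColonRegular r)
    (f : Module.Basis (Fin n) (R ⧸ seqIdeal r) W) (s p : ℕ) (y) :
    torModelEquiv hK hr f (torIncl (seqIdeal r) s p y) ∈
      ⋀[SymmetricAlgebra (R ⧸ seqIdeal r) W]^p (SymmetricAlgebra (R ⧸ seqIdeal r) W ⊗[R] U) := by
  induction y using tor_induction hK hr s p with
  | zero => simp only [map_zero, zero_mem]
  | add x y hx hy => simp only [map_add]; exact add_mem hx hy
  | h m x =>
    rw [torModelEquiv_torIncl]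
    exact smul_exteriorBase_mem (SymmetricAlgebra (R ⧸ seqIdeal r) W) _ p x

/-- The degree of c is recorded because it decides the outcome: for s > 0 it puts c in the ideal of
the f_j, and for s = 0 it makes c an element of R/I. -/
lemma torModelEquiv_torIncl_zero (hK : QuasiIso (koszulSeqAug r e))
    (hr : ColonRegular r)
    (f : Module.Basis (Fin n) (R ⧸ seqIdeal r) W) (s : ℕ) (y) :
    ∃ c ∈ symPiece (seqIdeal r) W s, torModelEquiv hK hr f (torIncl (seqIdeal r) s 0 y) =
      algebraMap (SymmetricAlgebra (R ⧸ seqIdeal r) W) _ c := by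
  induction y using tor_induction hK hr s 0 with
  | zero => exact ⟨0, zero_mem _, by simp only [map_zero]⟩
  | add x y hx hy =>
    obtain ⟨c, hc, h⟩ := hx
    obtain ⟨d, hd, h'⟩ := hy
    exact ⟨c + d, add_mem hc hd, by simp only [map_add, h, h']⟩
  | h m x =>
    have hm : grSymEquiv hr f (DirectSum.of (Gr (seqIdeal r)) s m) ∈
        symPiece (seqIdeal r) W s := by
      rw [← SetLike.mem_coe, ← image_grSymEquiv hr f s]
      exact ⟨_, ⟨m, rfl⟩, rfl⟩
    refine ⟨algebraMap R _ (exteriorPower.zeroEquiv R U x) *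
      grSymEquiv hr f (DirectSum.of (Gr (seqIdeal r)) s m), ?_, ?_⟩
    · have := Submodule.smul_mem _ (Ideal.Quotient.mk (seqIdeal r)
        (exteriorPower.zeroEquiv R U x)) hm
      rwa [Algebra.smul_def] at this
    · rw [torModelEquiv_torIncl, coe_eq_algebraMap_zeroEquiv]
      exact smul_exteriorBase_algebraMap (SymmetricAlgebra (R ⧸ seqIdeal r) W) _ _

/-- In positive exterior degree this is exactness of the Koszul complex of the regular sequence f_j.
In exterior degree zero with s > 0, elements of Sym^s lie in the ideal of the f_j and are
boundaries. Bidegree (0, 0), excluded here, carries the homology R/I. -/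
lemma exists_modelD_eq (hK : QuasiIso (koszulSeqAug r e))
    (hr : ColonRegular r) (f : Module.Basis (Fin n) (R ⧸ seqIdeal r) W)
    {s p : ℕ} (hsp : 0 < s ∨ 0 < p) (y : TorQ (seqIdeal r) (Gr (seqIdeal r) s) p)
    (h : modelD e f (torModelEquiv hK hr f (torIncl (seqIdeal r) s p y)) = 0) :
    ∃ z, modelD e f z = torModelEquiv hK hr f (torIncl (seqIdeal r) s p y) := by
  rcases p with _ | p
  · obtain ⟨s, rfl⟩ : ∃ t, s = t + 1 := ⟨s - 1, by omega⟩
    obtain ⟨c, hc, hy⟩ := torModelEquiv_torIncl_zero hK hr f (s + 1) y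
    rw [hy]
    exact exists_koszulD_baseChange_eq_algebraMap (SymmetricAlgebra (R ⧸ seqIdeal r) W) e
      (fun j => SymmetricAlgebra.ι (R ⧸ seqIdeal r) W (f j)) c (range_ι_pow_succ_le f s c hc)
  · exact koszul_exact_baseChange (SymmetricAlgebra (R ⧸ seqIdeal r) W) e (colonRegular_ι f) p _
      (torModelEquiv_torIncl_mem hK hr f s (p + 1) y) h

lemma exists_deltaTot_eq (hK : QuasiIso (koszulSeqAug r e))
    (hr : ColonRegular r) (f : Module.Basis (Fin n) (R ⧸ seqIdeal r) W)
    {s p : ℕ} (hsp : 0 < s ∨ 0 < p) {y : TorTot (seqIdeal r) (Gr (seqIdeal r) s)}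
    (h : delta (seqIdeal r) s y = 0) :
    ∃ w, deltaTot (seqIdeal r) w = torIncl (seqIdeal r) s p (y p) := by
  obtain ⟨z, hz⟩ := exists_modelD_eq hK hr f hsp (y p) (by
    rw [← torModelEquiv_deltaTot, deltaTot_torIncl_eq_zero _ h, map_zero])
  obtain ⟨w, rfl⟩ := (torModelEquiv hK hr f).surjective z
  rw [← torModelEquiv_deltaTot] at hz
  exact ⟨w, (torModelEquiv hK hr f).injective hz⟩

lemma delta_exact (hK : QuasiIso (koszulSeqAug r e))
    (hr : ColonRegular r) (f : Module.Basis (Fin n) (R ⧸ seqIdeal r) W) (s : ℕ) :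
    Function.Exact (delta (seqIdeal r) s) (delta (seqIdeal r) (s + 1)) := by
  intro y
  constructor
  · intro h
    refine mem_of_lof_mem (LinearMap.range (delta (seqIdeal r) s)) y fun p => ?_
    obtain ⟨w, hw⟩ := exists_deltaTot_eq hK hr f (p := p) (Or.inl s.succ_pos) h
    -- The preimage w need not be homogeneous. As `deltaTot` raises s by one, its component of index
    -- s already has the required image.
    refine ⟨w s, ?_⟩
    rw [← deltaTot_apply_succ, hw]
    exact DirectSum.of_eq_same (β := fun s => TorTot (seqIdeal r) (Gr (seqIdeal r) s)) _ _
  · rintro ⟨x, rfl⟩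
    have h1 : deltaTot (seqIdeal r) (deltaTot (seqIdeal r)
        (DirectSum.lof R ℕ (fun s => TorTot (seqIdeal r) (Gr (seqIdeal r) s)) s x)) = 0 := by
      apply (torModelEquiv hK hr f).injective
      rw [torModelEquiv_deltaTot, torModelEquiv_deltaTot, map_zero]
      exact koszulD_koszulD _ _
    rw [deltaTot_lof, deltaTot_lof] at h1
    exact (map_eq_zero_iff _ (DirectSum.of_injective (β := fun s =>
      TorTot (seqIdeal r) (Gr (seqIdeal r) s)) (s + 1 + 1))).1 h1

/-- After ψ the map is the composite R/I → Sym(W) → Λ of structure maps, both injective. -/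
lemma eta_injective (hK : QuasiIso (koszulSeqAug r e))
    (hr : ColonRegular r) (f : Module.Basis (Fin n) (R ⧸ seqIdeal r) W) :
    Function.Injective (eta (seqIdeal r)) := by
  refine (injective_iff_map_eq_zero _).2 fun a ha => ?_
  have h := torModelEquiv_eta hK hr f a
  rw [ha] at h
  simp only [map_zero] at h
  exact (SymmetricAlgebra.algebraMap_eq_zero_iff _ a).1
    ((ExteriorAlgebra.algebraMap_eq_zero_iff _ _).1 h.symm)

lemma eta_exact (hK : QuasiIso (koszulSeqAug r e))
    (hr : ColonRegular r) (f : Module.Basis (Fin n) (R ⧸ seqIdeal r) W) :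
    Function.Exact (eta (seqIdeal r)) (deltaZero (seqIdeal r)) := by
  have hT : Function.Bijective (torTotMap (seqIdeal r) (unitGr (seqIdeal r))) :=
    torTotMap_bijective (unitGrEquiv (seqIdeal r))
  intro x
  constructor
  · intro h
    have h' : delta (seqIdeal r) 0 (torTotMap (seqIdeal r) (unitGr (seqIdeal r)) x) = 0 := h
    -- Working after the isomorphism induced by R/I ≅ I^0/I^1 turns the claim into membership in a
    -- submodule, which can be checked one Tor degree at a time.
    suffices hx : torTotMap (seqIdeal r) (unitGr (seqIdeal r)) x ∈
        LinearMap.range (torTotMap (seqIdeal r) (unitGr (seqIdeal r)) ∘ₗ eta (seqIdeal r)) by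
      obtain ⟨a, ha⟩ := hx
      exact ⟨a, hT.1 ha⟩
    refine mem_of_lof_mem _ _ fun p => ?_
    rcases p with _ | p
    · obtain ⟨c, hc, hy⟩ := torModelEquiv_torIncl_zero hK hr f 0
        (torTotMap (seqIdeal r) (unitGr (seqIdeal r)) x 0)
      rw [symPiece, pow_zero] at hc
      obtain ⟨a, rfl⟩ := Submodule.mem_one.1 hc
      rw [← torModelEquiv_eta hK hr f a] at hy
      exact ⟨a, (DirectSum.of_injective (β := fun s =>
        TorTot (seqIdeal r) (Gr (seqIdeal r) s)) 0 ((torModelEquiv hK hr f).injective hy)).symm⟩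
    -- In positive Tor degree the component is a value of `deltaTot`, which has nothing in the
    -- summand s = 0, so the component is zero.
    · obtain ⟨w, hw⟩ := exists_deltaTot_eq hK hr f (p := p + 1) (Or.inr p.succ_pos) h'
      have h0 := (congrArg (fun z => z 0) hw).symm.trans (deltaTot_apply_zero _ w)
      have h1 := (DirectSum.of_eq_same (β := fun s => TorTot (seqIdeal r) (Gr (seqIdeal r) s))
        0 _).symm.trans h0
      exact ⟨0, (map_zero _).trans h1.symm⟩
  · rintro ⟨a, rfl⟩
    have h1 : deltaTot (seqIdeal r) (DirectSum.lof R ℕ (fun s => TorTot (seqIdeal r)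
        (Gr (seqIdeal r) s)) 0 (torTotMap (seqIdeal r) (unitGr (seqIdeal r))
          (eta (seqIdeal r) a))) = 0 := by
      apply (torModelEquiv hK hr f).injective
      rw [torModelEquiv_deltaTot, torModelEquiv_eta, map_zero]
      exact koszulD_algebraMap _ _
    rw [deltaTot_lof] at h1
    exact (map_eq_zero_iff _ (DirectSum.of_injective (β := fun s =>
      TorTot (seqIdeal r) (Gr (seqIdeal r) s)) (0 + 1))).1 h1

/-- `deltaZero` differs from `delta` at s = 0 by an isomorphism of its source, so the two have the
same range. -/
lemma deltaZero_exact (hK : QuasiIso (koszulSeqAug r e))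
    (hr : ColonRegular r) (f : Module.Basis (Fin n) (R ⧸ seqIdeal r) W) :
    Function.Exact (deltaZero (seqIdeal r)) (delta (seqIdeal r) 1) := by
  have hT : Function.Bijective (torTotMap (seqIdeal r) (unitGr (seqIdeal r))) :=
    torTotMap_bijective (unitGrEquiv (seqIdeal r))
  intro y
  refine (delta_exact hK hr f 0 y).trans ?_
  constructor
  · rintro ⟨x, rfl⟩
    obtain ⟨x, rfl⟩ := hT.2 x
    exact ⟨x, rfl⟩
  · rintro ⟨x, rfl⟩
    exact ⟨_, rfl⟩

end Exactness
end KoszulTor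

theorem mainTheorem3 {R : Type u} [CommRing R] {n : ℕ} (r : Fin n → R)
    (hr : RingTheory.Sequence.IsWeaklyRegular R (List.ofFn r))
    {U : Type u} [AddCommGroup U] [Module R U] (e : Module.Basis (Fin n) R U)
    {W : Type w} [AddCommGroup W] [Module (R ⧸ seqIdeal r) W]
    (f : Module.Basis (Fin n) (R ⧸ seqIdeal r) W) :
    ∃ (hK : QuasiIso (koszulSeqAug r e))
      (φ : (⨁ s, Gr (seqIdeal r) s) ≃ₐ[R] SymmetricAlgebra (R ⧸ seqIdeal r) W)
      (ψ : TorGr (seqIdeal r) ≃ₗ[R] ModelKoszul (seqIdeal r) W U),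
      -- `φ` is the graded algebra isomorphism sending the class of `r_j` in `I/I^2` to `-f_j`
      (∀ (j : Fin n) (hj : r j ∈ seqIdeal r ^ 1),
        φ (DirectSum.of (Gr (seqIdeal r)) 1 (Gr.mk (r j) hj)) =
          -SymmetricAlgebra.ι (R ⧸ seqIdeal r) W (f j)) ∧
      (∀ s, φ '' Set.range (DirectSum.of (Gr (seqIdeal r)) s) = symPiece (seqIdeal r) W s) ∧
      -- `ψ` is the bigraded isomorphism obtained from `φ` and from the Koszul resolution
      (∀ (s p : ℕ) (m : Gr (seqIdeal r) s) (v : Fin p → U),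
        ψ (DirectSum.lof R ℕ (fun s => TorTot (seqIdeal r) (Gr (seqIdeal r) s)) s
            (DirectSum.lof R ℕ (fun p => TorQ (seqIdeal r) (Gr (seqIdeal r) s) p) p
              (torMap (seqIdeal r) (Gr.act m) p
                (koszulClass r e hK p (exteriorPower.ιMulti R p v))))) =
          φ (DirectSum.of (Gr (seqIdeal r)) s m) •
            ExteriorAlgebra.ιMulti (SymmetricAlgebra (R ⧸ seqIdeal r) W) p
              (fun i => 1 ⊗ₜ[R] v i)) ∧
      (∀ s p : ℕ,
        (LinearMap.range (DirectSum.lof R ℕ (fun s => TorTot (seqIdeal r) (Gr (seqIdeal r) s)) s ∘ₗ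
          DirectSum.lof R ℕ (fun p => TorQ (seqIdeal r) (Gr (seqIdeal r) s) p) p)).map
            (ψ : TorGr (seqIdeal r) →ₗ[R] ModelKoszul (seqIdeal r) W U) =
          modelPiece (seqIdeal r) W U s p) ∧
      -- `δ^*` corresponds to the Koszul differential, and `η` to the inclusion of `R/I`
      (∀ x : TorGr (seqIdeal r), ψ (deltaTot (seqIdeal r) x) = modelD e f (ψ x)) ∧
      (∀ a : R ⧸ seqIdeal r,
        ψ (DirectSum.lof R ℕ (fun s => TorTot (seqIdeal r) (Gr (seqIdeal r) s)) 0
            (torTotMap (seqIdeal r) (unitGr (seqIdeal r)) (eta (seqIdeal r) a))) =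
          algebraMap (SymmetricAlgebra (R ⧸ seqIdeal r) W) _ (algebraMap (R ⧸ seqIdeal r) _ a)) ∧
      -- exactness
      Function.Injective (eta (seqIdeal r)) ∧
      Function.Exact (eta (seqIdeal r)) (deltaZero (seqIdeal r)) ∧
      Function.Exact (deltaZero (seqIdeal r)) (delta (seqIdeal r) 1) ∧
      ∀ s : ℕ, Function.Exact (delta (seqIdeal r) (s + 1)) (delta (seqIdeal r) (s + 2)) := by
  have hr' := colonRegular_of_isWeaklyRegular r hr
  have hK := quasiIso_koszulSeqAug r e hr'
  refine ⟨hK, grSymEquiv hr' f, torModelEquiv hK hr' f, grSymEquiv_of_one hr' f,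
    image_grSymEquiv hr' f, fun s p m v => ?_, torModelEquiv_map_range hK hr' f,
    torModelEquiv_deltaTot hK hr' f, torModelEquiv_eta hK hr' f, eta_injective hK hr' f,
    eta_exact hK hr' f, deltaZero_exact hK hr' f, fun s => delta_exact hK hr' f (s + 1)⟩
  refine (torModelEquiv_torIncl hK hr' f s p m _).trans ?_
  rw [exteriorPower.ιMulti_apply_coe, exteriorBase_ιMulti]
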